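/- **Theorem.** A *causal triangulation with $N\ge 1$ slices* is a finite connected plane graph $T$ (loops and multiple edges allowed), with a root vertex and a marked root edge attached to it, such that: every vertex is at graph distance at most $N$ from the root vertex, which carries no loop; for each $1\le i\le N$ the vertices at distance $i$ from the root vertex, together with the edges joining them, form a cycle $S_i$ (a loop if there is only one such vertex); the external face is bounded by $S_N$, and all other faces are triangles. Let $\mathcal T_{N,l}$ be the set of such triangulations with $l\ge 1$ vertices on $S_N$, up to orientation-preserving isomorphism of rooted plane graphs; let $V(T)$, $E(T)$ and $F(T)$ be the sets of vertices, edges and triangles of $T$, and for $\beta\ge 0$ put $$Z_{N,l}(\beta,\mu)=\sum_{T\in\mathcal T_{N,l}}\ \sum_{\sigma\in\{+1,-1\}^{V(T)}}\exp\Big(\beta\sum_{(u,v)\in E(T)}\sigma_u\sigma_v-\mu|F(T)|\Big)\in[0,\infty].$$ Let $\mu^c_{N,l}(\beta)\in[-\infty,\infty]$ be the infimum of the real $\mu$ with $Z_{N,l}(\beta,\mu)<\infty$. Then for every $\beta\ge 0$ the limit $\mu_c(\beta)=\lim_{N\to\infty}\mu^c_{N,l}(\beta)$ exists, is finite, and is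 the same for all $l\ge 1$. The function $\mu_c$ (the critical line) is monotone non-decreasing on $[0,\infty)$ and has at most countably many jumps (discontinuities), and for all $\beta\ge0$ $$\max\Big\{\tfrac32\log 2+\tfrac32\log\cosh\beta,\ \log 2+\tfrac32\beta\Big\}\ \le\ \mu_c(\beta)\ \le\ \tfrac32\log 2+\beta+\tfrac12\log\cosh\beta .$$ Consequently $\mu_c(\beta)=\log 2+\tfrac32\beta+O(e^{-2\beta})$ as $\beta\to\infty$, and $\mu_c(\beta)=\tfrac32\log 2+O(\beta)$ as $\beta\to0$, $\beta\ge 0$. -/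

import Mathlib

open Filter Topology Asymptotics

namespace CDT

noncomputable section

/-- A finite graph (loops and multiple edges allowed) drawn on an oriented closed surface, given
by its rotation system, with a marked oriented edge `root` and a distinguished face `outer`.
A dart is an oriented edge; `rev` reverses a dart; `next d` is the dart following `d` in the
counterclockwise order around the starting point of `d`. Vertices are the orbits of `next`,
edges the orbits of `rev`, and faces the orbits of `d ↦ next (rev d)`. -/
structure RootedMap where
  Dart : Type
  finite_dart : Finite Dart
  next : Equiv.Perm Dart
  rev : Equiv.Perm Dart
  rev_rev : ∀ d, rev (rev d) = d
  rev_ne : ∀ d, rev d ≠ d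
  root : Dart
  outer : Quotient (Equiv.Perm.SameCycle.setoid (next * rev))

namespace RootedMap

variable (M : RootedMap)

/-- The vertex set `V(T)`. -/
def Vertex : Type := Quotient (Equiv.Perm.SameCycle.setoid M.next)

/-- The edge set `E(T)`. -/
def Edge : Type := Quotient (Equiv.Perm.SameCycle.setoid M.rev)

/-- The set of all faces, the external face included. -/
def Face : Type := Quotient (Equiv.Perm.SameCycle.setoid (M.next * M.rev))

instance : Finite M.Dart := M.finite_dart

instance : Finite M.Vertex := Quotient.finite _

instance : Fintype M.Dart := Fintype.ofFinite _

instance : Fintype M.Vertex := Fintype.ofFinite _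

/-- The starting point of a dart. -/
def tail (d : M.Dart) : M.Vertex := Quotient.mk _ d

/-- The end point of a dart. -/
def head (d : M.Dart) : M.Vertex := M.tail (M.rev d)

/-- The face along whose boundary a dart runs. -/
def face (d : M.Dart) : M.Face := Quotient.mk _ d

/-- The external face. -/
def outerFace : M.Face := M.outer

/-- The number of sides of a face (an edge with the face on both sides counts twice). -/
def faceDegree (f : M.Face) : ℕ := Nat.card {d : M.Dart // M.face d = f}

/-- The root vertex: the starting point of the root edge. -/
def rootVertex : M.Vertex := M.tail M.root

/-- The adjacency graph of the vertices; it determines connectedness and graph distance. -/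
def graph : SimpleGraph M.Vertex where
  Adj u v := u ≠ v ∧ ∃ d, M.tail d = u ∧ M.head d = v
  symm := ⟨by
    rintro u v ⟨h, d, rfl, rfl⟩
    exact ⟨h.symm, M.rev d, rfl, by simp [head, M.rev_rev]⟩⟩
  loopless := ⟨fun _ h => h.1 rfl⟩

/-- The graph distance of a vertex from the root vertex. -/
def height (v : M.Vertex) : ℕ := M.graph.dist M.rootVertex v

/-- The map is connected and has genus zero (Euler's formula `|V| - |E| + |F| = 2`), i.e. it is
drawn on the sphere; equivalently, in the plane, with `outerFace` as the external face. -/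
def IsPlanar : Prop :=
  M.graph.Connected ∧
    (Nat.card M.Vertex : ℤ) - Nat.card M.Edge + Nat.card M.Face = 2

/-- The vertices at distance `i` from the root together with all edges joining two of them form a
cycle: `c 0, …, c (n - 1)` is a closed path that visits every such vertex exactly once and
runs through every such edge exactly once. (A cycle of length one is a loop, a cycle of
length two is a pair of parallel edges.) -/
def SliceIsCycle (i : ℕ) : Prop :=
  ∃ (n : ℕ) (c : ZMod n → M.Dart), 0 < n ∧
    (∀ k, M.head (c k) = M.tail (c (k + 1))) ∧
    Function.Injective (fun k => M.tail (c k)) ∧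
    (∀ v, M.height v = i ↔ ∃ k, M.tail (c k) = v) ∧
    (∀ j k, c j ≠ M.rev (c k)) ∧
    (∀ d, M.height (M.tail d) = i → M.height (M.head d) = i →
      ∃ k, d = c k ∨ d = M.rev (c k))

/-- `M` is a causal triangulation with the slices `S_1, …, S_N`, the last of which has `l`
vertices: a triangulated disc whose centre is the root and whose boundary is `S_N`.
(At distance `0` there is only the root vertex, without a loop.) -/
structure IsCausal (N l : ℕ) : Prop where
  planar : M.IsPlanar
  height_le : ∀ v, M.height v ≤ N
  no_root_loop : ∀ d, ¬ (M.tail d = M.rootVertex ∧ M.head d = M.rootVertex)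
  slice_cycle : ∀ i, 1 ≤ i → i ≤ N → M.SliceIsCycle i
  triangles : ∀ f, f ≠ M.outerFace → M.faceDegree f = 3
  outer_boundary : ∀ d, M.face d = M.outerFace → M.height (M.tail d) = N
  card_last : Nat.card {v : M.Vertex // M.height v = N} = l

/-- `|F(T)|`, the number of triangles: all faces except the external one. -/
def numTriangles : ℕ := Nat.card {f : M.Face // f ≠ M.outerFace}

/-- The Ising Hamiltonian `H(T, σ) = - ∑_{(u,v) ∈ E(T)} σ_u σ_v`, the spins being `±1`. Every
edge consists of exactly two darts, hence the factor `1 / 2`. -/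
def hamiltonian (σ : M.Vertex → ℤˣ) : ℝ :=
  -((1 / 2 : ℝ) * ∑ d : M.Dart, ((σ (M.tail d) : ℤ) : ℝ) * ((σ (M.head d) : ℤ) : ℝ))

open Classical in
/-- `∑_{σ ∈ Ω(T)} exp (-β H(T, σ) - μ |F(T)|)`. -/
def weight (β μ : ℝ) : ℝ :=
  ∑ σ : M.Vertex → ℤˣ, Real.exp (-β * M.hamiltonian σ - μ * M.numTriangles)

/-- Isomorphism of rooted plane maps (orientation preserving). -/
def Iso (M M' : RootedMap) : Prop :=
  ∃ e : M.Dart ≃ M'.Dart,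
    (∀ d, e (M.next d) = M'.next (e d)) ∧ (∀ d, e (M.rev d) = M'.rev (e d)) ∧
    e M.root = M'.root ∧ ∀ d, M.face d = M.outerFace ↔ M'.face (e d) = M'.outerFace

theorem Iso.refl (M : RootedMap) : Iso M M :=
  ⟨Equiv.refl _, fun _ => rfl, fun _ => rfl, rfl, fun _ => Iff.rfl⟩

theorem Iso.symm {M M' : RootedMap} : Iso M M' → Iso M' M := by
  rintro ⟨e, h1, h2, h3, h4⟩
  refine ⟨e.symm, fun d => ?_, fun d => ?_, ?_, fun d => ?_⟩
  · rw [Equiv.symm_apply_eq, h1, e.apply_symm_apply]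
  · rw [Equiv.symm_apply_eq, h2, e.apply_symm_apply]
  · rw [Equiv.symm_apply_eq, h3]
  · rw [h4, e.apply_symm_apply]

theorem Iso.trans {M M' M'' : RootedMap} : Iso M M' → Iso M' M'' → Iso M M'' := by
  rintro ⟨e, h1, h2, h3, h4⟩ ⟨f, g1, g2, g3, g4⟩
  exact ⟨e.trans f, fun d => by simp [h1, g1], fun d => by simp [h2, g2], by simp [h3, g3],
    fun d => (h4 d).trans (g4 (e d))⟩

end RootedMap

/-- Isomorphism as an equivalence relation on causal triangulations. -/
instance causalSetoid (N l : ℕ) : Setoid {M : RootedMap // M.IsCausal N l} where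
  r M M' := RootedMap.Iso M.1 M'.1
  iseqv := ⟨fun M => RootedMap.Iso.refl M.1, fun h => h.symm, fun h h' => h.trans h'⟩

/-- The set `𝒯_{N,l}` of causal triangulations (up to isomorphism) with `N` slices and `l`
vertices on the last slice. -/
def Triangulations (N l : ℕ) : Type 1 := Quotient (causalSetoid N l)

/-- A map representing a causal triangulation. -/
def Triangulations.toMap {N l : ℕ} (T : Triangulations N l) : RootedMap := (Quotient.out T).1

open scoped ENNReal in
/-- The partition function `Z_{N,l}(β, μ) ∈ [0, ∞]`. -/
def partitionFunction (N l : ℕ) (β μ : ℝ) : ℝ≥0∞ :=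
  ∑' T : Triangulations N l, ENNReal.ofReal (T.toMap.weight β μ)

/-- The threshold `μ^c_{N,l}(β)`: `Z_{N,l}(β, μ)` is finite for `μ` above it and infinite for `μ`
below it. (It is `-∞` when the series has finitely many terms.) -/
def criticalValue (N l : ℕ) (β : ℝ) : EReal :=
  sInf {x : EReal | ∃ μ : ℝ, x = μ ∧ partitionFunction N l β μ < ⊤}

/-- The critical line `μ_c(β) = lim_{N → ∞} μ^c_{N,l}(β)`. The limit exists, is finite and is the
same for all `l ≥ 1`; the definition uses `l = 1`. -/
def criticalLine (β : ℝ) : ℝ := (limUnder atTop (fun N : ℕ => criticalValue N 1 β)).toReal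

end

end CDT

/-!
A causal triangulation is a pile of annular strips. Cut along the slices, it falls into the strip
around the root, a wheel of triangles, and the strips between consecutive slices. Start at the root
edge and, from slice to slice, at a determined edge upwards; then the triangles of a strip are
numbered, and the strip is described by its *word*: which of its triangles have a side in the upper
slice. The first edge is chosen so that the last triangle of every strip but the one around the root
has its side in the lower slice. Apart from this and from the number of triangles of the two kinds,
which are the sizes of the two slices, sizes and words are arbitrary, and they determine the
triangulation up to isomorphism (`SliceData.isCausal`, `RootedMap.IsCausal.iso_map`,
`SliceData.eq_of_iso`). So `𝒯_{N+1,m}` is in bijection with an explicit set of codes, in which a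
slice with `m` vertices can follow one with `n + 1` vertices in `(n + m).choose m` ways
(`Code.equivTriangulations`).

Let `A` be the number of vertices besides the root. There are `2 * A - m` triangles and
`3 * A - m` edges, `A` of them in the slices. The Ising partition function is

* at least `exp (β * (3 * A - m))`, from the constant spin configurations;
* at least `2 ^ (A + 1) * cosh β ^ (3 * A - m)`, because all terms of the high temperature
  expansion are nonnegative, which also makes it monotone in `β`;
* at most `exp (β * (2 * A - m))` times the partition functions of the slices, which are cycles;
  so it is bounded by `const * exp (2 * β * A) * (2 * cosh β) ^ A`.

Each of these bounds makes the weight of the triangulation comparable with `g ^ A`, where `g` is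
`exp (3 * β - 2 * μ)`, `2 * cosh β ^ 3 * exp (-2 * μ)` or `2 * cosh β * exp (2 * β - 2 * μ)`
respectively. The sums `B_N(m) = ∑ g ^ A` satisfy
`B_{N+1}(m) = g ^ m * ∑ n, (n + m).choose m * B_N(n + 1)`. For `g ≤ 1 / 4` they are all finite
(`Code.codeSum_le`), and for `g > 1 / 4` some of them are infinite (`Code.exists_codeSum_eq_top`).
Solving `g = 1 / 4` for `μ` gives the three bounds of the critical line.

Finally, extending a triangulation by one more slice of a given size decreases its weight at most by
a constant factor, so `μ^c_{N,l} ≤ μ^c_{N+1,l'}` for all `l` and `l'`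
(`criticalValue_le_succ`). Hence the limit exists and does not depend on `l`, and the remaining
claims follow from the bounds and from the monotonicity in `β`.
-/

namespace CDT

noncomputable section

/-! ### Cycles of permutations -/

/-- Following a cycle of a permutation of a finite set to its first element with property `p`. -/
theorem exists_first_pow {X : Type*} [Finite X] {π : Equiv.Perm X} {x y : X}
    (h : π.SameCycle x y) (p : X → Prop) (hp : p y) :
    ∃ a : ℕ, p ((π ^ a) x) ∧ ∀ b < a, ¬ p ((π ^ b) x) := by
  classical
  obtain ⟨a, ha⟩ := h.exists_nat_pow_eq
  have hex : ∃ a : ℕ, p ((π ^ a) x) := ⟨a, ha ▸ hp⟩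
  exact ⟨Nat.find hex, Nat.find_spec hex, fun b hb => Nat.find_min hex hb⟩

/-- A property that is passed on by a permutation of a finite set is constant on its cycles. -/
theorem _root_.Equiv.Perm.SameCycle.induction {X : Type*} [Finite X] {π : Equiv.Perm X} {x y : X}
    (h : π.SameCycle x y) {p : X → Prop} (hx : p x) (hp : ∀ z, p z → p (π z)) : p y := by
  obtain ⟨a, rfl⟩ := h.exists_nat_pow_eq
  induction a with
  | zero => simpa using hx
  | succ a ih => rw [pow_succ']; exact hp _ (ih ⟨a, rfl⟩)

/-- The cycles of a permutation are enumerated by a function that is constant exactly on them. -/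
def cycleQuotientEquiv {X Y : Type*} (π : Equiv.Perm X) (f : X → Y)
    (hf : ∀ x x', π.SameCycle x x' ↔ f x = f x') (hs : Function.Surjective f) :
    Quotient (Equiv.Perm.SameCycle.setoid π) ≃ Y :=
  Equiv.ofBijective (Quotient.lift f fun x x' h => (hf x x').1 h)
    ⟨by
      rintro ⟨x⟩ ⟨x'⟩ h
      exact Quotient.sound ((hf x x').2 h), fun y => by
      obtain ⟨x, rfl⟩ := hs y
      exact ⟨Quotient.mk _ x, rfl⟩⟩

namespace RootedMap

variable (M : RootedMap)

theorem tail_eq_iff {d d' : M.Dart} : M.tail d = M.tail d' ↔ M.next.SameCycle d d' :=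
  Quotient.eq (r := Equiv.Perm.SameCycle.setoid M.next)

theorem face_eq_iff {d d' : M.Dart} : M.face d = M.face d' ↔ (M.next * M.rev).SameCycle d d' :=
  Quotient.eq (r := Equiv.Perm.SameCycle.setoid (M.next * M.rev))

@[simp] theorem tail_next (d : M.Dart) : M.tail (M.next d) = M.tail d :=
  M.tail_eq_iff.2 (Equiv.Perm.sameCycle_apply_left.2 .rfl)

@[simp] theorem face_next_rev (d : M.Dart) : M.face (M.next (M.rev d)) = M.face d :=
  M.face_eq_iff.2 (Equiv.Perm.sameCycle_apply_left (f := M.next * M.rev).2 .rfl)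

theorem exists_tail (v : M.Vertex) : ∃ d, M.tail d = v := Quotient.exists_rep v

theorem exists_face (f : M.Face) : ∃ d, M.face d = f := Quotient.exists_rep f

@[simp] theorem tail_rev (d : M.Dart) : M.tail (M.rev d) = M.head d := rfl

@[simp] theorem head_rev (d : M.Dart) : M.head (M.rev d) = M.tail d := by
  simp [head, M.rev_rev]

/-- A function on the vertices that vanishes at the root only, changes by at most one along every
edge and decreases along some edge at every other vertex is the distance from the root. -/
theorem connected_and_height_eq (f : M.Vertex → ℕ) (h0 : ∀ v, f v = 0 ↔ v = M.rootVertex)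
    (hstep : ∀ d, f (M.head d) ≤ f (M.tail d) + 1)
    (hdown : ∀ v, f v ≠ 0 → ∃ d, M.tail d = v ∧ f (M.head d) + 1 = f v) :
    M.graph.Connected ∧ ∀ v, M.height v = f v := by
  have hwalk : ∀ n v, f v = n → ∃ p : M.graph.Walk M.rootVertex v, p.length = n := by
    intro n
    induction n with
    | zero =>
      intro v hv
      obtain rfl := (h0 v).1 hv
      exact ⟨.nil, rfl⟩
    | succ n ih =>
      intro v hv
      obtain ⟨d, rfl, hd⟩ := hdown v (by omega)
      obtain ⟨p, hp⟩ := ih (M.head d) (by omega)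
      have hadj : M.graph.Adj (M.head d) (M.tail d) :=
        ⟨fun h => by rw [h] at hd; omega, M.rev d, rfl, by simp⟩
      exact ⟨p.concat hadj, by simp [hp]⟩
  have hle : ∀ u v (p : M.graph.Walk u v), f v ≤ f u + p.length := by
    intro u v p
    induction p with
    | nil => simp
    | cons h p ih =>
      rw [SimpleGraph.Walk.length_cons]
      obtain ⟨-, d, hd, hd'⟩ := h
      have := hstep d
      rw [hd, hd'] at this
      omega
  have hreach : ∀ v, M.graph.Reachable M.rootVertex v := fun v =>
    ⟨(hwalk _ v rfl).choose⟩
  have hconn : M.graph.Connected :=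
    { preconnected := fun u v => (hreach u).symm.trans (hreach v)
      nonempty := ⟨M.rootVertex⟩ }
  refine ⟨hconn, fun v => le_antisymm ?_ ?_⟩
  · obtain ⟨p, hp⟩ := hwalk _ v rfl
    exact hp ▸ SimpleGraph.dist_le p
  · obtain ⟨p, hp⟩ := (hreach v).exists_walk_length_eq_dist
    have := hle _ _ p
    rw [(h0 _).2 rfl, hp, zero_add] at this
    exact this

end RootedMap

/-! ### Maps made of strips of triangles -/

/-- A sphere map cut into strips of triangles between consecutive slices. `U` is the set of
edges that join two slices, `H` the set of edges inside the slices; every `h : H` is directed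
counterclockwise and also stands for the vertex where it starts, so that the vertices are
`Option H` with `none` for the root. `rot` is the counterclockwise order of the edges within a
strip and `succ` that of the edges within a slice. The triangle between `u` and `rot u` has exactly one side in
a slice: `side u` is `Sum.inl h` if this side `h` lies in the slice below and `Sum.inr h` if it
lies in the slice above. Conversely `below h` and `above h` are the triangles on the two sides
of `h`, with `above h = none` on the last slice. -/
structure Skeleton (N : ℕ) where
  U : Type
  H : Type
  finite_U : Finite U
  finite_H : Finite H
  rot : Equiv.Perm U
  succ : Equiv.Perm H
  side : U → H ⊕ H
  above : H → Option U
  below : H → U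
  bot : U → Option H
  top : U → H
  lev : H → ℕ
  first : U
  outer : H
  side_below : ∀ h, side (below h) = .inr h
  below_of_side : ∀ u h, side u = .inr h → below h = u
  side_of_above : ∀ u h, above h = some u → side u = .inl h
  above_of_side : ∀ u h, side u = .inl h → above h = some u
  above_eq_none : ∀ h, above h = none ↔ lev h = N
  bot_of_inl : ∀ u h, side u = .inl h → bot u = some h ∧ bot (rot u) = some (succ h)
  bot_of_inr : ∀ u h, side u = .inr h → bot (rot u) = bot u
  top_of_inr : ∀ u h, side u = .inr h → top u = h ∧ top (rot u) = succ h
  top_of_inl : ∀ u h, side u = .inl h → top (rot u) = top u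
  lev_pos : ∀ h, 1 ≤ lev h
  lev_le : ∀ h, lev h ≤ N
  lev_succ : ∀ h, lev (succ h) = lev h
  lev_top : ∀ u, lev (top u) = (bot u).elim 0 lev + 1
  sameCycle_succ : ∀ h h', lev h = lev h' → succ.SameCycle h h'
  sameCycle_rot : ∀ u u', lev (top u) = lev (top u') → rot.SameCycle u u'
  exists_lev : ∀ i, 1 ≤ i → i ≤ N → ∃ h, lev h = i
  bot_first : bot first = none
  lev_outer : lev outer = N

namespace Skeleton

variable {N : ℕ} (K : Skeleton N)

instance : Finite K.U := K.finite_U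
instance : Finite K.H := K.finite_H

/-- The darts of the map of a skeleton: the two orientations of every edge. -/
inductive Dart
  | up (u : K.U)
  | dn (u : K.U)
  | fwd (h : K.H)
  | bwd (h : K.H)

/-- The darts in terms of the edges. -/
def dartEquiv : K.Dart ≃ (K.U ⊕ K.U) ⊕ (K.H ⊕ K.H) where
  toFun
    | .up u => .inl (.inl u)
    | .dn u => .inl (.inr u)
    | .fwd h => .inr (.inl h)
    | .bwd h => .inr (.inr h)
  invFun
    | .inl (.inl u) => .up u
    | .inl (.inr u) => .dn u
    | .inr (.inl h) => .fwd h
    | .inr (.inr h) => .bwd h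
  left_inv := by rintro (u | u | h | h) <;> rfl
  right_inv := by rintro ((u | u) | (h | h)) <;> rfl

instance : Finite K.Dart := Finite.of_equiv _ K.dartEquiv.symm

/-- The next dart around a vertex. At a vertex of a slice the counterclockwise order is: the
edges upwards, the forward edge, the edges downwards, the backward edge. -/
def nextFun : K.Dart → K.Dart
  | .up u => (K.side u).elim .fwd fun _ => .up (K.rot u)
  | .fwd h => .dn (K.below h)
  | .dn u => (K.side (K.rot.symm u)).elim (fun _ => .dn (K.rot.symm u)) .bwd
  | .bwd h => (K.above h).elim (.fwd (K.succ h)) fun u => .up (K.rot u)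

/-- The previous dart around a vertex. -/
def prevFun : K.Dart → K.Dart
  | .up u => (K.side (K.rot.symm u)).elim .bwd fun _ => .up (K.rot.symm u)
  | .fwd h => (K.above h).elim (.bwd (K.succ.symm h)) .up
  | .dn u => (K.side u).elim (fun _ => .dn (K.rot u)) .fwd
  | .bwd h => .dn (K.rot (K.below h))

theorem above_succ_eq_none {h : K.H} (hh : K.above h = none) : K.above (K.succ h) = none := by
  rw [K.above_eq_none] at *
  rw [K.lev_succ, hh]

theorem above_succ_symm_eq_none {h : K.H} (hh : K.above h = none) :
    K.above (K.succ.symm h) = none := by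
  rw [K.above_eq_none] at *
  rw [← K.lev_succ, Equiv.apply_symm_apply, hh]

theorem prev_next (d : K.Dart) : K.prevFun (K.nextFun d) = d := by
  rcases d with u | u | h | h
  · rcases hs : K.side u with h | h
    · simp [nextFun, prevFun, hs, K.above_of_side _ _ hs]
    · simp [nextFun, prevFun, hs]
  · rcases hs : K.side (K.rot.symm u) with h | h
    · simp [nextFun, prevFun, hs]
    · simp [nextFun, prevFun, hs, K.below_of_side _ _ hs]
  · simp [nextFun, prevFun, K.side_below]
  · rcases hs : K.above h with _ | u
    · simp [nextFun, prevFun, hs, K.above_succ_eq_none hs]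
    · simp [nextFun, prevFun, hs, K.side_of_above _ _ hs]

theorem next_prev (d : K.Dart) : K.nextFun (K.prevFun d) = d := by
  rcases d with u | u | h | h
  · rcases hs : K.side (K.rot.symm u) with h | h
    · simp [nextFun, prevFun, hs, K.above_of_side _ _ hs]
    · simp [nextFun, prevFun, hs]
  · rcases hs : K.side u with h | h
    · simp [nextFun, prevFun, hs]
    · simp [nextFun, prevFun, hs, K.below_of_side _ _ hs]
  · rcases hs : K.above h with _ | u
    · simp [nextFun, prevFun, hs, K.above_succ_symm_eq_none hs]
    · simp [nextFun, prevFun, hs, K.side_of_above _ _ hs]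
  · simp [nextFun, prevFun, K.side_below]

/-- Reversal of the darts. -/
def revFun : K.Dart → K.Dart
  | .up u => .dn u
  | .dn u => .up u
  | .fwd h => .bwd h
  | .bwd h => .fwd h

theorem rev_rev (d : K.Dart) : K.revFun (K.revFun d) = d := by
  rcases d with u | u | h | h <;> rfl

/-- `Skeleton.nextFun` as a permutation. -/
def next : Equiv.Perm K.Dart := ⟨K.nextFun, K.prevFun, K.prev_next, K.next_prev⟩

/-- `Skeleton.revFun` as a permutation. -/
def rev : Equiv.Perm K.Dart := ⟨K.revFun, K.revFun, K.rev_rev, K.rev_rev⟩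

/-- The map of a skeleton. -/
abbrev map : RootedMap where
  Dart := K.Dart
  finite_dart := inferInstance
  next := K.next
  rev := K.rev
  rev_rev := K.rev_rev
  rev_ne := by rintro (u | u | h | h) <;> simp [rev, revFun]
  root := .up K.first
  outer := Quotient.mk _ (.fwd K.outer)

theorem next_apply (d : K.Dart) : K.next d = K.nextFun d := rfl

theorem next_up_inl {u : K.U} {h : K.H} (hs : K.side u = .inl h) :
    K.map.next (.up u) = Dart.fwd h := by
  simp [next_apply, nextFun, hs]

theorem next_up_inr {u : K.U} {h : K.H} (hs : K.side u = .inr h) :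
    K.map.next (.up u) = Dart.up (K.rot u) := by
  simp [next_apply, nextFun, hs]

theorem next_fwd (h : K.H) : K.map.next (.fwd h) = Dart.dn (K.below h) := rfl

theorem next_dn_inl {u : K.U} {h : K.H} (hs : K.side u = .inl h) :
    K.map.next (.dn (K.rot u)) = Dart.dn u := by
  simp [next_apply, nextFun, hs]

theorem next_dn_inr {u : K.U} {h : K.H} (hs : K.side u = .inr h) :
    K.map.next (.dn (K.rot u)) = Dart.bwd h := by
  simp [next_apply, nextFun, hs]

theorem next_bwd_none {h : K.H} (hs : K.above h = none) :
    K.map.next (.bwd h) = Dart.fwd (K.succ h) := by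
  simp [next_apply, nextFun, hs]

theorem next_bwd_some {h : K.H} {u : K.U} (hs : K.above h = some u) :
    K.map.next (.bwd h) = Dart.up (K.rot u) := by
  simp [next_apply, nextFun, hs]

theorem rev_up (u : K.U) : K.map.rev (.up u) = Dart.dn u := rfl
theorem rev_dn (u : K.U) : K.map.rev (.dn u) = Dart.up u := rfl
theorem rev_fwd (h : K.H) : K.map.rev (.fwd h) = Dart.bwd h := rfl
theorem rev_bwd (h : K.H) : K.map.rev (.bwd h) = Dart.fwd h := rfl

/-- The starting point of a dart, as an element of `Option H`. -/
def start : K.Dart → Option K.H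
  | .up u => K.bot u
  | .dn u => some (K.top u)
  | .fwd h => some h
  | .bwd h => some (K.succ h)

theorem start_next (d : K.map.Dart) : K.start (K.map.next d) = K.start d := by
  rcases d with u | u | h | h
  · rcases hs : K.side u with h | h
    · rw [K.next_up_inl hs]; exact (K.bot_of_inl _ _ hs).1.symm
    · rw [K.next_up_inr hs]; exact K.bot_of_inr _ _ hs
  · obtain ⟨u, rfl⟩ := K.rot.surjective u
    rcases hs : K.side u with h | h
    · rw [K.next_dn_inl hs]; exact congrArg some (K.top_of_inl _ _ hs).symm
    · rw [K.next_dn_inr hs]; exact congrArg some (K.top_of_inr _ _ hs).2.symm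
  · rw [next_fwd]; exact congrArg some (K.top_of_inr _ _ (K.side_below h)).1
  · rcases hs : K.above h with _ | u
    · rw [K.next_bwd_none hs]; rfl
    · rw [K.next_bwd_some hs]; exact (K.bot_of_inl _ _ (K.side_of_above _ _ hs)).2

/-- An edge upwards from a vertex of a slice leads, around this vertex, to its forward edge. -/
theorem sameCycle_up_fwd {u : K.U} {h : K.H} (hb : K.bot u = some h) :
    K.map.next.SameCycle (.up u) (.fwd h) := by
  have htop : K.lev (K.top u) = K.lev h + 1 := by rw [K.lev_top, hb]; rfl
  have hlt : K.above h ≠ none := fun hn => by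
    have := K.lev_le (K.top u)
    rw [K.above_eq_none] at hn
    omega
  obtain ⟨u', hu'⟩ := Option.ne_none_iff_exists'.1 hlt
  have hs' := K.side_of_above _ _ hu'
  have htop' : K.lev (K.top u') = K.lev h + 1 := by
    rw [K.lev_top, (K.bot_of_inl _ _ hs').1]; rfl
  obtain ⟨a, ⟨g, hg⟩, hmin⟩ := exists_first_pow (K.sameCycle_rot u u' (htop.trans htop'.symm))
    (fun u => ∃ h, K.side u = .inl h) ⟨h, hs'⟩
  have key : ∀ b ≤ a, K.bot ((K.rot ^ b) u) = some h ∧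
      K.map.next.SameCycle (.up u) (.up ((K.rot ^ b) u)) := by
    intro b
    induction b with
    | zero => exact fun _ => ⟨hb, .rfl⟩
    | succ b ih =>
      intro hba
      obtain ⟨h1, h2⟩ := ih (by omega)
      rcases hs : K.side ((K.rot ^ b) u) with g | g
      · exact absurd ⟨g, hs⟩ (hmin b (by omega))
      · rw [pow_succ', Equiv.Perm.mul_apply, K.bot_of_inr _ _ hs]
        refine ⟨h1, h2.trans ?_⟩
        rw [← K.next_up_inr hs]
        exact Equiv.Perm.sameCycle_apply_right.2 .rfl
  obtain ⟨h1, h2⟩ := key a le_rfl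
  rw [(K.bot_of_inl _ _ hg).1] at h1
  obtain rfl := Option.some.inj h1
  refine h2.trans ?_
  rw [← K.next_up_inl hg]
  exact Equiv.Perm.sameCycle_apply_right.2 .rfl

/-- An edge downwards from a vertex of a slice is reached, around this vertex, from its forward
edge. -/
theorem sameCycle_dn_fwd (u : K.U) : K.map.next.SameCycle (.dn u) (.fwd (K.top u)) := by
  have hs' := K.side_below (K.top u)
  obtain ⟨a, ⟨g, hg⟩, hmin⟩ := exists_first_pow (K.sameCycle_rot u (K.below (K.top u))
    (by rw [(K.top_of_inr _ _ hs').1])) (fun u => ∃ h, K.side u = .inr h) ⟨_, hs'⟩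
  have key : ∀ b ≤ a, K.top ((K.rot ^ b) u) = K.top u ∧
      K.map.next.SameCycle (.dn u) (.dn ((K.rot ^ b) u)) := by
    intro b
    induction b with
    | zero => exact fun _ => ⟨rfl, .rfl⟩
    | succ b ih =>
      intro hba
      obtain ⟨h1, h2⟩ := ih (by omega)
      rcases hs : K.side ((K.rot ^ b) u) with g | g
      · rw [pow_succ', Equiv.Perm.mul_apply, K.top_of_inl _ _ hs]
        refine ⟨h1, h2.trans ?_⟩
        nth_rewrite 1 [← K.next_dn_inl hs]
        exact Equiv.Perm.sameCycle_apply_left.2 .rfl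
      · exact absurd ⟨g, hs⟩ (hmin b (by omega))
  obtain ⟨h1, h2⟩ := key a le_rfl
  rw [(K.top_of_inr _ _ hg).1] at h1
  refine h2.trans ?_
  nth_rewrite 1 [← K.below_of_side _ _ hg, ← K.next_fwd, h1]
  exact Equiv.Perm.sameCycle_apply_left.2 .rfl

theorem sameCycle_of_start_eq_some {d : K.map.Dart} {h : K.H} (hd : K.start d = some h) :
    K.map.next.SameCycle d (.fwd h) := by
  rcases d with u | u | g | g
  · exact K.sameCycle_up_fwd hd
  · obtain rfl := Option.some.inj hd
    exact K.sameCycle_dn_fwd u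
  · obtain rfl := Option.some.inj hd
    exact .rfl
  · refine (Equiv.Perm.sameCycle_apply_left.1 ?_)
    have hd' := (K.start_next (.bwd g)).trans hd
    rcases hs : K.above g with _ | u
    · rw [K.next_bwd_none hs] at hd' ⊢
      obtain rfl := Option.some.inj hd'
      exact .rfl
    · rw [K.next_bwd_some hs] at hd' ⊢
      exact K.sameCycle_up_fwd hd'

theorem sameCycle_of_start_eq_none {d : K.map.Dart} (hd : K.start d = none) :
    K.map.next.SameCycle (.up K.first) d := by
  rcases d with u | u | g | g
  · have hb : K.bot u = none := hd
    have key : ∀ a : ℕ, K.bot ((K.rot ^ a) K.first) = none ∧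
        K.map.next.SameCycle (.up K.first) (.up ((K.rot ^ a) K.first)) := by
      intro a
      induction a with
      | zero => exact ⟨K.bot_first, .rfl⟩
      | succ a ih =>
        rcases hs : K.side ((K.rot ^ a) K.first) with g | g
        · rw [(K.bot_of_inl _ _ hs).1] at ih
          exact absurd ih.1 (by simp)
        · rw [pow_succ', Equiv.Perm.mul_apply, K.bot_of_inr _ _ hs]
          refine ⟨ih.1, ih.2.trans ?_⟩
          rw [← K.next_up_inr hs]
          exact Equiv.Perm.sameCycle_apply_right.2 .rfl
    obtain ⟨a, rfl⟩ := (K.sameCycle_rot K.first u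
      (by rw [K.lev_top, K.lev_top, hb, K.bot_first])).exists_nat_pow_eq
    exact (key a).2
  all_goals simp [start] at hd

theorem sameCycle_next_iff (d d' : K.map.Dart) :
    K.map.next.SameCycle d d' ↔ K.start d = K.start d' := by
  constructor
  · intro h
    exact (h.induction (p := fun x => K.start x = K.start d) rfl
      fun z hz => (K.start_next z).trans hz).symm
  · intro h
    rcases hd : K.start d with _ | g
    · exact (K.sameCycle_of_start_eq_none hd).symm.trans
        (K.sameCycle_of_start_eq_none (h.symm.trans hd))
    · exact (K.sameCycle_of_start_eq_some hd).trans
        (K.sameCycle_of_start_eq_some (h.symm.trans hd)).symm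

/-- The vertices of the map of a skeleton. -/
def vertexEquiv : K.map.Vertex ≃ Option K.H :=
  cycleQuotientEquiv K.map.next K.start K.sameCycle_next_iff (by
    rintro (_ | h)
    · exact ⟨.up K.first, K.bot_first⟩
    · exact ⟨.fwd h, rfl⟩)

@[simp] theorem vertexEquiv_tail (d : K.map.Dart) : K.vertexEquiv (K.map.tail d) = K.start d := rfl

@[simp] theorem vertexEquiv_head (d : K.map.Dart) :
    K.vertexEquiv (K.map.head d) = K.start (K.map.rev d) := rfl

/-- The undirected edge of a dart. -/
def undirected : K.Dart → K.U ⊕ K.H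
  | .up u => .inl u
  | .dn u => .inl u
  | .fwd h => .inr h
  | .bwd h => .inr h

theorem sameCycle_rev_iff (d d' : K.map.Dart) :
    K.map.rev.SameCycle d d' ↔ K.undirected d = K.undirected d' := by
  have hflip : ∀ d : K.map.Dart, K.map.rev.SameCycle d (K.map.rev d) := fun d =>
    Equiv.Perm.sameCycle_apply_right.2 .rfl
  constructor
  · intro h
    refine (h.induction (p := fun x => K.undirected x = K.undirected d) rfl ?_).symm
    rintro (u | u | h | h) hz <;> exact hz
  · rintro h
    rcases d with u | u | g | g <;> rcases d' with u' | u' | g' | g' <;>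
      simp only [undirected, Sum.inl.injEq, Sum.inr.injEq, reduceCtorEq] at h <;> subst h
    any_goals exact .rfl
    all_goals exact hflip _

/-- The edges of the map of a skeleton. -/
def edgeEquiv : K.map.Edge ≃ K.U ⊕ K.H :=
  cycleQuotientEquiv K.map.rev K.undirected K.sameCycle_rev_iff (by
    rintro (u | h)
    · exact ⟨.up u, rfl⟩
    · exact ⟨.fwd h, rfl⟩)

/-- The face to the right of a dart: a triangle, or `none` for the external face. -/
def right : K.Dart → Option K.U
  | .up u => some (K.rot.symm u)
  | .dn u => some u
  | .fwd h => K.above h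
  | .bwd h => some (K.below h)

theorem right_next_rev (d : K.map.Dart) : K.right ((K.map.next * K.map.rev) d) = K.right d := by
  rw [Equiv.Perm.mul_apply]
  rcases d with u | u | h | h
  · obtain ⟨u, rfl⟩ := K.rot.surjective u
    rw [rev_up]
    rcases hs : K.side u with h | h
    · rw [K.next_dn_inl hs]; simp [right]
    · rw [K.next_dn_inr hs]; simp [right, K.below_of_side _ _ hs]
  · rw [rev_dn]
    rcases hs : K.side u with h | h
    · rw [K.next_up_inl hs]; simp [right, K.above_of_side _ _ hs]
    · rw [K.next_up_inr hs]; simp [right]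
  · rw [rev_fwd]
    rcases hs : K.above h with _ | u
    · rw [K.next_bwd_none hs]; simp [right, hs, K.above_succ_eq_none hs]
    · rw [K.next_bwd_some hs]; simp [right, hs]
  · rw [rev_bwd, next_fwd]; rfl

theorem sameCycle_face_up (u : K.U) :
    (K.map.next * K.map.rev).SameCycle (.up (K.rot u)) (.dn u) := by
  refine Equiv.Perm.sameCycle_apply_left.1 ?_
  rw [Equiv.Perm.mul_apply, rev_up]
  rcases hs : K.side u with h | h
  · rw [K.next_dn_inl hs]
  · rw [K.next_dn_inr hs]
    refine Equiv.Perm.sameCycle_apply_left.1 ?_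
    rw [Equiv.Perm.mul_apply, rev_bwd, next_fwd, K.below_of_side _ _ hs]

theorem sameCycle_face_of_right_eq_some {d : K.map.Dart} {u : K.U} (hd : K.right d = some u) :
    (K.map.next * K.map.rev).SameCycle d (.dn u) := by
  rcases d with v | v | h | h
  · obtain ⟨v, rfl⟩ := K.rot.surjective v
    simp only [right, Equiv.symm_apply_apply, Option.some.injEq] at hd
    subst hd
    exact K.sameCycle_face_up v
  · obtain rfl := Option.some.inj hd
    exact .rfl
  · refine Equiv.Perm.sameCycle_apply_left.1 ?_
    rw [Equiv.Perm.mul_apply, rev_fwd, K.next_bwd_some hd]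
    exact K.sameCycle_face_up u
  · refine Equiv.Perm.sameCycle_apply_left.1 ?_
    obtain rfl := Option.some.inj hd
    rw [Equiv.Perm.mul_apply, rev_bwd, next_fwd]

theorem sameCycle_face_of_right_eq_none {d : K.map.Dart} (hd : K.right d = none) :
    (K.map.next * K.map.rev).SameCycle (.fwd K.outer) d := by
  rcases d with v | v | h | h
  · simp [right] at hd
  · simp [right] at hd
  · have hh := (K.above_eq_none h).1 hd
    have ho := (K.above_eq_none _).2 K.lev_outer
    refine ((K.sameCycle_succ K.outer h (by rw [hh, K.lev_outer])).induction
      (p := fun h => K.above h = none ∧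
        (K.map.next * K.map.rev).SameCycle (.fwd K.outer) (.fwd h)) ⟨ho, .rfl⟩ ?_).2
    rintro z ⟨hz, hz'⟩
    refine ⟨K.above_succ_eq_none hz, hz'.trans ?_⟩
    rw [← K.next_bwd_none hz]
    exact Equiv.Perm.sameCycle_apply_right.2 .rfl
  · simp [right] at hd

theorem sameCycle_face_iff (d d' : K.map.Dart) :
    (K.map.next * K.map.rev).SameCycle d d' ↔ K.right d = K.right d' := by
  constructor
  · intro h
    exact (h.induction (p := fun x => K.right x = K.right d) rfl
      fun z hz => (K.right_next_rev z).trans hz).symm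
  · intro h
    rcases hd : K.right d with _ | g
    · exact (K.sameCycle_face_of_right_eq_none hd).symm.trans
        (K.sameCycle_face_of_right_eq_none (h.symm.trans hd))
    · exact (K.sameCycle_face_of_right_eq_some hd).trans
        (K.sameCycle_face_of_right_eq_some (h.symm.trans hd)).symm

/-- The faces of the map of a skeleton. -/
def faceEquiv : K.map.Face ≃ Option K.U :=
  cycleQuotientEquiv (K.map.next * K.map.rev) K.right K.sameCycle_face_iff (by
    rintro (_ | u)
    · exact ⟨.fwd K.outer, (K.above_eq_none _).2 K.lev_outer⟩
    · exact ⟨.dn u, rfl⟩)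

@[simp] theorem faceEquiv_face (d : K.map.Dart) : K.faceEquiv (K.map.face d) = K.right d := rfl

theorem faceEquiv_outerFace : K.faceEquiv K.map.outerFace = none :=
  (K.above_eq_none _).2 K.lev_outer

theorem face_eq_outerFace_iff (d : K.map.Dart) :
    K.map.face d = K.map.outerFace ↔ K.right d = none := by
  rw [← K.faceEquiv.apply_eq_iff_eq, faceEquiv_outerFace, faceEquiv_face]

end Skeleton


/-- A cycle of a permutation as a sequence indexed by the integers modulo its length. -/
theorem exists_zmod_enumeration {X : Type*} {π : Equiv.Perm X} {s : Finset X}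
    (hs : π.IsCycleOn (s : Set X)) {a : X} (ha : a ∈ s) :
    ∃ c : ZMod s.card → X, (∀ k, c (k + 1) = π (c k)) ∧ Function.Injective c ∧
      ∀ x, x ∈ s ↔ ∃ k, c k = x := by
  have hpos : 0 < s.card := Finset.card_pos.2 ⟨a, ha⟩
  have : NeZero s.card := ⟨hpos.ne'⟩
  refine ⟨fun k => (π ^ k.val) a, fun k => ?_, fun j k hjk => ?_, fun x => ⟨fun hx => ?_, ?_⟩⟩
  · change _ = π ((π ^ k.val) a)
    rw [← Equiv.Perm.mul_apply, ← pow_succ', hs.pow_apply_eq_pow_apply ha,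
      ← ZMod.natCast_eq_natCast_iff]
    simp
  · have := (hs.pow_apply_eq_pow_apply ha).1 hjk
    rw [← ZMod.natCast_eq_natCast_iff] at this
    simpa using this
  · obtain ⟨n, hn, rfl⟩ := hs.exists_pow_eq ha hx
    exact ⟨n, by simp [ZMod.val_natCast, Nat.mod_eq_of_lt hn]⟩
  · rintro ⟨k, rfl⟩
    have hmem : ∀ n : ℕ, (π ^ n) a ∈ (s : Set X) := fun n =>
      (hs.1.perm_pow n).mapsTo ha
    exact hmem _

namespace Skeleton

variable {N : ℕ} (K : Skeleton N)

/-- The height of a vertex of the map of a skeleton, as it is prescribed by the slices. -/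
def vertexLev (v : Option K.H) : ℕ := v.elim 0 K.lev

@[simp] theorem vertexLev_none : K.vertexLev none = 0 := rfl
@[simp] theorem vertexLev_some (h : K.H) : K.vertexLev (some h) = K.lev h := rfl

theorem connected_and_height :
    K.map.graph.Connected ∧ ∀ v, K.map.height v = K.vertexLev (K.vertexEquiv v) := by
  refine K.map.connected_and_height_eq (fun v => K.vertexLev (K.vertexEquiv v)) ?_ ?_ ?_
  · intro v
    have hroot : K.vertexEquiv K.map.rootVertex = none := K.bot_first
    rw [← K.vertexEquiv.apply_eq_iff_eq, hroot]
    rcases K.vertexEquiv v with _ | h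
    · simp
    · have := K.lev_pos h
      simp only [vertexLev_some, reduceCtorEq, iff_false]
      omega
  · intro d
    simp only [vertexEquiv_head, vertexEquiv_tail]
    rcases d with u | u | h | h
    · change K.vertexLev (some (K.top u)) ≤ K.vertexLev (K.bot u) + 1
      exact (K.lev_top u).le
    · change K.vertexLev (K.bot u) ≤ K.vertexLev (some (K.top u)) + 1
      have := K.lev_top u
      change K.lev (K.top u) = K.vertexLev (K.bot u) + 1 at this
      simp only [vertexLev_some]
      omega
    · change K.lev (K.succ h) ≤ K.lev h + 1
      rw [K.lev_succ]; omega
    · change K.lev h ≤ K.lev (K.succ h) + 1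
      rw [K.lev_succ]; omega
  · intro v hv
    rcases hh : K.vertexEquiv v with _ | h
    · rw [hh] at hv; exact absurd rfl hv
    · have htop := (K.top_of_inr _ _ (K.side_below h)).1
      refine ⟨.dn (K.below h), ?_, ?_⟩
      · rw [← K.vertexEquiv.apply_eq_iff_eq, hh, vertexEquiv_tail]
        exact congrArg some htop
      · rw [vertexEquiv_head]
        change K.vertexLev (K.bot (K.below h)) + 1 = K.lev h
        have := K.lev_top (K.below h)
        rw [htop] at this
        exact this.symm

theorem height_eq (v : K.map.Vertex) : K.map.height v = K.vertexLev (K.vertexEquiv v) :=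
  K.connected_and_height.2 v

theorem height_tail (d : K.map.Dart) : K.map.height (K.map.tail d) = K.vertexLev (K.start d) :=
  K.height_eq _

theorem height_head (d : K.map.Dart) :
    K.map.height (K.map.head d) = K.vertexLev (K.start (K.map.rev d)) :=
  K.height_eq _

theorem card_vertex : Nat.card K.map.Vertex = Nat.card K.H + 1 := by
  rw [Nat.card_congr K.vertexEquiv, Finite.card_option]

theorem card_edge : Nat.card K.map.Edge = Nat.card K.U + Nat.card K.H := by
  rw [Nat.card_congr K.edgeEquiv, Nat.card_sum]

theorem card_face : Nat.card K.map.Face = Nat.card K.U + 1 := by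
  rw [Nat.card_congr K.faceEquiv, Finite.card_option]

theorem numTriangles_eq : K.map.numTriangles = Nat.card K.U := by
  have e : {f : K.map.Face // f ≠ K.map.outerFace} ≃ {o : Option K.U // o ≠ none} :=
    K.faceEquiv.subtypeEquiv fun f => by
      rw [← K.faceEquiv_outerFace, Ne, Ne, K.faceEquiv.apply_eq_iff_eq]
  have e' : {o : Option K.U // o ≠ none} ≃ K.U :=
    (Equiv.subtypeEquivRight fun o => Option.isSome_iff_ne_none.symm).trans
      (Equiv.optionIsSomeEquiv K.U)
  exact Nat.card_congr (e.trans e')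

theorem isPlanar : K.map.IsPlanar := by
  refine ⟨K.connected_and_height.1, ?_⟩
  rw [card_vertex, card_edge, card_face]
  push_cast
  ring

theorem sliceIsCycle {i : ℕ} (h1 : 1 ≤ i) (h2 : i ≤ N) : K.map.SliceIsCycle i := by
  classical
  have := Fintype.ofFinite K.H
  obtain ⟨h₀, hh₀⟩ := K.exists_lev i h1 h2
  set s : Finset K.H := Finset.univ.filter fun h => K.lev h = i with hs
  have hmem : ∀ h, h ∈ s ↔ K.lev h = i := by simp [hs]
  have hcyc : K.succ.IsCycleOn (s : Set K.H) := by
    refine ⟨⟨fun h hh => ?_, K.succ.injective.injOn, fun h hh => ⟨K.succ.symm h, ?_, by simp⟩⟩,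
      fun h hh h' hh' => K.sameCycle_succ _ _ ?_⟩
    · rw [Finset.mem_coe, hmem] at *
      rw [K.lev_succ, hh]
    · rw [Finset.mem_coe, hmem] at *
      rw [← hh, ← K.lev_succ (K.succ.symm h), Equiv.apply_symm_apply]
    · rw [Finset.mem_coe, hmem] at hh hh'
      rw [hh, hh']
  obtain ⟨c, hc1, hc2, hc3⟩ := exists_zmod_enumeration hcyc ((hmem h₀).2 hh₀)
  refine ⟨s.card, fun k => .fwd (c k), Finset.card_pos.2 ⟨h₀, (hmem _).2 hh₀⟩, fun k => ?_,
    fun j k hjk => ?_, fun v => ?_, fun j k => ?_, fun d hd hd' => ?_⟩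
  · rw [← K.vertexEquiv.apply_eq_iff_eq, vertexEquiv_head, vertexEquiv_tail]
    exact congrArg some (hc1 k).symm
  · have := congrArg K.vertexEquiv hjk
    exact hc2 (Option.some.inj this)
  · rw [height_eq]
    constructor
    · intro hv
      rcases hh : K.vertexEquiv v with _ | h
      · rw [hh] at hv; simp at hv; omega
      · rw [hh] at hv
        obtain ⟨k, hk⟩ := (hc3 h).1 ((hmem h).2 hv)
        refine ⟨k, ?_⟩
        rw [← K.vertexEquiv.apply_eq_iff_eq, vertexEquiv_tail, hh, ← hk]
        rfl
    · rintro ⟨k, rfl⟩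
      exact (hmem _).1 ((hc3 _).2 ⟨k, rfl⟩)
  · rw [rev_fwd]; simp
  · rw [height_tail] at hd
    rw [height_head] at hd'
    rcases d with u | u | h | h
    · have h1 : K.vertexLev (K.bot u) = i := hd
      have h2 : K.lev (K.top u) = i := hd'
      have h3 : K.lev (K.top u) = K.vertexLev (K.bot u) + 1 := K.lev_top u
      omega
    · have h1 : K.vertexLev (K.bot u) = i := hd'
      have h2 : K.lev (K.top u) = i := hd
      have h3 : K.lev (K.top u) = K.vertexLev (K.bot u) + 1 := K.lev_top u
      omega
    · obtain ⟨k, rfl⟩ := (hc3 h).1 ((hmem h).2 hd)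
      exact ⟨k, .inl rfl⟩
    · obtain ⟨k, rfl⟩ := (hc3 h).1 ((hmem h).2 hd')
      exact ⟨k, .inr rfl⟩

theorem faceDegree_eq {f : K.map.Face} (hf : f ≠ K.map.outerFace) : K.map.faceDegree f = 3 := by
  obtain ⟨u, hu⟩ : ∃ u, K.faceEquiv f = some u := Option.ne_none_iff_exists'.1 fun h =>
    hf (K.faceEquiv.injective (h.trans K.faceEquiv_outerFace.symm))
  obtain ⟨e, he, he1, he2⟩ : ∃ e : K.Dart, (∀ d, (∀ v, d ≠ .up v ∧ d ≠ .dn v) →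
      (K.right d = some u ↔ d = e)) ∧ K.right e = some u ∧ ∀ v, e ≠ .up v ∧ e ≠ .dn v := by
    rcases hs : K.side u with h | h
    · refine ⟨.fwd h, ?_, K.above_of_side _ _ hs, by simp⟩
      rintro (v | v | g | g) hd
      · exact absurd rfl (hd v).1
      · exact absurd rfl (hd v).2
      · rw [Dart.fwd.injEq]
        change K.above g = some u ↔ _
        refine ⟨fun hg => ?_, fun hg => hg ▸ K.above_of_side _ _ hs⟩
        have := K.side_of_above _ _ hg
        rw [hs] at this
        exact (Sum.inl.inj this).symm
      · simp only [right, Option.some.injEq, reduceCtorEq, iff_false]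
        rintro rfl
        rw [K.side_below] at hs
        simp at hs
    · refine ⟨.bwd h, ?_, congrArg some (K.below_of_side _ _ hs), by simp⟩
      rintro (v | v | g | g) hd
      · exact absurd rfl (hd v).1
      · exact absurd rfl (hd v).2
      · simp only [right, reduceCtorEq, iff_false]
        intro hg
        have := K.side_of_above _ _ hg
        rw [hs] at this
        simp at this
      · rw [Dart.bwd.injEq]
        simp only [right, Option.some.injEq]
        refine ⟨fun hg => ?_, fun hg => hg ▸ K.below_of_side _ _ hs⟩
        subst hg
        rw [K.side_below] at hs
        exact Sum.inr.inj hs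
  have hset : {d : K.map.Dart | K.map.face d = f} = {.dn u, .up (K.rot u), e} := by
    ext d
    simp only [Set.mem_ofPred_eq, Set.mem_insert_iff, Set.mem_singleton_iff]
    rw [← K.faceEquiv.apply_eq_iff_eq, faceEquiv_face, hu]
    rcases d with v | v | g | g
    · simp only [right, Option.some.injEq, reduceCtorEq, Dart.up.injEq, false_or]
      rw [Equiv.symm_apply_eq]
      refine ⟨.inl, fun h => h.resolve_right fun h => (he2 v).1 h.symm⟩
    · simp only [right, Option.some.injEq, reduceCtorEq, Dart.dn.injEq, false_or]
      refine ⟨.inl, fun h => h.resolve_right fun h => (he2 v).2 h.symm⟩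
    · rw [he _ (by simp)]; simp
    · rw [he _ (by simp)]; simp
  have hcard : {d : K.map.Dart | K.map.face d = f}.ncard = 3 :=
    Set.ncard_eq_three.2 ⟨_, _, _, by simp, fun h => (he2 u).2 h.symm, fun h => (he2 _).1 h.symm,
      hset⟩
  rw [← hcard]
  exact Nat.card_coe_set_eq _

/-- The map of a skeleton is a causal triangulation. -/
theorem isCausal : K.map.IsCausal N (Nat.card {h // K.lev h = N}) where
  planar := K.isPlanar
  height_le v := by
    rw [height_eq]
    rcases K.vertexEquiv v with _ | h
    · exact Nat.zero_le _
    · exact K.lev_le h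
  no_root_loop d := by
    rintro ⟨h1, h2⟩
    rw [← K.vertexEquiv.apply_eq_iff_eq] at h1 h2
    have hroot : K.vertexEquiv K.map.rootVertex = none := K.bot_first
    rw [hroot] at h1 h2
    rcases d with u | u | h | h
    · exact absurd h2 (Option.some_ne_none _)
    · exact absurd h1 (Option.some_ne_none _)
    · exact absurd h1 (Option.some_ne_none _)
    · exact absurd h1 (Option.some_ne_none _)
  slice_cycle _ := K.sliceIsCycle
  triangles _ := K.faceDegree_eq
  outer_boundary d hd := by
    rw [face_eq_outerFace_iff] at hd
    rw [height_tail]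
    rcases d with u | u | h | h
    · simp [right] at hd
    · simp [right] at hd
    · exact (K.above_eq_none h).1 hd
    · simp [right] at hd
  card_last := by
    have hN : 1 ≤ N := by have := K.lev_pos K.outer; rwa [K.lev_outer] at this
    have e : {v : K.map.Vertex // K.map.height v = N} ≃
        {o : Option K.H // K.vertexLev o = N} :=
      K.vertexEquiv.subtypeEquiv fun v => by rw [K.height_eq]
    rw [Nat.card_congr e]
    refine (Nat.card_congr (Equiv.ofBijective
      (fun h : {h // K.lev h = N} => (⟨some h.1, h.2⟩ : {o : Option K.H // K.vertexLev o = N}))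
      ⟨fun a b hab => ?_, ?_⟩)).symm
    · simpa [Subtype.ext_iff] using hab
    · rintro ⟨_ | h, hh⟩
      · simp at hh; omega
      · exact ⟨⟨h, hh⟩, rfl⟩

end Skeleton


/-! ### Words describing the strips -/

/-- The number of elements of `S` below `j`. -/
def inCount (S : Finset ℕ) (j : ℕ) : ℕ := Nat.count (· ∈ S) j

/-- The number of non-elements of `S` below `j`. -/
def outCount (S : Finset ℕ) (j : ℕ) : ℕ := Nat.count (· ∉ S) j

@[simp] theorem inCount_zero (S : Finset ℕ) : inCount S 0 = 0 := Nat.count_zero _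
@[simp] theorem outCount_zero (S : Finset ℕ) : outCount S 0 = 0 := Nat.count_zero _

theorem inCount_succ (S : Finset ℕ) (j : ℕ) :
    inCount S (j + 1) = inCount S j + if j ∈ S then 1 else 0 := Nat.count_succ _ _

theorem outCount_succ (S : Finset ℕ) (j : ℕ) :
    outCount S (j + 1) = outCount S j + if j ∈ S then 0 else 1 := by
  rw [outCount, Nat.count_succ]
  split_ifs <;> rfl

theorem inCount_add_outCount (S : Finset ℕ) (j : ℕ) : inCount S j + outCount S j = j := by
  induction j with
  | zero => simp
  | succ j ih => rw [inCount_succ, outCount_succ]; split_ifs <;> omega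

theorem inCount_mono (S : Finset ℕ) : Monotone (inCount S) := Nat.count_monotone _
theorem outCount_mono (S : Finset ℕ) : Monotone (outCount S) := Nat.count_monotone _

theorem inCount_eq_card {S : Finset ℕ} {m : ℕ} (h : S ⊆ Finset.range m) :
    inCount S m = S.card := by
  rw [inCount, Nat.count_eq_card_filter_range]
  congr 1
  ext x
  simp only [Finset.mem_filter, Finset.mem_range]
  exact ⟨fun h => h.2, fun hx => ⟨Finset.mem_range.1 (h hx), hx⟩⟩

/-- The `k`-th element of `S`, from `0`. -/
def inNth (S : Finset ℕ) (k : ℕ) : ℕ := Nat.nth (· ∈ S) k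

/-- The `k`-th non-element of `S`, from `0`. -/
def outNth (S : Finset ℕ) (k : ℕ) : ℕ := Nat.nth (· ∉ S) k

theorem nth_of_lt_count {p : ℕ → Prop} [DecidablePred p] {k m : ℕ} (h : k < Nat.count p m) :
    Nat.nth p k < m ∧ p (Nat.nth p k) ∧ Nat.count p (Nat.nth p k) = k := by
  have hk : ∀ hf : (Set.ofPred p).Finite, k < hf.toFinset.card := fun hf =>
    h.trans_le (Nat.count_le_card hf m)
  exact ⟨Nat.nth_lt_of_lt_count h, Nat.nth_mem k hk, Nat.count_nth hk⟩

theorem inNth_spec {S : Finset ℕ} {k m : ℕ} (h : k < inCount S m) :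
    inNth S k < m ∧ inNth S k ∈ S ∧ inCount S (inNth S k) = k := nth_of_lt_count h

theorem outNth_spec {S : Finset ℕ} {k m : ℕ} (h : k < outCount S m) :
    outNth S k < m ∧ outNth S k ∉ S ∧ outCount S (outNth S k) = k := nth_of_lt_count h

theorem inNth_inCount {S : Finset ℕ} {j : ℕ} (h : j ∈ S) : inNth S (inCount S j) = j :=
  Nat.nth_count h

theorem outNth_outCount {S : Finset ℕ} {j : ℕ} (h : j ∉ S) : outNth S (outCount S j) = j :=
  Nat.nth_count (p := (· ∉ S)) h

/-- Sizes and words of a causal triangulation with `N` slices. The slice at height `i + 1` has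
`size i` vertices. The `j`-th triangle of the strip below this slice has a side in this slice if
`j ∈ word i`, and otherwise a side in the slice at height `i`. The counting starts behind a
triangle of the second kind, so that the last triangle of a strip is of this kind, except in the
strip around the root. Only the values for `i < N` matter. -/
structure SliceData (N : ℕ) where
  size : ℕ → ℕ
  word : ℕ → Finset ℕ
  pos : 0 < N
  size_pos : ∀ i < N, 0 < size i
  word_zero : word 0 = Finset.range (size 0)
  word_subset : ∀ i, i + 1 < N → word (i + 1) ⊆ Finset.range (size i + size (i + 1) - 1)
  card_word : ∀ i, i + 1 < N → (word (i + 1)).card = size (i + 1)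

/-- Index pairs `(i, j)` with `i < N` and `j < L i`. -/
@[ext] structure Cell (N : ℕ) (L : ℕ → ℕ) where
  i : ℕ
  j : ℕ
  hi : i < N
  hj : j < L i

namespace Cell

variable {N : ℕ} {L : ℕ → ℕ}

/-- The cells as a sigma type. -/
def equivSigma : Cell N L ≃ Σ i : Fin N, Fin (L i) where
  toFun c := ⟨⟨c.i, c.hi⟩, ⟨c.j, c.hj⟩⟩
  invFun s := ⟨s.1, s.2, s.1.2, s.2.2⟩
  left_inv _ := rfl
  right_inv _ := rfl

instance : Finite (Cell N L) := Finite.of_equiv _ equivSigma.symm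

theorem card : Nat.card (Cell N L) = ∑ i ∈ Finset.range N, L i := by
  rw [Nat.card_congr equivSigma, Nat.card_sigma, Finset.sum_range]
  simp

/-- The cyclic shift of every row. -/
def rot : Equiv.Perm (Cell N L) where
  toFun c := ⟨c.i, if c.j + 1 < L c.i then c.j + 1 else 0, c.hi, by
    have := c.hj; split_ifs <;> omega⟩
  invFun c := ⟨c.i, if c.j = 0 then L c.i - 1 else c.j - 1, c.hi, by
    have := c.hj; split_ifs <;> omega⟩
  left_inv c := by
    have := c.hj
    ext
    · rfl
    · by_cases h : c.j + 1 < L c.i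
      · simp [h]
      · simp only [h, if_false, if_true]; omega
  right_inv c := by
    have := c.hj
    ext
    · rfl
    · dsimp only; split_ifs <;> omega

@[simp] theorem rot_i (c : Cell N L) : (rot c).i = c.i := rfl

theorem rot_j (c : Cell N L) : (rot c).j = if c.j + 1 < L c.i then c.j + 1 else 0 := rfl

theorem rot_pow (c : Cell N L) (k : ℕ) (hk : c.j + k < L c.i) :
    (rot ^ k) c = ⟨c.i, c.j + k, c.hi, hk⟩ := by
  induction k with
  | zero => rfl
  | succ k ih =>
    rw [pow_succ', Equiv.Perm.mul_apply, ih (by omega)]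
    ext
    · rfl
    · rw [rot_j, if_pos (by dsimp only; omega)]; rfl

theorem sameCycle_rot {c c' : Cell N L} (h : c.i = c'.i) :
    (rot : Equiv.Perm (Cell N L)).SameCycle c c' := by
  have key : ∀ c : Cell N L, (rot : Equiv.Perm (Cell N L)).SameCycle
      ⟨c.i, 0, c.hi, (Nat.zero_le _).trans_lt c.hj⟩ c := fun c =>
    ⟨c.j, by rw [zpow_natCast, rot_pow _ _ (by simpa using c.hj)]; ext <;> simp⟩
  refine (key c).symm.trans ?_
  convert key c' using 2

end Cell

namespace SliceData

variable {N : ℕ} (D : SliceData N)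

/-- The number of triangles of the strip below the slice at height `i + 1`. -/
def len : ℕ → ℕ
  | 0 => D.size 0
  | i + 1 => D.size i + D.size (i + 1)

theorem word_subset_len {i : ℕ} (hi : i < N) : D.word i ⊆ Finset.range (D.len i) := by
  rcases i with _ | i
  · rw [D.word_zero]; rfl
  · exact (D.word_subset i hi).trans (Finset.range_subset_range.2 (Nat.sub_le _ _))

theorem inCount_len {i : ℕ} (hi : i < N) : inCount (D.word i) (D.len i) = D.size i := by
  rw [inCount_eq_card (D.word_subset_len hi)]
  rcases i with _ | i
  · rw [D.word_zero, Finset.card_range]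
  · exact D.card_word i hi

theorem outCount_len {i : ℕ} (hi : i + 1 < N) :
    outCount (D.word (i + 1)) (D.len (i + 1)) = D.size i := by
  have h1 := D.inCount_len hi
  have h2 := inCount_add_outCount (D.word (i + 1)) (D.len (i + 1))
  have h3 : D.len (i + 1) = D.size i + D.size (i + 1) := rfl
  omega

theorem last_notMem {i : ℕ} (hi : i + 1 < N) : D.len (i + 1) - 1 ∉ D.word (i + 1) := by
  intro h
  exact absurd (Finset.mem_range.1 (D.word_subset i hi h)) (lt_irrefl _)

theorem len_pos {i : ℕ} (hi : i < N) : 0 < D.len i := by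
  have := D.size_pos i hi
  rcases i with _ | i
  · exact this
  · exact Nat.add_pos_right _ this

theorem mem_word_zero {j : ℕ} (hj : j < D.len 0) : j ∈ D.word 0 := by
  rw [D.word_zero]; exact Finset.mem_range.2 hj

theorem outCount_lt {i j : ℕ} (hi : i + 1 < N) (hj : j < D.len (i + 1)) :
    outCount (D.word (i + 1)) j < D.size i := by
  have h1 := D.outCount_len hi
  have h2 := outCount_succ (D.word (i + 1)) (D.len (i + 1) - 1)
  rw [if_neg (D.last_notMem hi), Nat.sub_add_cancel (D.len_pos hi), h1] at h2
  have h3 := outCount_mono (D.word (i + 1)) (show j ≤ D.len (i + 1) - 1 by omega)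
  omega

theorem inCount_lt {i j : ℕ} (hi : i < N) (hj : j < D.len i) (hm : j ∈ D.word i) :
    inCount (D.word i) j < D.size i := by
  have h1 := D.inCount_len hi
  have h2 := inCount_succ (D.word i) j
  rw [if_pos hm] at h2
  have h3 := inCount_mono (D.word i) (show j + 1 ≤ D.len i by omega)
  omega

/-- The edges between consecutive slices. -/
abbrev U : Type := Cell N D.len

/-- The edges inside the slices. -/
abbrev H : Type := Cell N D.size

/-- The lower end point of an edge between slices. -/
def bot (u : D.U) : Option D.H :=
  if h : u.i = 0 then none else
    some ⟨u.i - 1, outCount (D.word u.i) u.j, by have := u.hi; omega, by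
      obtain ⟨_ | i, j, hi, hj⟩ := u
      · exact absurd rfl h
      · exact D.outCount_lt hi hj⟩

/-- The upper end point of an edge between slices. -/
def top (u : D.U) : D.H :=
  ⟨u.i, if inCount (D.word u.i) u.j < D.size u.i then inCount (D.word u.i) u.j else 0, u.hi, by
    have := D.size_pos u.i u.hi
    split_ifs <;> omega⟩

/-- The side of a triangle that lies in a slice. -/
def side (u : D.U) : D.H ⊕ D.H :=
  if h : u.j ∈ D.word u.i then
    .inr ⟨u.i, inCount (D.word u.i) u.j, u.hi, D.inCount_lt u.hi u.hj h⟩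
  else .inl ⟨u.i - 1, outCount (D.word u.i) u.j, by have := u.hi; omega, by
      obtain ⟨_ | i, j, hi, hj⟩ := u
      · exact absurd (D.mem_word_zero hj) h
      · exact D.outCount_lt hi hj⟩

/-- The triangle above an edge of a slice. -/
def above (h : D.H) : Option D.U :=
  if hi : h.i + 1 < N then
    some ⟨h.i + 1, outNth (D.word (h.i + 1)) h.j, hi,
      (outNth_spec (h.hj.trans_eq (D.outCount_len hi).symm)).1⟩
  else none

/-- The triangle below an edge of a slice. -/
def below (h : D.H) : D.U :=
  ⟨h.i, inNth (D.word h.i) h.j, h.hi, (inNth_spec (h.hj.trans_eq (D.inCount_len h.hi).symm)).1⟩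

theorem side_eq_inr {u : D.U} {h : D.H} :
    D.side u = .inr h ↔ u.j ∈ D.word u.i ∧ h.i = u.i ∧ h.j = inCount (D.word u.i) u.j := by
  unfold side
  split_ifs with hm
  · rw [Sum.inr.injEq]
    exact ⟨fun h => by subst h; exact ⟨hm, rfl, rfl⟩, fun h => by
      ext
      · exact h.2.1.symm
      · exact h.2.2.symm⟩
  · simp [hm]

theorem side_eq_inl {u : D.U} {h : D.H} :
    D.side u = .inl h ↔ u.j ∉ D.word u.i ∧ h.i + 1 = u.i ∧ h.j = outCount (D.word u.i) u.j := by
  unfold side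
  split_ifs with hm
  · simp [hm]
  · rw [Sum.inl.injEq]
    have h0 : u.i ≠ 0 := by
      obtain ⟨i, j, hi, hj⟩ := u
      rintro rfl
      exact hm (D.mem_word_zero hj)
    constructor
    · rintro rfl
      exact ⟨hm, by dsimp only; omega, rfl⟩
    · rintro ⟨-, h1, h2⟩
      ext
      · dsimp only; omega
      · exact h2.symm

theorem bot_eq_some {u : D.U} {h : D.H} :
    D.bot u = some h ↔ h.i + 1 = u.i ∧ h.j = outCount (D.word u.i) u.j := by
  unfold bot
  split_ifs with h0
  · simp only [false_iff]; omega
  · rw [Option.some.injEq]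
    constructor
    · rintro rfl
      exact ⟨by dsimp only; omega, rfl⟩
    · rintro ⟨h1, h2⟩
      ext
      · dsimp only; omega
      · exact h2.symm

theorem bot_eq_none {u : D.U} : D.bot u = none ↔ u.i = 0 := by
  unfold bot
  split_ifs with h0 <;> simp [h0]

theorem above_eq_some {h : D.H} {u : D.U} :
    D.above h = some u ↔ u.j ∉ D.word u.i ∧ h.i + 1 = u.i ∧ h.j = outCount (D.word u.i) u.j := by
  unfold above
  split_ifs with hi
  · rw [Option.some.injEq]
    have hs := outNth_spec (h.hj.trans_eq (D.outCount_len hi).symm)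
    constructor
    · rintro rfl
      exact ⟨hs.2.1, rfl, hs.2.2.symm⟩
    · rintro ⟨h1, h2, h3⟩
      ext
      · exact h2
      · dsimp only; rw [h2, h3, outNth_outCount h1]
  · simp only [false_iff]
    have := u.hi
    omega

theorem below_eq {h : D.H} {u : D.U} :
    D.below h = u ↔ u.j ∈ D.word u.i ∧ h.i = u.i ∧ h.j = inCount (D.word u.i) u.j := by
  have hs := inNth_spec (h.hj.trans_eq (D.inCount_len h.hi).symm)
  constructor
  · rintro rfl
    exact ⟨hs.2.1, rfl, hs.2.2.symm⟩
  · rintro ⟨h1, h2, h3⟩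
    ext
    · exact h2
    · change inNth _ _ = _
      rw [h2, h3, inNth_inCount h1]

/-- After the last triangle of a strip, the lower end points start again from `0`. -/
theorem outCount_rot (u : D.U) (h0 : u.i ≠ 0) :
    outCount (D.word u.i) (Cell.rot u).j =
      if u.j ∈ D.word u.i then outCount (D.word u.i) u.j else
        if outCount (D.word u.i) u.j + 1 < D.size (u.i - 1) then
          outCount (D.word u.i) u.j + 1 else 0 := by
  obtain ⟨_ | i, j, hi, hj⟩ := u
  · exact absurd rfl h0
  rw [Cell.rot_j]
  dsimp only
  rw [Nat.add_sub_cancel]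
  by_cases hl : j + 1 < D.len (i + 1)
  · have := D.outCount_lt hi hl
    rw [outCount_succ] at this
    rw [if_pos hl, outCount_succ]
    split_ifs at * <;> omega
  · have hj' : j = D.len (i + 1) - 1 := by omega
    have hm : j ∉ D.word (i + 1) := hj' ▸ D.last_notMem hi
    have h2 := outCount_succ (D.word (i + 1)) j
    rw [if_neg hm, show j + 1 = D.len (i + 1) by omega, D.outCount_len hi] at h2
    rw [if_neg hl, if_neg hm, if_neg (by omega), outCount_zero]

/-- After the last triangle of a strip, the upper end points start again from `0`. -/
theorem inCount_rot (u : D.U) :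
    (if inCount (D.word u.i) (Cell.rot u).j < D.size u.i then
        inCount (D.word u.i) (Cell.rot u).j else 0) =
      if u.j ∈ D.word u.i then
        if inCount (D.word u.i) u.j + 1 < D.size u.i then inCount (D.word u.i) u.j + 1 else 0
      else if inCount (D.word u.i) u.j < D.size u.i then inCount (D.word u.i) u.j else 0 := by
  obtain ⟨i, j, hi, hj⟩ := u
  rw [Cell.rot_j]
  dsimp only
  have h0 := D.size_pos i hi
  by_cases hl : j + 1 < D.len i
  · rw [if_pos hl, inCount_succ]
    split_ifs <;> omega
  · have h2 := inCount_succ (D.word i) j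
    rw [show j + 1 = D.len i by omega, D.inCount_len hi] at h2
    rw [if_neg hl, inCount_zero]
    split_ifs at * <;> omega

/-- The skeleton with given sizes and words. -/
abbrev skeleton : Skeleton N where
  U := D.U
  H := D.H
  finite_U := inferInstance
  finite_H := inferInstance
  rot := Cell.rot
  succ := Cell.rot
  side := D.side
  above := D.above
  below := D.below
  bot := D.bot
  top := D.top
  lev h := h.i + 1
  first := ⟨0, 0, D.pos, D.size_pos 0 D.pos⟩
  outer := ⟨N - 1, 0, Nat.sub_lt D.pos one_pos, D.size_pos _ (Nat.sub_lt D.pos one_pos)⟩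
  side_below h := D.side_eq_inr.2 (D.below_eq.1 rfl)
  below_of_side u h hs := D.below_eq.2 (D.side_eq_inr.1 hs)
  side_of_above h u hs := D.side_eq_inl.2 (D.above_eq_some.1 hs)
  above_of_side u h hs := D.above_eq_some.2 (D.side_eq_inl.1 hs)
  above_eq_none h := by
    have := h.hi
    unfold above
    split_ifs with hi
    · simp only [false_iff]; omega
    · simp only [true_iff]; omega
  bot_of_inl u h hs := by
    obtain ⟨h1, h2, h3⟩ := D.side_eq_inl.1 hs
    refine ⟨D.bot_eq_some.2 ⟨h2, h3⟩, D.bot_eq_some.2 ⟨h2, ?_⟩⟩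
    rw [Cell.rot_i, D.outCount_rot u (by omega), if_neg h1, Cell.rot_j, h3,
      show h.i = u.i - 1 by omega]
  bot_of_inr u h hs := by
    obtain ⟨h1, h2, h3⟩ := D.side_eq_inr.1 hs
    rcases hb : D.bot u with _ | g
    · rw [D.bot_eq_none] at hb ⊢
      exact hb
    · rw [D.bot_eq_some] at hb ⊢
      refine ⟨hb.1, ?_⟩
      rw [Cell.rot_i, D.outCount_rot u (by omega), if_pos h1, hb.2]
  top_of_inr u h hs := by
    obtain ⟨h1, h2, h3⟩ := D.side_eq_inr.1 hs
    refine ⟨?_, ?_⟩ <;> ext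
    · exact h2.symm
    · rw [h3]; exact if_pos (D.inCount_lt u.hi u.hj h1)
    · exact h2.symm
    · refine (D.inCount_rot u).trans ?_
      rw [if_pos h1, Cell.rot_j, h3, h2]
  top_of_inl u h hs := by
    obtain ⟨h1, h2, h3⟩ := D.side_eq_inl.1 hs
    ext
    · rfl
    · refine (D.inCount_rot u).trans ?_
      rw [if_neg h1]; rfl
  lev_pos h := Nat.succ_pos _
  lev_le h := h.hi
  lev_succ h := rfl
  lev_top u := by
    rcases hb : D.bot u with _ | g
    · rw [D.bot_eq_none] at hb
      change u.i + 1 = 0 + 1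
      rw [hb]
    · rw [D.bot_eq_some] at hb
      change u.i + 1 = g.i + 1 + 1
      rw [hb.1]
  sameCycle_succ h h' hh := Cell.sameCycle_rot (Nat.succ.inj hh)
  sameCycle_rot u u' hh := Cell.sameCycle_rot (Nat.succ.inj hh)
  exists_lev i h1 h2 := ⟨⟨i - 1, 0, by omega, D.size_pos _ (by omega)⟩, by dsimp only; omega⟩
  bot_first := D.bot_eq_none.2 rfl
  lev_outer := by
    have := D.pos
    dsimp only
    omega

/-- The map with given sizes and words. -/
abbrev map : RootedMap := D.skeleton.map

/-- The map with given sizes and words is a causal triangulation. -/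
theorem isCausal : D.map.IsCausal N (D.size (N - 1)) := by
  have h := D.skeleton.isCausal
  have hN := D.pos
  have e : {h : D.H // h.i + 1 = N} ≃ Fin (D.size (N - 1)) :=
    { toFun := fun h => ⟨h.1.j, by
        have h1 := h.1.hj
        have h2 : h.1.i = N - 1 := by have := h.2; omega
        rwa [h2] at h1⟩
      invFun := fun k => ⟨⟨N - 1, k, by omega, k.2⟩, by dsimp only; omega⟩
      left_inv := fun h => by
        have h2 : h.1.i = N - 1 := by have := h.2; omega
        apply Subtype.ext
        ext
        · exact h2.symm
        · rfl
      right_inv := fun k => rfl }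
  have hc : Nat.card {h // D.skeleton.lev h = N} = D.size (N - 1) :=
    (Nat.card_congr e).trans (Nat.card_fin _)
  rwa [hc] at h

end SliceData


/-! ### The local structure of a causal triangulation -/

namespace RootedMap

variable {M : RootedMap}

/-- The height of the starting point of a dart. -/
def ht (M : RootedMap) (d : M.Dart) : ℕ := M.height (M.tail d)

theorem ht_next (d : M.Dart) : M.ht (M.next d) = M.ht d := by rw [ht, tail_next, ht]

theorem ht_congr {d d' : M.Dart} (h : M.tail d = M.tail d') : M.ht d = M.ht d' := by
  rw [ht, h, ht]

/-- The dart goes away from the root. -/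
def IsUp (M : RootedMap) (d : M.Dart) : Prop := M.ht (M.rev d) = M.ht d + 1

/-- The dart goes towards the root. -/
def IsDown (M : RootedMap) (d : M.Dart) : Prop := M.ht d = M.ht (M.rev d) + 1

/-- The dart stays in a slice and has on its left a triangle with a vertex in the slice below:
it runs counterclockwise around the root. -/
def IsForward (M : RootedMap) (d : M.Dart) : Prop :=
  M.ht (M.rev d) = M.ht d ∧ M.IsDown (M.next d)

/-- The sequence `c` runs once through the slice at height `i`. -/
structure IsSliceCycle (M : RootedMap) (i n : ℕ) (c : ZMod n → M.Dart) : Prop where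
  pos : 0 < n
  head_eq : ∀ k, M.head (c k) = M.tail (c (k + 1))
  inj : Function.Injective (fun k => M.tail (c k))
  height_iff : ∀ v, M.height v = i ↔ ∃ k, M.tail (c k) = v
  ne_rev : ∀ j k, c j ≠ M.rev (c k)
  cover : ∀ d, M.height (M.tail d) = i → M.height (M.head d) = i → ∃ k, d = c k ∨ d = M.rev (c k)

namespace IsSliceCycle

variable {i n : ℕ} {c : ZMod n → M.Dart} (hc : M.IsSliceCycle i n c)
include hc

/-- The same slice in the opposite direction. -/
theorem reverse : M.IsSliceCycle i n (fun k => M.rev (c (-k))) where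
  pos := hc.pos
  head_eq k := by
    have := hc.head_eq (-(k + 1))
    rw [show -(k + 1) + 1 = -k by ring] at this
    rw [head_rev, tail_rev, this]
  inj j k hjk := by
    simp only [tail_rev, hc.head_eq] at hjk
    have := hc.inj hjk
    simpa using this
  height_iff v := by
    rw [hc.height_iff]
    constructor
    · rintro ⟨k, hk⟩
      refine ⟨-(k - 1), ?_⟩
      rw [tail_rev, hc.head_eq, neg_neg, sub_add_cancel, hk]
    · rintro ⟨k, hk⟩
      exact ⟨-k + 1, by rw [← hk, tail_rev, hc.head_eq]⟩
  ne_rev j k h := by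
    rw [M.rev_rev] at h
    exact hc.ne_rev _ _ h.symm
  cover d h1 h2 := by
    obtain ⟨k, hk | hk⟩ := hc.cover d h1 h2
    · exact ⟨-k, .inr (by rw [neg_neg, M.rev_rev, hk])⟩
    · exact ⟨-k, .inl (by rw [neg_neg, hk])⟩

theorem ht_eq (k : ZMod n) : M.ht (c k) = i := (hc.height_iff _).2 ⟨k, rfl⟩

theorem ht_rev_eq (k : ZMod n) : M.ht (M.rev (c k)) = i := by
  rw [ht, tail_rev, hc.head_eq]; exact hc.ht_eq _

/-- The two darts of a slice at one of its vertices. -/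
theorem eq_or_eq_of_tail {d : M.Dart} {k : ZMod n} (ht : M.tail d = M.tail (c (k + 1)))
    (hd : M.ht (M.rev d) = M.ht d) : d = c (k + 1) ∨ d = M.rev (c k) := by
  have h1 : M.ht d = i := by rw [M.ht_congr ht]; exact hc.ht_eq _
  obtain ⟨j, rfl | rfl⟩ := hc.cover d h1 (hd.trans h1)
  · rw [hc.inj ht]; exact .inl rfl
  · rw [tail_rev, hc.head_eq] at ht
    rw [add_right_cancel (hc.inj ht)]; exact .inr rfl

theorem tail_rev_eq (k : ZMod n) : M.tail (M.rev (c k)) = M.tail (c (k + 1)) := hc.head_eq k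

theorem const_of_step {α : Type*} {f : ZMod n → α} (hf : ∀ k, f (k + 1) = f k) (j k : ZMod n) :
    f j = f k := by
  have : NeZero n := ⟨hc.pos.ne'⟩
  have key : ∀ m : ℕ, f (m : ZMod n) = f 0 := by
    intro m
    induction m with
    | zero => simp
    | succ m ih => rw [Nat.cast_succ, hf, ih]
  rw [← ZMod.natCast_zmod_val j, ← ZMod.natCast_zmod_val k, key, key]

end IsSliceCycle

namespace IsCausal

variable {N l : ℕ} (hM : M.IsCausal N l)
include hM

theorem exists_sliceCycle {i : ℕ} (h1 : 1 ≤ i) (h2 : i ≤ N) :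
    ∃ (n : ℕ) (c : ZMod n → M.Dart), M.IsSliceCycle i n c := by
  obtain ⟨n, c, h1, h2, h3, h4, h5, h6⟩ := hM.slice_cycle i h1 h2
  exact ⟨n, c, h1, h2, h3, h4, h5, h6⟩

theorem ht_le (d : M.Dart) : M.ht d ≤ N := hM.height_le _

theorem ht_rev_le (d : M.Dart) : M.ht (M.rev d) ≤ M.ht d + 1 := by
  by_cases h : M.tail d = M.head d
  · rw [ht, tail_rev, ← h, ht]; exact Nat.le_succ _
  · have hadj : M.graph.Adj (M.tail d) (M.head d) := ⟨h, d, rfl, rfl⟩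
    have := hM.planar.1.dist_triangle (u := M.rootVertex) (v := M.tail d) (w := M.head d)
    rw [SimpleGraph.dist_eq_one_iff_adj.2 hadj] at this
    exact this

theorem ht_le_rev (d : M.Dart) : M.ht d ≤ M.ht (M.rev d) + 1 := by
  have := hM.ht_rev_le (M.rev d)
  rwa [M.rev_rev] at this

theorem height_eq_zero (v : M.Vertex) : M.height v = 0 ↔ v = M.rootVertex := by
  rw [height, hM.planar.1.dist_eq_zero_iff, eq_comm]

theorem ht_pos_of_horizontal {d : M.Dart} (hd : M.ht (M.rev d) = M.ht d) : 1 ≤ M.ht d := by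
  by_contra h
  have h0 : M.ht d = 0 := by omega
  exact hM.no_root_loop d ⟨(hM.height_eq_zero _).1 h0, (hM.height_eq_zero _).1 (hd.trans h0)⟩

theorem exists_isDown {v : M.Vertex} (hv : M.height v ≠ 0) :
    ∃ d, M.tail d = v ∧ M.IsDown d := by
  have hdist : M.height v = M.graph.dist v M.rootVertex := SimpleGraph.dist_comm
  obtain ⟨p, hp⟩ := (hM.planar.1.preconnected v M.rootVertex).exists_walk_length_eq_dist
  rw [← hdist] at hp
  rcases p with _ | ⟨hadj, q⟩
  · exact absurd hp.symm hv
  · rename_i w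
    rw [SimpleGraph.Walk.length_cons] at hp
    have hw : M.height w ≤ q.length := SimpleGraph.dist_comm.trans_le (SimpleGraph.dist_le q)
    obtain ⟨-, d, hd1, hd2⟩ := hadj
    have h1 := hM.ht_le_rev d
    have e1 : M.ht d = M.height v := by rw [ht, hd1]
    have e2 : M.ht (M.rev d) = M.height w := by rw [ht, tail_rev, hd2]
    refine ⟨d, hd1, ?_⟩
    rw [IsDown]
    omega

theorem outer_ht {d : M.Dart} (hd : M.face d = M.outerFace) :
    M.ht d = N ∧ M.ht (M.rev d) = N := by
  refine ⟨hM.outer_boundary d hd, ?_⟩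
  rw [← ht_next]
  exact hM.outer_boundary _ ((M.face_next_rev d).trans hd)

/-- Going around a triangle. -/
theorem next_rev_cube {d : M.Dart} (hd : M.face d ≠ M.outerFace) :
    M.next (M.rev (M.next (M.rev (M.next (M.rev d))))) = d := by
  classical
  set s : Finset M.Dart := Finset.univ.filter fun x => M.face x = M.face d with hs
  have hmem : ∀ x, x ∈ s ↔ M.face x = M.face d := by simp [hs]
  have hcyc : (M.next * M.rev).IsCycleOn (s : Set M.Dart) := by
    refine ⟨⟨fun x hx => ?_, (M.next * M.rev).injective.injOn, fun x hx =>
      ⟨(M.next * M.rev).symm x, ?_, by simp⟩⟩, fun x hx y hy => ?_⟩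
    · rw [Finset.mem_coe, hmem] at *
      exact (M.face_next_rev x).trans hx
    · rw [Finset.mem_coe, hmem] at *
      rw [← hx]
      exact M.face_eq_iff.2 (Equiv.Perm.sameCycle_symm_apply_left.2 .rfl)
    · rw [Finset.mem_coe, hmem] at hx hy
      exact M.face_eq_iff.1 (hx.trans hy.symm)
  have hcard : s.card = 3 := by
    rw [← hM.triangles _ hd, faceDegree, Nat.card_eq_fintype_card, Fintype.card_subtype]
  have := hcyc.pow_card_apply ((hmem d).2 rfl)
  rw [hcard] at this
  exact this

theorem face_ne_outer {d : M.Dart} (hd : M.ht (M.rev d) ≠ M.ht d) : M.face d ≠ M.outerFace :=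
  fun h => hd ((hM.outer_ht h).2.trans (hM.outer_ht h).1.symm)

/-- Two consecutive darts at a vertex that leave its slice lead to the same height. -/
theorem ht_rev_next {d : M.Dart} (h1 : M.ht (M.rev d) ≠ M.ht d)
    (h2 : M.ht (M.rev (M.next d)) ≠ M.ht d) : M.ht (M.rev (M.next d)) = M.ht (M.rev d) := by
  have hf : M.face (M.rev d) ≠ M.outerFace := hM.face_ne_outer (by rw [M.rev_rev]; exact h1.symm)
  have hcube := hM.next_rev_cube hf
  rw [M.rev_rev] at hcube
  have a1 := hM.ht_rev_le (M.next (M.rev (M.next d)))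
  have a2 := hM.ht_le_rev (M.next (M.rev (M.next d)))
  have a3 : M.ht (M.rev (M.next (M.rev (M.next d)))) = M.ht (M.rev d) := by
    rw [← ht_next, hcube]
  have a4 : M.ht (M.next (M.rev (M.next d))) = M.ht (M.rev (M.next d)) := ht_next _
  have b1 := hM.ht_rev_le d
  have b2 := hM.ht_le_rev d
  have b3 := hM.ht_rev_le (M.next d)
  have b4 := hM.ht_le_rev (M.next d)
  rw [ht_next] at b3 b4
  omega

/-- The third vertex of the face to the right of a dart of a slice, seen from both ends of the
dart. On the external face both sides equal `N`. -/
theorem ht_rev_prev (d : M.Dart) :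
    M.ht (M.rev (M.next.symm d)) = M.ht (M.rev (M.next (M.rev d))) := by
  by_cases hf : M.face d = M.outerFace
  · rw [(hM.outer_ht ((M.face_next_rev d).trans hf)).2]
    refine hM.outer_boundary _ ?_
    rw [← hf, ← M.face_next_rev, M.rev_rev, Equiv.apply_symm_apply]
  · have := hM.next_rev_cube hf
    have h2 : M.next.symm d = M.rev (M.next (M.rev (M.next (M.rev d)))) := by
      rw [Equiv.symm_apply_eq, this]
    rw [h2, M.rev_rev, ht_next]

/-- The height of the third vertex of the face to the right of a dart of a slice is the same
for the following dart of the slice: between the two darts of the slice at a vertex all darts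
lead to the same height. -/
theorem right_step {i n : ℕ} {c : ZMod n → M.Dart} (hc : M.IsSliceCycle i n c) (k : ZMod n) :
    M.ht (M.rev (M.next (M.rev (c (k + 1))))) = M.ht (M.rev (M.next (M.rev (c k)))) := by
  have hhor : ∀ k, M.ht (M.rev (c k)) = M.ht (c k) := fun k => by rw [hc.ht_rev_eq, hc.ht_eq]
  rw [← hM.ht_rev_prev]
  set x := M.next (M.rev (c k)) with hx
  have hxt : M.tail x = M.tail (c (k + 1)) := by rw [hx, tail_next, hc.tail_rev_eq]
  have hxc : M.next.SameCycle x (c (k + 1)) := M.tail_eq_iff.1 hxt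
  have hpt : ∀ b : ℕ, M.tail ((M.next ^ b) x) = M.tail (c (k + 1)) := fun b => by
    rw [← hxt]; exact M.tail_eq_iff.2 (Equiv.Perm.sameCycle_pow_left.2 .rfl)
  have hph : ∀ b : ℕ, M.ht ((M.next ^ b) x) = i := fun b => by
    rw [M.ht_congr (hpt b), hc.ht_eq]
  obtain ⟨a, ha, hmin⟩ := exists_first_pow hxc (fun d => M.ht (M.rev d) = M.ht d) (hhor _)
  have hay : (M.next ^ a) x = c (k + 1) := by
    refine (hc.eq_or_eq_of_tail (hpt a) ha).resolve_right fun hay => ?_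
    -- the full turn around the vertex would miss `c (k + 1)`
    obtain ⟨b, hb, hbc⟩ := exists_first_pow hxc (fun d => d = c (k + 1)) rfl
    have hper : (M.next ^ (a + 1)) x = x := by
      rw [pow_succ', Equiv.Perm.mul_apply, hay, hx]
    have hba : b ≤ a := by
      by_contra hlt
      refine hbc (b - (a + 1)) (by omega) ?_
      rw [← hb]
      conv_rhs => rw [show b = b - (a + 1) + (a + 1) by omega, pow_add, Equiv.Perm.mul_apply, hper]
    rcases hba.lt_or_eq with hlt | rfl
    · exact hmin b hlt (by rw [hb, hhor])
    · exact hc.ne_rev _ _ (hb.symm.trans hay)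
  have hconst : ∀ b < a, M.ht (M.rev ((M.next ^ b) x)) = M.ht (M.rev x) := by
    intro b
    induction b with
    | zero => exact fun _ => rfl
    | succ b ih =>
      intro hb
      have h1 := hmin b (by omega)
      have h2 := hmin (b + 1) hb
      rw [pow_succ', Equiv.Perm.mul_apply] at h2 ⊢
      rw [ht_next] at h2
      rw [hM.ht_rev_next h1 h2, ih (by omega)]
  rcases a with _ | a
  · have hxc' : x = c (k + 1) := hay
    rw [← hxc', hx, Equiv.symm_apply_apply, M.rev_rev, ← hx, hxc', hhor, hc.ht_eq, hc.ht_eq]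
  · rw [pow_succ', Equiv.Perm.mul_apply] at hay
    rw [← hay, Equiv.symm_apply_apply]
    exact hconst a (Nat.lt_succ_self a)

theorem right_const {i n : ℕ} {c : ZMod n → M.Dart} (hc : M.IsSliceCycle i n c) (j k : ZMod n) :
    M.ht (M.rev (M.next (M.rev (c j)))) = M.ht (M.rev (M.next (M.rev (c k)))) :=
  hc.const_of_step (f := fun k => M.ht (M.rev (M.next (M.rev (c k))))) (hM.right_step hc) j k

theorem left_const {i n : ℕ} {c : ZMod n → M.Dart} (hc : M.IsSliceCycle i n c) (j k : ZMod n) :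
    M.ht (M.rev (M.next (c j))) = M.ht (M.rev (M.next (c k))) := by
  have := hM.right_const hc.reverse (-j) (-k)
  simpa only [neg_neg, M.rev_rev] using this

/-- All darts that leave a slice lead to the third vertices of the faces on its two sides. -/
theorem ht_rev_of_slice {i n : ℕ} {c : ZMod n → M.Dart} (hc : M.IsSliceCycle i n c) {d : M.Dart}
    (hd : M.ht d = i) (j : ZMod n) : M.ht (M.rev d) = i ∨
      M.ht (M.rev d) = M.ht (M.rev (M.next (c j))) ∨
      M.ht (M.rev d) = M.ht (M.rev (M.next (M.rev (c j)))) := by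
  obtain ⟨k, hk⟩ := (hc.height_iff _).1 hd
  obtain ⟨k, rfl⟩ : ∃ m, k = m + 1 := ⟨k - 1, by ring⟩
  refine ((M.tail_eq_iff.1 hk).induction (p := fun d => M.tail d = M.tail (c (k + 1)) ∧
    (M.ht (M.rev d) = i ∨ M.ht (M.rev d) = M.ht (M.rev (M.next (c j))) ∨
      M.ht (M.rev d) = M.ht (M.rev (M.next (M.rev (c j)))))) ⟨rfl, .inl (hc.ht_rev_eq _)⟩ ?_).2
  rintro z ⟨hz, hz'⟩
  have hzi : M.ht z = i := by rw [M.ht_congr hz, hc.ht_eq]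
  refine ⟨by rw [tail_next, hz], ?_⟩
  by_cases h1 : M.ht (M.rev z) = M.ht z
  · rcases hc.eq_or_eq_of_tail hz h1 with rfl | rfl
    · exact .inr (.inl (hM.left_const hc _ _))
    · exact .inr (.inr (hM.right_const hc _ _))
  · by_cases h2 : M.ht (M.rev (M.next z)) = M.ht z
    · exact .inl (h2.trans hzi)
    · rw [hM.ht_rev_next h1 h2]; exact hz'

/-- One side of a slice faces the slice below and the other side the slice above or the external
face. -/
theorem exists_oriented_slice {i : ℕ} (h1 : 1 ≤ i) (h2 : i ≤ N) :
    ∃ (n : ℕ) (c : ZMod n → M.Dart), M.IsSliceCycle i n c ∧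
      (∀ k, M.ht (M.rev (M.next (c k))) + 1 = i) ∧
      ∀ k, M.ht (M.rev (M.next (M.rev (c k)))) = if i < N then i + 1 else N := by
  obtain ⟨n, c, hc⟩ := hM.exists_sliceCycle h1 h2
  obtain ⟨d, hd, hdn⟩ := hM.exists_isDown (v := M.tail (c 0)) (by
    have := hc.ht_eq 0
    rw [ht] at this
    omega)
  have hdi : M.ht d = i := (M.ht_congr hd).trans (hc.ht_eq 0)
  rw [IsDown, hdi] at hdn
  have hdown := hM.ht_rev_of_slice hc hdi 0
  have hother : M.ht (M.rev (M.next (c 0))) = (if i < N then i + 1 else N) ∨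
      M.ht (M.rev (M.next (M.rev (c 0)))) = if i < N then i + 1 else N := by
    split_ifs with hiN
    · obtain ⟨m, b, hb⟩ := hM.exists_sliceCycle (i := i + 1) (by omega) hiN
      obtain ⟨e, he, hedn⟩ := hM.exists_isDown (v := M.tail (b 0)) (by
        have := hb.ht_eq 0
        rw [ht] at this
        omega)
      have hei : M.ht e = i + 1 := (M.ht_congr he).trans (hb.ht_eq 0)
      rw [IsDown, hei] at hedn
      have := hM.ht_rev_of_slice hc (d := M.rev e) (by omega) 0
      rw [M.rev_rev] at this
      omega
    · obtain rfl : i = N := by omega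
      obtain ⟨e, he⟩ := M.exists_face M.outerFace
      have he' := (hM.outer_ht ((M.face_next_rev e).trans he)).2
      obtain ⟨k, rfl | rfl⟩ := hc.cover e (hM.outer_ht he).1 (hM.outer_ht he).2
      · exact .inr ((hM.right_const hc 0 k).trans he')
      · rw [M.rev_rev] at he'
        exact .inl ((hM.left_const hc 0 k).trans he')
  have hval : i ≤ (if i < N then i + 1 else N) := by split_ifs <;> omega
  by_cases hside : M.ht (M.rev (M.next (c 0))) + 1 = i
  · refine ⟨n, c, hc, fun k => by rw [hM.left_const hc k 0, hside], fun k => ?_⟩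
    rw [hM.right_const hc k 0]
    omega
  · have hside' : M.ht (M.rev (M.next (M.rev (c 0)))) + 1 = i := by omega
    refine ⟨n, _, hc.reverse, fun k => ?_, fun k => ?_⟩
    · rw [hM.right_const hc _ 0, hside']
    · rw [M.rev_rev, hM.left_const hc _ 0]
      omega

end IsCausal

end RootedMap


namespace RootedMap

variable {M : RootedMap}

namespace IsCausal

variable {N l : ℕ} (hM : M.IsCausal N l)
include hM

theorem exists_forward_slice {i : ℕ} (h1 : 1 ≤ i) (h2 : i ≤ N) :
    ∃ (n : ℕ) (c : ZMod n → M.Dart), M.IsSliceCycle i n c ∧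
      (∀ d, M.IsForward d ∧ M.ht d = i ↔ ∃ k, c k = d) ∧
      ∀ k, M.ht (M.rev (M.next (M.rev (c k)))) = if i < N then i + 1 else N := by
  obtain ⟨n, c, hc, hl, hr⟩ := hM.exists_oriented_slice h1 h2
  refine ⟨n, c, hc, fun d => ⟨?_, ?_⟩, hr⟩
  · rintro ⟨⟨hd, hd'⟩, hi⟩
    obtain ⟨k, rfl | rfl⟩ := hc.cover d hi (hd.trans hi)
    · exact ⟨k, rfl⟩
    · have := hr k
      rw [IsDown, ht_next, hi, this] at hd'
      split_ifs at hd' <;> omega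
  · rintro ⟨k, rfl⟩
    refine ⟨⟨by rw [hc.ht_eq, hc.ht_rev_eq], ?_⟩, hc.ht_eq k⟩
    rw [IsDown, ht_next, hc.ht_eq, hl]

theorem forward_or {d : M.Dart} (hd : M.ht (M.rev d) = M.ht d) :
    M.IsForward d ∨ M.IsForward (M.rev d) := by
  obtain ⟨n, c, hc, hf, -⟩ := hM.exists_forward_slice (hM.ht_pos_of_horizontal hd) (hM.ht_le d)
  obtain ⟨k, rfl | rfl⟩ := hc.cover d rfl hd
  · exact .inl ((hf _).2 ⟨k, rfl⟩).1
  · rw [M.rev_rev]; exact .inr ((hf _).2 ⟨k, rfl⟩).1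

/-- The face to the right of a forward dart has its third vertex above, or is the external
face. -/
theorem ht_right {d : M.Dart} (hd : M.IsForward d) :
    M.ht (M.rev (M.next (M.rev d))) = if M.ht d < N then M.ht d + 1 else N := by
  obtain ⟨n, c, hc, hf, hr⟩ := hM.exists_forward_slice (hM.ht_pos_of_horizontal hd.1) (hM.ht_le d)
  obtain ⟨k, hk⟩ := (hf d).1 ⟨hd, rfl⟩
  rw [← hr k, hk]

theorem not_forward_rev {d : M.Dart} (hd : M.IsForward d) : ¬ M.IsForward (M.rev d) := by
  intro h
  have h1 := hM.ht_right hd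
  have h2 := h.2
  have h3 := hM.ht_le d
  rw [IsDown, h1, ht_next, hd.1] at h2
  split_ifs at h2 <;> omega

theorem forward_unique {d d' : M.Dart} (hd : M.IsForward d) (hd' : M.IsForward d')
    (h : M.tail d = M.tail d') : d = d' := by
  obtain ⟨n, c, hc, hf, -⟩ := hM.exists_forward_slice (hM.ht_pos_of_horizontal hd.1) (hM.ht_le d)
  obtain ⟨k, rfl⟩ := (hf d).1 ⟨hd, rfl⟩
  obtain ⟨k', rfl⟩ := (hf d').1 ⟨hd', (M.ht_congr h).symm⟩
  exact congrArg c (hc.inj h)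

theorem forward_unique_head {d d' : M.Dart} (hd : M.IsForward d) (hd' : M.IsForward d')
    (h : M.head d = M.head d') : d = d' := by
  obtain ⟨n, c, hc, hf, -⟩ := hM.exists_forward_slice (hM.ht_pos_of_horizontal hd.1) (hM.ht_le d)
  obtain ⟨k, rfl⟩ := (hf d).1 ⟨hd, rfl⟩
  obtain ⟨k', rfl⟩ := (hf d').1 ⟨hd', by
    rw [← hd'.1, ← hd.1]; exact (M.ht_congr h).symm⟩
  rw [hc.head_eq, hc.head_eq] at h
  rw [add_right_cancel (hc.inj h)]

theorem exists_forward {v : M.Vertex} (hv : M.height v ≠ 0) :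
    ∃ d, M.IsForward d ∧ M.tail d = v := by
  obtain ⟨n, c, hc, hf, -⟩ := hM.exists_forward_slice (Nat.pos_of_ne_zero hv) (hM.height_le v)
  obtain ⟨k, hk⟩ := (hc.height_iff v).1 rfl
  exact ⟨c k, ((hf _).2 ⟨k, rfl⟩).1, hk⟩

theorem up_right {d : M.Dart} (hd : M.IsForward d) (hN : M.ht d < N) :
    M.IsUp (M.next (M.rev d)) := by
  have := hM.ht_right hd
  rw [if_pos hN] at this
  rw [IsUp, this, ht_next, hd.1]

theorem cases_dart (d : M.Dart) :
    M.IsUp d ∨ M.IsDown d ∨ M.IsForward d ∨ M.IsForward (M.rev d) := by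
  have h1 := hM.ht_rev_le d
  have h2 := hM.ht_le_rev d
  by_cases h : M.ht (M.rev d) = M.ht d
  · exact .inr (.inr (hM.forward_or h))
  · rcases Nat.lt_or_gt_of_ne h with h | h
    · exact .inr (.inl (by rw [IsDown]; omega))
    · exact .inl (by rw [IsUp]; omega)

theorem forward_right_last {d : M.Dart} (hd : M.IsForward d) (hN : M.ht d = N) :
    M.IsForward (M.next (M.rev d)) := by
  have h1 := hM.ht_right hd
  rw [hN, if_neg (lt_irrefl _)] at h1
  have h2 : M.ht (M.next (M.rev d)) = N := by rw [ht_next, hd.1, hN]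
  refine (hM.forward_or (h1.trans h2.symm)).resolve_right fun h => ?_
  -- otherwise the backward dart would be the only dart at its vertex
  have h3 : M.rev (M.next (M.rev d)) = d := by
    refine hM.forward_unique_head h hd ?_
    rw [head_rev, tail_next, tail_rev]
  have h4 : M.next (M.rev d) = M.rev d := by
    rw [← M.rev_rev (M.next (M.rev d)), h3]
  obtain ⟨e, he, he'⟩ := hM.exists_isDown (v := M.tail (M.rev d)) (by
    have := hM.ht_pos_of_horizontal hd.1
    rw [← hd.1] at this
    exact Nat.pos_iff_ne_zero.1 this)
  have h5 : e = M.rev d := by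
    refine (M.tail_eq_iff.1 he).symm.induction (p := fun x => x = M.rev d) rfl ?_
    rintro z rfl
    exact h4
  subst h5
  rw [IsDown, M.rev_rev, hd.1] at he'
  omega

/-- The external face consists of the forward darts of the last slice. -/
theorem forward_of_outer {d : M.Dart} (hd : M.face d = M.outerFace) :
    M.IsForward d ∧ M.ht d = N := by
  obtain ⟨h1, h2⟩ := hM.outer_ht hd
  refine ⟨(hM.forward_or (h2.trans h1.symm)).resolve_right fun h => ?_, h1⟩
  have h3 := h.2
  have h4 := (hM.outer_ht ((M.face_next_rev d).trans hd)).2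
  rw [IsDown, h4, ht_next, h2] at h3
  omega

theorem next_up {d : M.Dart} (hd : M.IsUp d) :
    M.IsUp (M.next d) ∨ M.IsForward (M.next d) := by
  have hd' := hd
  rw [IsUp] at hd'
  by_cases h : M.ht (M.rev (M.next d)) = M.ht d
  · refine .inr ((hM.forward_or (h.trans (ht_next d).symm)).resolve_right fun hb => ?_)
    have h1 := hM.ht_rev_prev (M.next d)
    have h2 := hb.2
    rw [Equiv.symm_apply_apply] at h1
    rw [IsDown, ← h1, ht_next, h] at h2
    omega
  · left
    rw [IsUp, hM.ht_rev_next (by omega) h, ht_next, hd']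

theorem next_down {d : M.Dart} (hd : M.IsDown d) :
    M.IsDown (M.next d) ∨ M.IsForward (M.rev (M.next d)) := by
  have hd' := hd
  rw [IsDown] at hd'
  by_cases h : M.ht (M.rev (M.next d)) = M.ht d
  · refine .inr ((hM.forward_or (h.trans (ht_next d).symm)).resolve_left fun hb => ?_)
    have h1 := hM.ht_rev_prev (M.next d)
    have h2 := hM.ht_right hb
    have h3 := hM.ht_le d
    rw [Equiv.symm_apply_apply] at h1
    rw [← h1, ht_next] at h2
    split_ifs at h2 <;> omega
  · left
    rw [IsDown, hM.ht_rev_next (by omega) h, ht_next, hd']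

/-- The triangle between two consecutive edges upwards at a vertex. -/
theorem triangle_above_vertex {u : M.Dart} (hu : M.IsUp u) (hu' : M.IsUp (M.next u)) :
    ∃ h, M.IsForward h ∧ M.next h = M.rev u ∧ M.next (M.rev (M.next u)) = M.rev h := by
  have hu0 : M.ht (M.rev u) = M.ht u + 1 := hu
  have hu1 : M.ht (M.rev (M.next u)) = M.ht (M.next u) + 1 := hu'
  rw [ht_next] at hu1
  have hcube := hM.next_rev_cube (d := M.rev u) (hM.face_ne_outer (by rw [M.rev_rev]; omega))
  rw [M.rev_rev] at hcube
  refine ⟨M.rev (M.next (M.rev (M.next u))), ?_, hcube, (M.rev_rev _).symm⟩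
  have h1 : M.ht (M.rev (M.next (M.rev (M.next u)))) = M.ht u + 1 := by
    rw [← ht_next, hcube, hu0]
  have h2 : M.ht (M.next (M.rev (M.next u))) = M.ht u + 1 := by rw [ht_next, hu1]
  refine (hM.next_down (d := M.rev (M.next u)) ?_).resolve_left fun h => ?_
  · rw [IsDown, M.rev_rev, ht_next, hu1]
  · rw [IsDown, h1, h2] at h
    omega

/-- The triangle with a side in the slice below. -/
theorem triangle_above_edge {u : M.Dart} (hu : M.IsUp u) (hh : M.IsForward (M.next u)) :
    M.IsUp (M.next (M.rev (M.next u))) ∧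
      M.next (M.rev (M.next (M.rev (M.next u)))) = M.rev u := by
  have hu0 : M.ht (M.rev u) = M.ht u + 1 := hu
  have hcube := hM.next_rev_cube (d := M.rev u) (hM.face_ne_outer (by rw [M.rev_rev]; omega))
  rw [M.rev_rev] at hcube
  refine ⟨hM.up_right hh ?_, hcube⟩
  have := hM.ht_le (M.rev u)
  rw [ht_next]
  omega

/-- The triangle with a side in the slice above. -/
theorem triangle_below_edge {h : M.Dart} (hh : M.IsForward h) :
    M.IsUp (M.rev (M.next h)) ∧ M.IsUp (M.next (M.rev (M.next h))) ∧
      M.next (M.rev (M.next (M.rev (M.next h)))) = M.rev h := by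
  have hu : M.IsUp (M.rev (M.next h)) := by
    have := hh.2
    rwa [IsDown, ← M.rev_rev (M.next h), M.rev_rev (M.rev (M.next h))] at this
  have hu' : M.IsUp (M.next (M.rev (M.next h))) := by
    refine (hM.next_up hu).resolve_right fun hg => ?_
    obtain ⟨h1, h2⟩ := hM.triangle_above_edge hu hg
    rw [M.rev_rev] at h2
    have h3 := M.next.injective h2
    have h4 := M.rev_rev (M.next (M.rev (M.next (M.rev (M.next h)))))
    rw [h3] at h4
    rw [← h4, IsUp, M.rev_rev, hh.1] at h1
    omega
  refine ⟨hu, hu', ?_⟩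
  obtain ⟨g, hg, hg1, hg2⟩ := hM.triangle_above_vertex hu hu'
  rw [M.rev_rev] at hg1
  rw [hg2, M.next.injective hg1]

end IsCausal

end RootedMap


/-! ### Enumerating the strips and slices of a causal triangulation -/

section Period

variable {X : Type*} [Finite X] {π : Equiv.Perm X} {f : X → ℕ}

omit [Finite X] in
theorem isCycleOn_level (h1 : ∀ x, f (π x) = f x) (h2 : ∀ x y, f x = f y → π.SameCycle x y)
    (i : ℕ) : π.IsCycleOn {x | f x = i} := by
  refine ⟨⟨fun x hx => (h1 x).trans hx, π.injective.injOn, fun x hx =>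
    ⟨π.symm x, ?_, by simp⟩⟩, fun x hx y hy => h2 x y (Eq.trans hx (Eq.symm hy))⟩
  have := h1 (π.symm x)
  rw [Equiv.apply_symm_apply] at this
  exact this.symm.trans hx

/-- If the cycles of `π` are the level sets of `f`, the length of a cycle is the cardinality of
the level set. -/
theorem pow_eq_pow_iff_of_level (h1 : ∀ x, f (π x) = f x)
    (h2 : ∀ x y, f x = f y → π.SameCycle x y) {x : X} {i : ℕ} (hx : f x = i) (a b : ℕ) :
    (π ^ a) x = (π ^ b) x ↔ a ≡ b [MOD Nat.card {y // f y = i}] := by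
  classical
  have := Fintype.ofFinite X
  have hc : π.IsCycleOn ((Finset.univ.filter fun x => f x = i : Finset X) : Set X) := by
    simpa using isCycleOn_level h1 h2 i
  rw [hc.pow_apply_eq_pow_apply (by simpa using hx), Nat.card_eq_fintype_card,
    Fintype.card_subtype]

theorem exists_pow_of_level (h1 : ∀ x, f (π x) = f x)
    (h2 : ∀ x y, f x = f y → π.SameCycle x y) {x y : X} {i : ℕ} (hx : f x = i) (hy : f y = i) :
    ∃ a < Nat.card {y // f y = i}, (π ^ a) x = y := by
  classical
  have := Fintype.ofFinite X
  have hc : π.IsCycleOn ((Finset.univ.filter fun x => f x = i : Finset X) : Set X) := by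
    simpa using isCycleOn_level h1 h2 i
  rw [Nat.card_eq_fintype_card, Fintype.card_subtype]
  exact hc.exists_pow_eq (by simpa using hx) (by simpa using hy)

end Period

namespace RootedMap

variable {M : RootedMap}

/-- The darts leading away from the root. -/
abbrev UpDart (M : RootedMap) : Type := {d : M.Dart // M.IsUp d}

/-- The forward darts. -/
abbrev ForwardDart (M : RootedMap) : Type := {d : M.Dart // M.IsForward d}

open Classical in
/-- The next edge within a strip, across the triangle to the left. -/
def strip (M : RootedMap) (d : M.Dart) : M.Dart :=
  if M.IsUp (M.next d) then M.next d else M.next (M.rev (M.next d))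

theorem strip_of_up {u : M.Dart} (h : M.IsUp (M.next u)) : M.strip u = M.next u := if_pos h

theorem IsForward.not_isUp {d : M.Dart} (h : M.IsForward d) : ¬ M.IsUp d := fun hu => by
  have := h.1
  rw [IsUp] at hu
  omega

theorem IsForward.not_isDown {d : M.Dart} (h : M.IsForward d) : ¬ M.IsDown d := fun hu => by
  have := h.1
  rw [IsDown] at hu
  omega

theorem IsUp.not_isDown {d : M.Dart} (h : M.IsUp d) : ¬ M.IsDown d := fun hu => by
  rw [IsUp] at h
  rw [IsDown] at hu
  omega

theorem isDown_rev {d : M.Dart} : M.IsDown (M.rev d) ↔ M.IsUp d := by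
  rw [IsDown, IsUp, M.rev_rev]

theorem isUp_rev {d : M.Dart} : M.IsUp (M.rev d) ↔ M.IsDown d := by
  rw [IsDown, IsUp, M.rev_rev]

theorem rev_injective {d d' : M.Dart} (h : M.rev d = M.rev d') : d = d' := by
  rw [← M.rev_rev d, h, M.rev_rev]

theorem strip_of_forward {u : M.Dart} (h : M.IsForward (M.next u)) :
    M.strip u = M.next (M.rev (M.next u)) := if_neg h.not_isUp

namespace IsCausal

variable {N l : ℕ} (hM : M.IsCausal N l)
include hM

theorem strip_isUp {u : M.Dart} (hu : M.IsUp u) : M.IsUp (M.strip u) := by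
  rcases hM.next_up hu with h | h
  · rwa [strip_of_up h]
  · rw [strip_of_forward h]; exact (hM.triangle_above_edge hu h).1

theorem ht_strip {u : M.Dart} (hu : M.IsUp u) : M.ht (M.strip u) = M.ht u := by
  rcases hM.next_up hu with h | h
  · rw [strip_of_up h, ht_next]
  · rw [strip_of_forward h, ht_next, h.1, ht_next]

theorem strip_injective {u v : M.Dart} (hu : M.IsUp u) (hv : M.IsUp v)
    (h : M.strip u = M.strip v) : u = v := by
  rcases hM.next_up hu with hu' | hu' <;> rcases hM.next_up hv with hv' | hv'
  · rw [strip_of_up hu', strip_of_up hv'] at h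
    exact M.next.injective h
  · obtain ⟨g, hg, hg1, hg2⟩ := hM.triangle_above_vertex hu hu'
    have h2 := (hM.triangle_above_edge hv hv').2
    rw [← strip_of_forward hv', ← h, strip_of_up hu', hg2] at h2
    exact absurd (rev_injective h2 ▸ hv) hg.not_isUp
  · obtain ⟨g, hg, hg1, hg2⟩ := hM.triangle_above_vertex hv hv'
    have h2 := (hM.triangle_above_edge hu hu').2
    rw [← strip_of_forward hu', h, strip_of_up hv', hg2] at h2
    exact absurd (rev_injective h2 ▸ hu) hg.not_isUp
  · have h1 := (hM.triangle_above_edge hu hu').2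
    have h2 := (hM.triangle_above_edge hv hv').2
    rw [← strip_of_forward hu', h, strip_of_forward hv', h2] at h1
    exact (rev_injective h1).symm

/-- `RootedMap.strip` as a permutation of the darts leading away from the root. -/
def upRot : Equiv.Perm M.UpDart :=
  Equiv.ofBijective (fun u => ⟨M.strip u, hM.strip_isUp u.2⟩)
    (Finite.injective_iff_bijective.1 fun u v h =>
      Subtype.ext (hM.strip_injective u.2 v.2 (congrArg Subtype.val h)))

theorem upRot_coe (u : M.UpDart) : (hM.upRot u : M.Dart) = M.strip u := rfl

theorem ht_upRot (u : M.UpDart) : M.ht (hM.upRot u) = M.ht u := hM.ht_strip u.2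

theorem exists_forward_at {d : M.Dart} (hd : M.ht d ≠ 0) :
    ∃ h : M.ForwardDart, M.tail h = M.tail d :=
  let ⟨h, hh, ht⟩ := hM.exists_forward (v := M.tail d) hd
  ⟨⟨h, hh⟩, ht⟩

theorem ht_forward_pos (h : M.ForwardDart) : 1 ≤ M.ht h := hM.ht_pos_of_horizontal h.2.1

theorem exists_succ (h : M.ForwardDart) : ∃ g : M.ForwardDart, M.tail g = M.head h :=
  hM.exists_forward_at (d := M.rev h) (by
    have := hM.ht_forward_pos h
    rw [h.2.1]
    omega)

/-- The next forward dart of a slice. -/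
def succ : Equiv.Perm M.ForwardDart :=
  Equiv.ofBijective (fun h => (hM.exists_succ h).choose)
    (Finite.injective_iff_bijective.1 fun g h hgh => Subtype.ext
      (hM.forward_unique_head g.2 h.2 (by
        rw [← (hM.exists_succ g).choose_spec, ← (hM.exists_succ h).choose_spec]
        exact congrArg _ (congrArg Subtype.val hgh))))

theorem tail_succ (h : M.ForwardDart) : M.tail (hM.succ h) = M.head h :=
  (hM.exists_succ h).choose_spec

theorem ht_succ (h : M.ForwardDart) : M.ht (hM.succ h) = M.ht h := by
  rw [← h.2.1]; exact M.ht_congr (hM.tail_succ h)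

theorem forward_ext {g h : M.ForwardDart} (hgh : M.tail g = M.tail h) : g = h :=
  Subtype.ext (hM.forward_unique g.2 h.2 hgh)

theorem sameCycle_succ (g h : M.ForwardDart) (hgh : M.ht g = M.ht h) :
    hM.succ.SameCycle g h := by
  obtain ⟨n, c, hc, hf, -⟩ := hM.exists_forward_slice (hM.ht_forward_pos g) (hM.ht_le g)
  have : NeZero n := ⟨hc.pos.ne'⟩
  have key : ∀ m : ℕ, ((hM.succ ^ m) ⟨c 0, ((hf _).2 ⟨0, rfl⟩).1⟩ : M.Dart) = c m := by
    intro m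
    induction m with
    | zero => simp
    | succ m ih =>
      have hfm := ((hf (c (m + 1 : ℕ))).2 ⟨_, rfl⟩).1
      refine hM.forward_unique (Subtype.property _) hfm ?_
      rw [pow_succ', Equiv.Perm.mul_apply, hM.tail_succ, ih, hc.head_eq, Nat.cast_succ]
  have key' : ∀ g' : M.ForwardDart, M.ht g' = M.ht g →
      hM.succ.SameCycle ⟨c 0, ((hf _).2 ⟨0, rfl⟩).1⟩ g' := by
    intro g' hg'
    obtain ⟨k, hk⟩ := (hf g').1 ⟨g'.2, hg'⟩
    refine ⟨k.val, ?_⟩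
    rw [zpow_natCast]
    apply Subtype.ext
    rw [key, ZMod.natCast_zmod_val, hk]
  exact (key' g rfl).symm.trans (key' h hgh.symm)

/-- The first edge upwards behind the end point of a forward dart. -/
def base (h : M.ForwardDart) (hh : M.ht h < N) : M.UpDart :=
  ⟨M.next (M.rev h), hM.up_right h.2 hh⟩

theorem tail_base (h : M.ForwardDart) (hh : M.ht h < N) : M.tail (hM.base h hh) = M.head h := by
  rw [base, tail_next, tail_rev]

theorem ht_up_lt (u : M.UpDart) : M.ht u < N := by
  have h1 := hM.ht_le (M.rev u)
  have h2 := u.2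
  rw [IsUp] at h2
  omega

theorem sameCycle_base (u : M.UpDart) (h : M.ForwardDart) (hh : M.ht h < N)
    (hu : M.tail h = M.tail u) : hM.upRot.SameCycle u (hM.base h hh) := by
  obtain ⟨a, ha, hmin⟩ := exists_first_pow (M.tail_eq_iff.1 hu.symm) (fun d => ¬ M.IsUp d)
    h.2.not_isUp
  simp only [not_not] at hmin
  have key : ∀ b < a, ((hM.upRot ^ b) u : M.Dart) = (M.next ^ b) (u : M.Dart) := by
    intro b
    induction b with
    | zero => exact fun _ => rfl
    | succ b ih =>
      intro hb
      have := hmin (b + 1) hb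
      rw [pow_succ', Equiv.Perm.mul_apply] at this
      rw [pow_succ', pow_succ', Equiv.Perm.mul_apply, Equiv.Perm.mul_apply, upRot_coe,
        ih (by omega), strip_of_up this]
  rcases a with _ | a
  · exact absurd u.2 ha
  rw [pow_succ', Equiv.Perm.mul_apply] at ha
  have hup := hmin a (Nat.lt_succ_self a)
  have hf := (hM.next_up hup).resolve_left ha
  have heq : M.next ((M.next ^ a) (u : M.Dart)) = h := by
    refine hM.forward_unique hf h.2 ?_
    rw [tail_next, hu]
    exact M.tail_eq_iff.2 (Equiv.Perm.sameCycle_pow_left.2 .rfl)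
  refine ⟨(a + 1 : ℕ), ?_⟩
  rw [zpow_natCast]
  apply Subtype.ext
  rw [pow_succ', Equiv.Perm.mul_apply, upRot_coe, key a (Nat.lt_succ_self a), strip_of_forward hf,
    heq]
  rfl

theorem isUp_of_ht_eq_zero {d : M.Dart} (hd : M.ht d = 0) : M.IsUp d := by
  rcases hM.cases_dart d with h | h | h | h
  · exact h
  · rw [IsDown] at h; omega
  · have := hM.ht_pos_of_horizontal h.1; omega
  · have h1 := hM.ht_pos_of_horizontal h.1
    have h2 := h.1
    rw [M.rev_rev] at h2
    omega

theorem sameCycle_upRot (u v : M.UpDart) (huv : M.ht u = M.ht v) : hM.upRot.SameCycle u v := by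
  by_cases h0 : M.ht u = 0
  · have htail : M.tail u = M.tail v :=
      ((hM.height_eq_zero _).1 h0).trans ((hM.height_eq_zero _).1 (huv.symm.trans h0)).symm
    obtain ⟨a, ha⟩ := (M.tail_eq_iff.1 htail).exists_nat_pow_eq
    have key : ∀ b : ℕ, ((hM.upRot ^ b) u : M.Dart) = (M.next ^ b) (u : M.Dart) := by
      intro b
      induction b with
      | zero => rfl
      | succ b ih =>
        rw [pow_succ', pow_succ', Equiv.Perm.mul_apply, Equiv.Perm.mul_apply, upRot_coe, ih,
          strip_of_up]
        refine hM.isUp_of_ht_eq_zero ?_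
        rw [ht_next, ← h0]
        exact M.ht_congr (M.tail_eq_iff.2 (Equiv.Perm.sameCycle_pow_left.2 .rfl))
    refine ⟨a, ?_⟩
    rw [zpow_natCast]
    exact Subtype.ext ((key a).trans ha)
  · obtain ⟨g, hg⟩ := hM.exists_forward_at h0
    obtain ⟨h, hh⟩ := hM.exists_forward_at (huv ▸ h0)
    have hgu := M.ht_congr hg
    have hhv := M.ht_congr hh
    have hgN : M.ht g < N := by rw [hgu]; exact hM.ht_up_lt u
    have hhN : M.ht h < N := by rw [hhv]; exact hM.ht_up_lt v
    refine (hM.sameCycle_base u g hgN hg).trans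
      (Equiv.Perm.SameCycle.trans ?_ (hM.sameCycle_base v h hhN hh).symm)
    obtain ⟨h1, h2⟩ := (hM.sameCycle_succ g h (by omega)).induction
      (p := fun x => ∃ hx : M.ht x < N, hM.upRot.SameCycle (hM.base g hgN) (hM.base x hx))
      ⟨hgN, .rfl⟩ (by
        rintro z ⟨hz, hz'⟩
        have hz2 : M.ht (hM.succ z) < N := by rwa [hM.ht_succ]
        refine ⟨hz2, hz'.trans (hM.sameCycle_base _ _ _ ?_)⟩
        rw [hM.tail_succ, hM.tail_base])
    exact h2

/-- The forward dart at the end point of a dart that leads away from the root. -/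
def edgeAbove (u : M.UpDart) : M.ForwardDart :=
  (hM.exists_forward_at (d := M.rev u) (by rw [u.2]; omega)).choose

theorem tail_edgeAbove (u : M.UpDart) : M.tail (hM.edgeAbove u) = M.head u :=
  (hM.exists_forward_at (d := M.rev u) (by rw [u.2]; omega)).choose_spec

theorem ht_edgeAbove (u : M.UpDart) : M.ht (hM.edgeAbove u) = M.ht u + 1 := by
  rw [← u.2]; exact M.ht_congr (hM.tail_edgeAbove u)

theorem isUp_root : M.IsUp M.root := hM.isUp_of_ht_eq_zero ((hM.height_eq_zero _).2 rfl)

open Classical in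
/-- The marked edge of every strip: the root edge, and in every further strip the first edge
upwards at the end point of the marked edge of the previous strip. -/
def marked : ℕ → M.UpDart
  | 0 => ⟨M.root, hM.isUp_root⟩
  | i + 1 => if h : M.ht (hM.succ.symm (hM.edgeAbove (marked i))) < N then
      hM.base (hM.succ.symm (hM.edgeAbove (marked i))) h else marked i

/-- The edges of a strip in counterclockwise order, from the marked one. -/
def rowU (i j : ℕ) : M.UpDart := (hM.upRot ^ j) (hM.marked i)

/-- The edges of a slice in counterclockwise order, from the one above the marked edge of the
strip below. -/
def rowH (i k : ℕ) : M.ForwardDart := (hM.succ ^ k) (hM.edgeAbove (hM.marked i))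

theorem rowU_succ (i j : ℕ) : (hM.rowU i (j + 1) : M.Dart) = M.strip (hM.rowU i j) := by
  rw [rowU, pow_succ', Equiv.Perm.mul_apply, upRot_coe, rowU]

theorem rowH_succ (i k : ℕ) : hM.rowH i (k + 1) = hM.succ (hM.rowH i k) := by
  rw [rowH, pow_succ', Equiv.Perm.mul_apply, rowH]

theorem ht_marked {i : ℕ} (hi : i < N) : M.ht (hM.marked i) = i := by
  induction i with
  | zero => exact (hM.height_eq_zero _).2 rfl
  | succ i ih =>
    have h1 : M.ht (hM.succ.symm (hM.edgeAbove (hM.marked i))) = i + 1 := by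
      rw [← hM.ht_succ, Equiv.apply_symm_apply, hM.ht_edgeAbove, ih (by omega)]
    rw [marked, dif_pos (by rw [h1]; exact hi), M.ht_congr (hM.tail_base _ _), ← h1]
    exact (hM.succ.symm (hM.edgeAbove (hM.marked i))).2.1

/-- The edge before the marked one lies in a triangle with a side in the slice below. -/
theorem marked_succ {i : ℕ} (hi : i + 1 < N) :
    (hM.marked (i + 1) : M.Dart) = M.next (M.rev (hM.succ.symm (hM.edgeAbove (hM.marked i)))) := by
  have h1 : M.ht (hM.succ.symm (hM.edgeAbove (hM.marked i))) = i + 1 := by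
    rw [← hM.ht_succ, Equiv.apply_symm_apply, hM.ht_edgeAbove, hM.ht_marked (by omega)]
  rw [marked, dif_pos (by rw [h1]; exact hi)]
  rfl

theorem ht_rowU {i : ℕ} (hi : i < N) (j : ℕ) : M.ht (hM.rowU i j) = i := by
  induction j with
  | zero => exact hM.ht_marked hi
  | succ j ih => rw [rowU_succ, hM.ht_strip (hM.rowU i j).2, ih]

theorem ht_rowH {i : ℕ} (hi : i < N) (k : ℕ) : M.ht (hM.rowH i k) = i + 1 := by
  induction k with
  | zero => exact (hM.ht_edgeAbove _).trans (by rw [hM.ht_marked hi])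
  | succ k ih => rw [rowH_succ, hM.ht_succ, ih]

omit hM in
/-- The number of edges of a strip. -/
def stripLen (M : RootedMap) (i : ℕ) : ℕ := Nat.card {u : M.UpDart // M.ht u = i}

omit hM in
/-- The number of edges of a slice. -/
def sliceLen (M : RootedMap) (i : ℕ) : ℕ := Nat.card {h : M.ForwardDart // M.ht h = i + 1}

theorem rowU_eq_iff {i : ℕ} (hi : i < N) (a b : ℕ) :
    hM.rowU i a = hM.rowU i b ↔ a ≡ b [MOD stripLen M i] :=
  pow_eq_pow_iff_of_level (f := fun u : M.UpDart => M.ht u) hM.ht_upRot hM.sameCycle_upRot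
    (hM.ht_marked hi) a b

theorem rowH_eq_iff {i : ℕ} (hi : i < N) (a b : ℕ) :
    hM.rowH i a = hM.rowH i b ↔ a ≡ b [MOD sliceLen M i] :=
  pow_eq_pow_iff_of_level (f := fun u : M.ForwardDart => M.ht u) hM.ht_succ hM.sameCycle_succ
    (hM.ht_rowH hi 0) a b

theorem exists_rowU (u : M.UpDart) : ∃ j < stripLen M (M.ht u), hM.rowU (M.ht u) j = u :=
  exists_pow_of_level (f := fun u : M.UpDart => M.ht u) hM.ht_upRot hM.sameCycle_upRot
    (hM.ht_marked (hM.ht_up_lt u)) rfl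

theorem exists_rowH {i : ℕ} (hi : i < N) (h : M.ForwardDart) (hh : M.ht h = i + 1) :
    ∃ k < sliceLen M i, hM.rowH i k = h :=
  exists_pow_of_level (f := fun u : M.ForwardDart => M.ht u) hM.ht_succ hM.sameCycle_succ
    (hM.ht_rowH hi 0) hh

open Classical in
/-- The positions of the triangles of a strip that have a side in the slice above. -/
def stripWord (i : ℕ) : Finset ℕ :=
  (Finset.range (stripLen M i)).filter fun j => M.IsUp (M.next (hM.rowU i j))

theorem mem_stripWord {i j : ℕ} (hj : j < stripLen M i) :
    j ∈ hM.stripWord i ↔ M.IsUp (M.next (hM.rowU i j)) := by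
  simp [stripWord, hj]

theorem forward_of_notMem {i j : ℕ} (hj : j < stripLen M i) (h : j ∉ hM.stripWord i) :
    M.IsForward (M.next (hM.rowU i j)) := by
  rw [hM.mem_stripWord hj] at h
  exact (hM.next_up (hM.rowU i j).2).resolve_left h

theorem mem_step {i j : ℕ} (hj : j < stripLen M i) (hm : j ∈ hM.stripWord i) :
    (hM.rowU i (j + 1) : M.Dart) = M.next (hM.rowU i j) ∧
      ∃ h : M.ForwardDart, M.next h = M.rev (hM.rowU i j) ∧
        M.next (M.rev (hM.rowU i (j + 1))) = M.rev h ∧ M.tail h = M.head (hM.rowU i j) ∧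
        M.head h = M.head (hM.rowU i (j + 1)) := by
  rw [hM.mem_stripWord hj] at hm
  have h1 : (hM.rowU i (j + 1) : M.Dart) = M.next (hM.rowU i j) := by
    rw [rowU_succ, strip_of_up hm]
  obtain ⟨h, hh, h2, h3⟩ := hM.triangle_above_vertex (hM.rowU i j).2 hm
  rw [← h1] at h3
  refine ⟨h1, ⟨h, hh⟩, h2, h3, ?_, ?_⟩
  · rw [← tail_rev, ← h2, tail_next]
  · rw [← tail_rev, ← tail_rev, ← h3, tail_next]

theorem notMem_step {i j : ℕ} (hj : j < stripLen M i) (hm : j ∉ hM.stripWord i) :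
    (hM.rowU i (j + 1) : M.Dart) = M.next (M.rev (M.next (hM.rowU i j))) ∧
      M.next (M.rev (hM.rowU i (j + 1))) = M.rev (hM.rowU i j) := by
  have hf := hM.forward_of_notMem hj hm
  have h1 : (hM.rowU i (j + 1) : M.Dart) = M.next (M.rev (M.next (hM.rowU i j))) := by
    rw [rowU_succ, strip_of_forward hf]
  exact ⟨h1, by rw [h1, (hM.triangle_above_edge (hM.rowU i j).2 hf).2]⟩

theorem head_rowU {i j : ℕ} (hj : j ≤ stripLen M i) :
    M.head (hM.rowU i j) = M.tail (hM.rowH i (inCount (hM.stripWord i) j)) := by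
  induction j with
  | zero => rw [inCount_zero]; exact (hM.tail_edgeAbove _).symm
  | succ j ih =>
    have ih := ih (by omega)
    rw [inCount_succ]
    split_ifs with hm
    · obtain ⟨-, h, -, -, h3, h4⟩ := hM.mem_step (by omega) hm
      rw [rowH_succ, hM.tail_succ, ← h4]
      rw [ih] at h3
      rw [hM.forward_ext h3]
    · rw [add_zero, ← ih, ← tail_rev, ← tail_rev,
        ← (hM.notMem_step (by omega) hm).2, tail_next]

theorem tail_rowU {i j : ℕ} (hi : i + 1 < N) (hj : j ≤ stripLen M (i + 1)) :
    M.tail (hM.rowU (i + 1) j) =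
      M.tail (hM.rowH i (outCount (hM.stripWord (i + 1)) j)) := by
  induction j with
  | zero =>
    rw [outCount_zero]
    change M.tail (hM.marked (i + 1)) = M.tail (hM.edgeAbove (hM.marked i))
    rw [hM.marked_succ hi, tail_next, tail_rev, ← hM.tail_succ, Equiv.apply_symm_apply]
  | succ j ih =>
    have ih := ih (by omega)
    rw [outCount_succ]
    split_ifs with hm
    · rw [add_zero, ← ih, (hM.mem_step (by omega) hm).1, tail_next]
    · rw [rowH_succ, hM.tail_succ, (hM.notMem_step (by omega) hm).1, tail_next, tail_rev]
      congr 1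
      refine hM.forward_unique (hM.forward_of_notMem (by omega) hm) (Subtype.property _) ?_
      rw [tail_next, ih]

theorem rowH_of_mem {i j : ℕ} (hj : j < stripLen M i) (hm : j ∈ hM.stripWord i) :
    M.next (hM.rowH i (inCount (hM.stripWord i) j)) = M.rev (hM.rowU i j) ∧
      M.next (M.rev (hM.rowU i (j + 1))) = M.rev (hM.rowH i (inCount (hM.stripWord i) j)) := by
  obtain ⟨-, h, h1, h2, h3, -⟩ := hM.mem_step hj hm
  rw [hM.head_rowU hj.le] at h3
  rw [← hM.forward_ext h3]
  exact ⟨h1, h2⟩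

theorem next_rowU_of_notMem {i j : ℕ} (hi : i + 1 < N) (hj : j < stripLen M (i + 1))
    (hm : j ∉ hM.stripWord (i + 1)) :
    M.next (hM.rowU (i + 1) j) = hM.rowH i (outCount (hM.stripWord (i + 1)) j) := by
  refine hM.forward_unique (hM.forward_of_notMem hj hm) (Subtype.property _) ?_
  rw [tail_next, hM.tail_rowU hi hj.le]

end IsCausal

end RootedMap


namespace RootedMap

variable {M : RootedMap}

namespace IsCausal

variable {N l : ℕ} (hM : M.IsCausal N l)
include hM

theorem outer_of_forward {d : M.Dart} (hd : M.IsForward d) (hN : M.ht d = N) :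
    M.face d = M.outerFace := by
  obtain ⟨e, he⟩ := M.exists_face M.outerFace
  obtain ⟨he1, he2⟩ := hM.forward_of_outer he
  refine ((hM.sameCycle_succ ⟨e, he1⟩ ⟨d, hd⟩ (he2.trans hN.symm)).induction
    (p := fun x => M.ht x = N ∧ M.face x = M.outerFace) ⟨he2, he⟩ ?_).2
  rintro z ⟨hz, hz'⟩
  refine ⟨(hM.ht_succ z).trans hz, ?_⟩
  have : M.next (M.rev z) = hM.succ z := by
    refine hM.forward_unique (hM.forward_right_last z.2 hz) (Subtype.property _) ?_
    rw [tail_next, tail_rev, hM.tail_succ]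
  rw [← this, face_next_rev, hz']

theorem face_eq_outer_iff (d : M.Dart) :
    M.face d = M.outerFace ↔ M.IsForward d ∧ M.ht d = N :=
  ⟨hM.forward_of_outer, fun h => hM.outer_of_forward h.1 h.2⟩

theorem stripLen_pos {i : ℕ} (hi : i < N) : 0 < stripLen M i := by
  have : Nonempty {u : M.UpDart // M.ht u = i} := ⟨⟨hM.marked i, hM.ht_marked hi⟩⟩
  exact Nat.card_pos

theorem sliceLen_pos {i : ℕ} (hi : i < N) : 0 < sliceLen M i := by
  have : Nonempty {h : M.ForwardDart // M.ht h = i + 1} := ⟨⟨hM.rowH i 0, hM.ht_rowH hi 0⟩⟩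
  exact Nat.card_pos

theorem rowU_injOn {i a b : ℕ} (hi : i < N) (ha : a < stripLen M i) (hb : b < stripLen M i)
    (h : hM.rowU i a = hM.rowU i b) : a = b :=
  Nat.ModEq.eq_of_lt_of_lt ((hM.rowU_eq_iff hi a b).1 h) ha hb

theorem rowH_injOn {i a b : ℕ} (hi : i < N) (ha : a < sliceLen M i) (hb : b < sliceLen M i)
    (h : hM.rowH i a = hM.rowH i b) : a = b :=
  Nat.ModEq.eq_of_lt_of_lt ((hM.rowH_eq_iff hi a b).1 h) ha hb

theorem rowU_stripLen {i : ℕ} (hi : i < N) : hM.rowU i (stripLen M i) = hM.rowU i 0 :=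
  (hM.rowU_eq_iff hi _ _).2 (by simp [Nat.ModEq])

theorem rowH_sliceLen {i : ℕ} (hi : i < N) : hM.rowH i (sliceLen M i) = hM.rowH i 0 :=
  (hM.rowH_eq_iff hi _ _).2 (by simp [Nat.ModEq])

omit hM in
theorem stripWord_lt (hM : M.IsCausal N l) {i j : ℕ} (hj : j ∈ hM.stripWord i) :
    j < stripLen M i := by
  classical
  exact Finset.mem_range.1 (Finset.filter_subset _ _ hj)

/-- Every edge of a slice is a side of exactly one triangle of the strip below. -/
theorem card_stripWord {i : ℕ} (hi : i < N) : (hM.stripWord i).card = sliceLen M i := by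
  rw [sliceLen, ← Set.ncard_coe_finset, ← Nat.card_coe_set_eq]
  refine Nat.card_congr (Equiv.ofBijective (fun j : (hM.stripWord i : Set ℕ) =>
    (⟨hM.rowH i (inCount (hM.stripWord i) j), hM.ht_rowH hi _⟩ :
      {h : M.ForwardDart // M.ht h = i + 1})) ⟨?_, ?_⟩)
  · rintro ⟨a, ha⟩ ⟨b, hb⟩ hab
    have ha' := hM.stripWord_lt ha
    have hb' := hM.stripWord_lt hb
    have h : hM.rowH i _ = hM.rowH i _ := congrArg Subtype.val hab
    have h1 := (hM.rowH_of_mem ha' ha).1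
    rw [h, (hM.rowH_of_mem hb' hb).1] at h1
    exact Subtype.ext (hM.rowU_injOn hi ha' hb' (Subtype.ext (rev_injective h1.symm)))
  · rintro ⟨h, hh⟩
    obtain ⟨h1, h2, -⟩ := hM.triangle_below_edge h.2
    have hht : M.ht (M.rev (M.next h)) = i := by
      have := h.2.2
      rw [IsDown, ht_next, hh] at this
      omega
    obtain ⟨j, hj, hju⟩ := hM.exists_rowU ⟨_, h1⟩
    simp only [hht] at hj hju
    have hm : j ∈ hM.stripWord i := by rw [hM.mem_stripWord hj, hju]; exact h2
    refine ⟨⟨j, hm⟩, Subtype.ext (Subtype.ext (M.next.injective ?_))⟩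
    rw [(hM.rowH_of_mem hj hm).1, hju, M.rev_rev]

/-- Every edge of a slice other than the last is a side of exactly one triangle of the strip
above. -/
theorem card_sdiff_stripWord {i : ℕ} (hi : i + 1 < N) :
    (Finset.range (stripLen M (i + 1)) \ hM.stripWord (i + 1)).card = sliceLen M i := by
  set s := Finset.range (stripLen M (i + 1)) \ hM.stripWord (i + 1) with hs
  have hmem : ∀ j ∈ s, j < stripLen M (i + 1) ∧ j ∉ hM.stripWord (i + 1) := by simp [hs]
  rw [sliceLen, ← Set.ncard_coe_finset, ← Nat.card_coe_set_eq]
  refine Nat.card_congr (Equiv.ofBijective (fun j : (s : Set ℕ) =>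
    (⟨hM.rowH i (outCount (hM.stripWord (i + 1)) j), hM.ht_rowH (by omega) _⟩ :
      {h : M.ForwardDart // M.ht h = i + 1})) ⟨?_, ?_⟩)
  · rintro ⟨a, ha⟩ ⟨b, hb⟩ hab
    obtain ⟨ha', ha⟩ := hmem a ha
    obtain ⟨hb', hb⟩ := hmem b hb
    have h : hM.rowH i _ = hM.rowH i _ := congrArg Subtype.val hab
    have h1 := hM.next_rowU_of_notMem hi ha' ha
    rw [h, ← hM.next_rowU_of_notMem hi hb' hb] at h1
    exact Subtype.ext (hM.rowU_injOn hi ha' hb' (Subtype.ext (M.next.injective h1)))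
  · rintro ⟨h, hh⟩
    have hp : M.ht (M.next.symm h) = i + 1 := by
      rw [← hh, ← ht_next (M.next.symm h), Equiv.apply_symm_apply]
    have hup : M.IsUp (M.next.symm h) := by
      rw [IsUp, hM.ht_rev_prev, hM.ht_right h.2, if_pos (by omega), hp, hh]
    obtain ⟨j, hj, hju⟩ := hM.exists_rowU ⟨_, hup⟩
    simp only [hp] at hj hju
    have hm : j ∉ hM.stripWord (i + 1) := by
      rw [hM.mem_stripWord hj, hju, Equiv.apply_symm_apply]
      exact h.2.not_isUp
    refine ⟨⟨j, by simp [hs, hj, hm]⟩, Subtype.ext (Subtype.ext ?_)⟩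
    rw [← hM.next_rowU_of_notMem hi hj hm, hju, Equiv.apply_symm_apply]

theorem stripWord_subset {i : ℕ} : hM.stripWord i ⊆ Finset.range (stripLen M i) :=
  fun _ hj => Finset.mem_range.2 (hM.stripWord_lt hj)

theorem stripLen_succ {i : ℕ} (hi : i + 1 < N) :
    stripLen M (i + 1) = sliceLen M i + sliceLen M (i + 1) := by
  rw [← hM.card_stripWord hi, ← hM.card_sdiff_stripWord hi,
    Finset.card_sdiff_add_card_eq_card hM.stripWord_subset, Finset.card_range]

theorem stripWord_zero : hM.stripWord 0 = Finset.range (stripLen M 0) := by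
  by_cases hN : 0 < N
  · refine Finset.Subset.antisymm hM.stripWord_subset fun j hj => ?_
    rw [hM.mem_stripWord (Finset.mem_range.1 hj)]
    exact hM.isUp_of_ht_eq_zero (by rw [ht_next, hM.ht_rowU hN])
  · exact absurd (hM.ht_up_lt ⟨_, hM.isUp_root⟩) (by omega)

theorem stripLen_zero (hN : 0 < N) : stripLen M 0 = sliceLen M 0 := by
  rw [← hM.card_stripWord hN, hM.stripWord_zero, Finset.card_range]

theorem last_notMem_stripWord {i : ℕ} (hi : i + 1 < N) :
    stripLen M (i + 1) - 1 ∉ hM.stripWord (i + 1) := by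
  intro hm
  have hpos := hM.stripLen_pos hi
  have h1 := (hM.mem_step (by omega) hm).1
  rw [Nat.sub_add_cancel hpos, hM.rowU_stripLen hi] at h1
  change (hM.marked (i + 1) : M.Dart) = _ at h1
  rw [hM.marked_succ hi] at h1
  have h2 := (hM.rowU (i + 1) (stripLen M (i + 1) - 1)).2
  rw [← M.next.injective h1, isUp_rev] at h2
  exact (hM.succ.symm (hM.edgeAbove (hM.marked i))).2.not_isDown h2

/-- The sizes and words of a causal triangulation. -/
def data (hN : 0 < N) : SliceData N where
  size := sliceLen M
  word := hM.stripWord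
  pos := hN
  size_pos _ := hM.sliceLen_pos
  word_zero := by rw [hM.stripWord_zero, hM.stripLen_zero hN]
  word_subset i hi j hj := by
    rw [Finset.mem_range, ← hM.stripLen_succ hi]
    have h1 := hM.stripWord_lt hj
    rcases eq_or_ne j (stripLen M (i + 1) - 1) with rfl | h
    · exact absurd hj (hM.last_notMem_stripWord hi)
    · omega
  card_word _ := hM.card_stripWord

theorem sliceLen_last (hN : 0 < N) : sliceLen M (N - 1) = l := by
  rw [← hM.card_last, sliceLen, Nat.sub_add_cancel hN]
  refine Nat.card_congr (Equiv.ofBijective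
    (fun h : {h : M.ForwardDart // M.ht h = N} =>
      (⟨M.tail h, h.2⟩ : {v : M.Vertex // M.height v = N})) ⟨?_, ?_⟩)
  · intro g h hgh
    exact Subtype.ext (hM.forward_ext (congrArg Subtype.val hgh))
  · rintro ⟨v, hv⟩
    obtain ⟨d, hd, rfl⟩ := hM.exists_forward (v := v) (by omega)
    exact ⟨⟨⟨d, hd⟩, hv⟩, rfl⟩

section Iso

variable (D : SliceData N) (hs : ∀ i < N, D.size i = sliceLen M i)
  (hw : ∀ i < N, D.word i = hM.stripWord i)

/-- The darts of the map with the sizes and words of `M`, as darts of `M`. -/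
def dartMap : D.map.Dart → M.Dart
  | .up u => hM.rowU u.i u.j
  | .dn u => M.rev (hM.rowU u.i u.j)
  | .fwd h => hM.rowH h.i h.j
  | .bwd h => M.rev (hM.rowH h.i h.j)

include hs in
theorem len_eq {i : ℕ} (hi : i < N) : D.len i = stripLen M i := by
  rcases i with _ | i
  · rw [hM.stripLen_zero D.pos]; exact hs 0 hi
  · rw [hM.stripLen_succ hi, ← hs _ hi, ← hs i (by omega)]; rfl

include hs in
theorem rowU_rot (u : D.U) : hM.rowU (Cell.rot u).i (Cell.rot u).j = hM.rowU u.i (u.j + 1) := by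
  rw [Cell.rot_i, Cell.rot_j]
  split_ifs with h
  · rfl
  · have h1 := u.hj
    have h2 : u.j + 1 = stripLen M u.i := by rw [← hM.len_eq D hs u.hi]; omega
    rw [h2, hM.rowU_stripLen u.hi]

include hs in
theorem rowH_rot (h : D.H) : hM.rowH (Cell.rot h).i (Cell.rot h).j = hM.rowH h.i (h.j + 1) := by
  rw [Cell.rot_i, Cell.rot_j]
  split_ifs with hh
  · rfl
  · have h1 := h.hj
    have h2 : h.j + 1 = sliceLen M h.i := by rw [← hs _ h.hi]; omega
    rw [h2, hM.rowH_sliceLen h.hi]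

include hs hw in
theorem dartMap_next (d : D.map.Dart) :
    hM.dartMap D (D.map.next d) = M.next (hM.dartMap D d) := by
  have hlen : ∀ u : D.U, u.j < stripLen M u.i := fun u => by
    rw [← hM.len_eq D hs u.hi]; exact u.hj
  have hinr : ∀ (u : D.U) (h : D.H), D.side u = .inr h →
      u.j ∈ hM.stripWord u.i ∧ hM.rowH h.i h.j = hM.rowH u.i (inCount (hM.stripWord u.i) u.j) := by
    intro u h hu
    obtain ⟨h1, h2, h3⟩ := D.side_eq_inr.1 hu
    rw [hw _ u.hi] at h1 h3
    exact ⟨h1, by rw [h2, h3]⟩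
  have hinl : ∀ (u : D.U) (h : D.H), D.side u = .inl h →
      u.j ∉ hM.stripWord u.i ∧ M.next (hM.rowU u.i u.j) = hM.rowH h.i h.j := by
    rintro ⟨i, j, hi, hj⟩ h hu
    obtain ⟨h1, h2, h3⟩ := D.side_eq_inl.1 hu
    dsimp only at h1 h2 h3
    subst h2
    rw [hw _ hi] at h1 h3
    exact ⟨h1, by rw [h3]; exact hM.next_rowU_of_notMem hi (hlen ⟨_, j, hi, hj⟩) h1⟩
  rcases d with u | u | h | h
  · rcases hu : D.side u with h | h
    · rw [D.skeleton.next_up_inl hu]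
      exact (hinl u h hu).2.symm
    · rw [D.skeleton.next_up_inr hu]
      exact (congrArg _ (hM.rowU_rot D hs u)).trans (hM.mem_step (hlen u) (hinr u h hu).1).1
  · obtain ⟨u, rfl⟩ := Equiv.surjective Cell.rot u
    have hr := hM.rowU_rot D hs u
    rcases hu : D.side u with h | h
    · rw [D.skeleton.next_dn_inl hu]
      change M.rev (hM.rowU u.i u.j) = M.next (M.rev (hM.rowU (Cell.rot u).i (Cell.rot u).j))
      rw [hr, (hM.notMem_step (hlen u) (hinl u h hu).1).2]
    · rw [D.skeleton.next_dn_inr hu]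
      change M.rev (hM.rowH h.i h.j) = M.next (M.rev (hM.rowU (Cell.rot u).i (Cell.rot u).j))
      rw [hr, (hM.rowH_of_mem (hlen u) (hinr u h hu).1).2, (hinr u h hu).2]
  · have hu := D.skeleton.side_below h
    change M.rev (hM.rowU (D.below h).i (D.below h).j) = M.next (hM.rowH h.i h.j)
    rw [(hinr _ h hu).2, (hM.rowH_of_mem (hlen _) (hinr _ h hu).1).1]
  · rcases ha : D.above h with _ | u
    · rw [D.skeleton.next_bwd_none ha]
      have hN : h.i + 1 = N := (D.skeleton.above_eq_none h).1 ha
      change (hM.rowH (Cell.rot h).i (Cell.rot h).j : M.Dart) = M.next (M.rev (hM.rowH h.i h.j))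
      rw [hM.rowH_rot D hs]
      refine hM.forward_unique (Subtype.property _) (hM.forward_right_last (Subtype.property _)
        ((hM.ht_rowH h.hi _).trans hN)) ?_
      rw [tail_next, tail_rev, rowH_succ, hM.tail_succ]
    · rw [D.skeleton.next_bwd_some ha]
      have hu := D.skeleton.side_of_above _ _ ha
      change (hM.rowU (Cell.rot u).i (Cell.rot u).j : M.Dart) = M.next (M.rev (hM.rowH h.i h.j))
      rw [hM.rowU_rot D hs, (hM.notMem_step (hlen u) (hinl u h hu).1).1, (hinl u h hu).2]

include hs in
theorem dartMap_bijective : Function.Bijective (hM.dartMap D) := by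
  have hlen : ∀ u : D.U, u.j < stripLen M u.i := fun u => by
    rw [← hM.len_eq D hs u.hi]; exact u.hj
  have hsize : ∀ h : D.H, h.j < sliceLen M h.i := fun h => by
    rw [← hs h.i h.hi]; exact h.hj
  have hU : ∀ u v : D.U, (hM.rowU u.i u.j : M.Dart) = hM.rowU v.i v.j → u = v := by
    intro u v huv
    have h1 : u.i = v.i := by rw [← hM.ht_rowU u.hi u.j, huv, hM.ht_rowU v.hi]
    ext
    · exact h1
    · refine hM.rowU_injOn u.hi (hlen u) (h1 ▸ hlen v) (Subtype.ext ?_)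
      rw [huv, h1]
  have hH : ∀ g h : D.H, (hM.rowH g.i g.j : M.Dart) = hM.rowH h.i h.j → g = h := by
    intro g h hgh
    have h1 : g.i = h.i := by
      have h2 := hM.ht_rowH g.hi g.j
      rw [hgh, hM.ht_rowH h.hi] at h2
      omega
    ext
    · exact h1
    · refine hM.rowH_injOn g.hi (hsize g) (h1 ▸ hsize h) (Subtype.ext ?_)
      rw [hgh, h1]
  have hup : ∀ u : D.U, M.IsUp (hM.rowU u.i u.j) := fun u => Subtype.property _
  have hdn : ∀ u : D.U, M.IsDown (M.rev (hM.rowU u.i u.j)) := fun u =>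
    isDown_rev.2 (Subtype.property _)
  have hfw : ∀ h : D.H, M.IsForward (hM.rowH h.i h.j) := fun u => Subtype.property _
  have hbw : ∀ h : D.H, M.IsForward (M.rev (M.rev (hM.rowH h.i h.j))) := fun h => by
    rw [M.rev_rev]; exact hfw h
  have hbu : ∀ {d : M.Dart}, M.IsForward (M.rev d) → ¬ M.IsUp d := fun hd hu =>
    hd.not_isDown (isDown_rev.2 hu)
  have hbd : ∀ {d : M.Dart}, M.IsForward (M.rev d) → ¬ M.IsDown d := fun hd hu =>
    hd.not_isUp (isUp_rev.2 hu)
  constructor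
  · intro d d' hdd
    rcases d with u | u | g | g <;> rcases d' with v | v | h | h <;>
      simp only [dartMap] at hdd
    · rw [hU _ _ hdd]
    · exact absurd (hdd ▸ hdn v) (hup u).not_isDown
    · exact absurd (hdd ▸ hup u) (hfw h).not_isUp
    · exact absurd (hdd ▸ hup u) (hbu (hbw h))
    · exact absurd (hdd ▸ hdn u) (hup v).not_isDown
    · rw [hU _ _ (rev_injective hdd)]
    · exact absurd (hdd ▸ hdn u) (hfw h).not_isDown
    · exact absurd (hdd ▸ hdn u) (hbd (hbw h))
    · exact absurd (hdd ▸ hup v) (hfw g).not_isUp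
    · exact absurd (hdd ▸ hdn v) (hfw g).not_isDown
    · rw [hH _ _ hdd]
    · exact absurd (hdd ▸ hbw h) (hM.not_forward_rev (hfw g))
    · exact absurd (hdd ▸ hup v) (hbu (hbw g))
    · exact absurd (hdd ▸ hdn v) (hbd (hbw g))
    · exact absurd (hdd ▸ hbw g) (hM.not_forward_rev (hfw h))
    · rw [hH _ _ (rev_injective hdd)]
  · have hU' : ∀ d, M.IsUp d → ∃ u : D.U, (hM.rowU u.i u.j : M.Dart) = d := by
      intro d hd
      obtain ⟨j, hj, hju⟩ := hM.exists_rowU ⟨d, hd⟩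
      have hi := hM.ht_up_lt ⟨d, hd⟩
      exact ⟨⟨M.ht d, j, hi, by rw [hM.len_eq D hs hi]; exact hj⟩, congrArg Subtype.val hju⟩
    have hH' : ∀ d, M.IsForward d → ∃ h : D.H, (hM.rowH h.i h.j : M.Dart) = d := by
      intro d hd
      have h1 := hM.ht_forward_pos ⟨d, hd⟩
      have h2 := hM.ht_le d
      dsimp only at h1
      obtain ⟨k, hk, hkh⟩ := hM.exists_rowH (i := M.ht d - 1) (by omega) ⟨d, hd⟩
        (by dsimp only; omega)
      exact ⟨⟨M.ht d - 1, k, by omega, by rw [hs _ (by omega)]; exact hk⟩,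
        congrArg Subtype.val hkh⟩
    intro d
    rcases hM.cases_dart d with h | h | h | h
    · obtain ⟨u, hu⟩ := hU' d h
      exact ⟨.up u, hu⟩
    · obtain ⟨u, hu⟩ := hU' _ (isUp_rev.2 h)
      exact ⟨.dn u, by simp only [dartMap, hu, M.rev_rev]⟩
    · obtain ⟨g, hg⟩ := hH' d h
      exact ⟨.fwd g, hg⟩
    · obtain ⟨g, hg⟩ := hH' _ h
      exact ⟨.bwd g, by simp only [dartMap, hg, M.rev_rev]⟩

include hs hw in
/-- A causal triangulation is determined by its sizes and words. -/
theorem iso_map : Iso D.map M := by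
  have hbij := hM.dartMap_bijective D hs
  refine ⟨Equiv.ofBijective _ hbij, hM.dartMap_next D hs hw, ?_, rfl, ?_⟩
  · rintro (u | u | h | h)
    · rfl
    · exact (M.rev_rev _).symm
    · rfl
    · exact (M.rev_rev _).symm
  · intro d
    rw [D.skeleton.face_eq_outerFace_iff, hM.face_eq_outer_iff]
    rcases d with u | u | h | h
    · simp only [Skeleton.right, reduceCtorEq, false_iff, not_and]
      exact fun h => absurd (Subtype.property _) h.not_isUp
    · simp only [Skeleton.right, reduceCtorEq, false_iff, not_and]
      exact fun h => absurd (isDown_rev.2 (Subtype.property _)) h.not_isDown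
    · refine (D.skeleton.above_eq_none h).trans ?_
      change h.i + 1 = N ↔ M.IsForward (hM.rowH h.i h.j) ∧ M.ht (hM.rowH h.i h.j) = N
      rw [hM.ht_rowH h.hi]
      exact ⟨fun hN => ⟨Subtype.property _, hN⟩, fun hN => hN.2⟩
    · simp only [Skeleton.right, reduceCtorEq, false_iff, not_and]
      exact fun hf => absurd hf (hM.not_forward_rev (Subtype.property _))

end Iso

end IsCausal

end RootedMap


/-! ### Isomorphic maps -/

namespace RootedMap

section Invariance

variable {M M' : RootedMap} (e : M.Dart ≃ M'.Dart) (hn : ∀ d, e (M.next d) = M'.next (e d))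
  (hr : ∀ d, e (M.rev d) = M'.rev (e d))

include hn in
theorem sameCycle_next_of_iso (d d' : M.Dart) :
    M.next.SameCycle d d' ↔ M'.next.SameCycle (e d) (e d') := by
  constructor
  · intro h
    refine h.induction (p := fun x => M'.next.SameCycle (e d) (e x)) .rfl fun z hz => ?_
    rw [hn]; exact Equiv.Perm.sameCycle_apply_right.2 hz
  · intro h
    have := h.induction (p := fun x => M.next.SameCycle d (e.symm x))
      (by rw [Equiv.symm_apply_apply]) fun z hz => by
        have h2 : e.symm (M'.next z) = M.next (e.symm z) := by
          rw [Equiv.symm_apply_eq, hn, Equiv.apply_symm_apply]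
        rw [h2]; exact Equiv.Perm.sameCycle_apply_right.2 hz
    rwa [Equiv.symm_apply_apply] at this

include hn hr in
theorem sameCycle_face_of_iso (d d' : M.Dart) :
    (M.next * M.rev).SameCycle d d' ↔ (M'.next * M'.rev).SameCycle (e d) (e d') := by
  have hnr : ∀ d, e ((M.next * M.rev) d) = (M'.next * M'.rev) (e d) := fun d => by
    rw [Equiv.Perm.mul_apply, Equiv.Perm.mul_apply, hn, hr]
  constructor
  · intro h
    refine h.induction (p := fun x => (M'.next * M'.rev).SameCycle (e d) (e x)) .rfl
      fun z hz => ?_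
    rw [hnr]; exact Equiv.Perm.sameCycle_apply_right.2 hz
  · intro h
    have := h.induction (p := fun x => (M.next * M.rev).SameCycle d (e.symm x))
      (by rw [Equiv.symm_apply_apply]) fun z hz => by
        have h2 : e.symm ((M'.next * M'.rev) z) = (M.next * M.rev) (e.symm z) := by
          rw [Equiv.symm_apply_eq, hnr, Equiv.apply_symm_apply]
        rw [h2]; exact Equiv.Perm.sameCycle_apply_right.2 hz
    rwa [Equiv.symm_apply_apply] at this

/-- The bijection of the vertices induced by an isomorphism. -/
def vertexIso : M.Vertex ≃ M'.Vertex :=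
  cycleQuotientEquiv M.next (fun d => M'.tail (e d))
    (fun d d' => (sameCycle_next_of_iso e hn d d').trans M'.tail_eq_iff.symm)
    (fun v => by
      obtain ⟨d, rfl⟩ := M'.exists_tail v
      exact ⟨e.symm d, congrArg M'.tail (e.apply_symm_apply d)⟩)

/-- The bijection of the faces induced by an isomorphism. -/
def faceIso : M.Face ≃ M'.Face :=
  cycleQuotientEquiv (M.next * M.rev) (fun d => M'.face (e d))
    (fun d d' => (sameCycle_face_of_iso e hn hr d d').trans M'.face_eq_iff.symm)
    (fun v => by
      obtain ⟨d, rfl⟩ := M'.exists_face v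
      exact ⟨e.symm d, congrArg M'.face (e.apply_symm_apply d)⟩)

theorem vertexIso_tail (d : M.Dart) : vertexIso e hn (M.tail d) = M'.tail (e d) := rfl

theorem faceIso_face (d : M.Dart) : faceIso e hn hr (M.face d) = M'.face (e d) := rfl

include hr in
theorem vertexIso_head (d : M.Dart) : vertexIso e hn (M.head d) = M'.head (e d) := by
  rw [← tail_rev, vertexIso_tail, hr, tail_rev]

/-- The isomorphism of the adjacency graphs induced by an isomorphism. -/
def graphIso : M.graph ≃g M'.graph where
  toEquiv := vertexIso e hn
  map_rel_iff' := by
    intro u v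
    change (_ ≠ _ ∧ _) ↔ (_ ≠ _ ∧ _)
    rw [(vertexIso e hn).injective.ne_iff]
    refine and_congr_right fun _ => ⟨?_, ?_⟩
    · rintro ⟨d, h1, h2⟩
      refine ⟨e.symm d, (vertexIso e hn).injective ?_, (vertexIso e hn).injective ?_⟩
      · rw [vertexIso_tail, Equiv.apply_symm_apply, h1]
      · rw [vertexIso_head e hn hr, Equiv.apply_symm_apply, h2]
    · rintro ⟨d, rfl, rfl⟩
      exact ⟨e d, (vertexIso_tail e hn d).symm, (vertexIso_head e hn hr d).symm⟩

include hn hr in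
theorem ht_of_iso (hroot : e M.root = M'.root) (hc : M.graph.Connected) (d : M.Dart) :
    M'.ht (e d) = M.ht d := by
  have hle : ∀ {V V' : Type} {G : SimpleGraph V} {G' : SimpleGraph V'} (f : G ≃g G')
      (_ : G.Connected) (u v : V), G'.dist (f u) (f v) ≤ G.dist u v := by
    intro V V' G G' f hG u v
    obtain ⟨p, hp⟩ := (hG.preconnected u v).exists_walk_length_eq_dist
    rw [← hp, ← p.length_map f.toHom]
    exact SimpleGraph.dist_le _
  have h1 : ∀ u v, M'.graph.dist (graphIso e hn hr u) (graphIso e hn hr v) = M.graph.dist u v := by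
    intro u v
    refine le_antisymm (hle _ hc u v) ?_
    have := hle (graphIso e hn hr).symm ((graphIso e hn hr).connected_iff.1 hc)
      (graphIso e hn hr u) (graphIso e hn hr v)
    rwa [RelIso.symm_apply_apply, RelIso.symm_apply_apply] at this
  rw [ht, ht, height, height, ← h1]
  congr 1
  rw [rootVertex, rootVertex, ← hroot]
  rfl

include hn hr in
theorem isUp_of_iso (hroot : e M.root = M'.root) (hc : M.graph.Connected) (d : M.Dart) :
    M'.IsUp (e d) ↔ M.IsUp d := by
  rw [IsUp, IsUp, ← hr, ht_of_iso e hn hr hroot hc, ht_of_iso e hn hr hroot hc]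

include hn hr in
theorem strip_of_iso (hroot : e M.root = M'.root) (hc : M.graph.Connected) (d : M.Dart) :
    e (M.strip d) = M'.strip (e d) := by
  have h := isUp_of_iso e hn hr hroot hc (M.next d)
  rw [hn] at h
  by_cases hu : M.IsUp (M.next d)
  · rw [strip, strip, if_pos hu, if_pos (h.2 hu), hn]
  · rw [strip, strip, if_neg hu, if_neg (mt h.1 hu), ← hn, ← hr, ← hn]

end Invariance

end RootedMap

namespace SliceData

variable {N : ℕ} (D : SliceData N)

theorem isUp_up (u : D.U) : D.map.IsUp (.up u) := by
  rw [RootedMap.IsUp, RootedMap.ht, RootedMap.ht, D.skeleton.height_tail, D.skeleton.height_tail]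
  exact D.skeleton.lev_top u

theorem not_isUp_fwd (h : D.H) : ¬ D.map.IsUp (.fwd h) := by
  rw [RootedMap.IsUp, RootedMap.ht, RootedMap.ht, D.skeleton.height_tail, D.skeleton.height_tail]
  exact (Nat.lt_succ_self _).ne

theorem isUp_next_up_iff (u : D.U) : D.map.IsUp (D.map.next (.up u)) ↔ u.j ∈ D.word u.i := by
  rcases hs : D.side u with h | h
  · rw [D.skeleton.next_up_inl hs]
    exact iff_of_false (D.not_isUp_fwd h) (D.side_eq_inl.1 hs).1
  · rw [D.skeleton.next_up_inr hs]
    exact iff_of_true (D.isUp_up _) (D.side_eq_inr.1 hs).1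

theorem strip_up (u : D.U) : D.map.strip (.up u) = Skeleton.Dart.up (Cell.rot u) := by
  rcases hs : D.side u with h | h
  · rw [RootedMap.strip, D.skeleton.next_up_inl hs, if_neg (D.not_isUp_fwd h)]
    exact D.skeleton.next_bwd_some (D.skeleton.above_of_side _ _ hs)
  · rw [RootedMap.strip, D.skeleton.next_up_inr hs, if_pos (D.isUp_up _)]

theorem card_word_eq {i : ℕ} (hi : i < N) : (D.word i).card = D.size i := by
  rw [← D.inCount_len hi, inCount_eq_card (D.word_subset_len hi)]

end SliceData

theorem Cell.rot_pow_zero {N : ℕ} {L : ℕ → ℕ} {i : ℕ} (hi : i < N) (h0 : 0 < L i) (k : ℕ) :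
    (Cell.rot ^ k) (⟨i, 0, hi, h0⟩ : Cell N L) = ⟨i, k % L i, hi, Nat.mod_lt _ h0⟩ := by
  induction k with
  | zero => simp
  | succ k ih =>
    rw [pow_succ', Equiv.Perm.mul_apply, ih]
    ext
    · rfl
    · rw [Cell.rot_j]
      dsimp only
      have h1 := Nat.mod_lt k h0
      rw [← Nat.mod_add_mod]
      split_ifs with h
      · rw [Nat.mod_eq_of_lt h]
      · rw [show k % L i + 1 = L i by omega, Nat.mod_self]

namespace SliceData

/-- The edge `(i, j)` between slices, directed away from the root. -/
abbrev upAt {N : ℕ} (D : SliceData N) (i j : ℕ) (hi : i < N) (hj : j < D.len i) : D.map.Dart :=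
  .up (⟨i, j, hi, hj⟩ : D.U)

/-- The edge `(i, k)` inside a slice, directed counterclockwise. -/
abbrev fwdAt {N : ℕ} (D : SliceData N) (i k : ℕ) (hi : i < N) (hk : k < D.size i) : D.map.Dart :=
  .fwd (⟨i, k, hi, hk⟩ : D.H)

variable {N : ℕ} {D D' : SliceData N}

/-- An isomorphism that matches the marked edges of two strips matches the strips. -/
theorem strip_eq_of_iso (e : D.map.Dart ≃ D'.map.Dart)
    (hn : ∀ d, e (D.map.next d) = D'.map.next (e d)) (hr : ∀ d, e (D.map.rev d) = D'.map.rev (e d))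
    (hroot : e D.map.root = D'.map.root) {i : ℕ} (hi : i < N)
    (hm : e (D.upAt i 0 hi (D.len_pos hi)) = D'.upAt i 0 hi (D'.len_pos hi)) :
    D.len i = D'.len i ∧ D.word i = D'.word i ∧ ∀ (j : ℕ) (hj : j < D.len i) (hj' : j < D'.len i),
      e (D.upAt i j hi hj) = D'.upAt i j hi hj' := by
  have hc := D.isCausal.planar.1
  have hrow : ∀ k : ℕ, e (D.upAt i (k % D.len i) hi (Nat.mod_lt _ (D.len_pos hi))) =
      D'.upAt i (k % D'.len i) hi (Nat.mod_lt _ (D'.len_pos hi)) := by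
    intro k
    rw [upAt, upAt, ← Cell.rot_pow_zero hi (D.len_pos hi), ← Cell.rot_pow_zero hi (D'.len_pos hi)]
    induction k with
    | zero => exact hm
    | succ k ih =>
      rw [pow_succ', pow_succ', Equiv.Perm.mul_apply, Equiv.Perm.mul_apply, ← strip_up, ← strip_up,
        ← ih]
      exact RootedMap.strip_of_iso e hn hr hroot hc _
  have hlen : D.len i = D'.len i := by
    have h1 := hrow (D.len i)
    have h2 := hrow (D'.len i)
    have h0 := hrow 0
    simp only [Nat.mod_self, Nat.zero_mod] at h0 h1 h2
    rw [h0] at h1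
    rw [← h0] at h2
    have h1 := congrArg Cell.j (Skeleton.Dart.up.inj h1)
    have h2 := congrArg Cell.j (Skeleton.Dart.up.inj (e.injective h2))
    exact Nat.dvd_antisymm (Nat.dvd_of_mod_eq_zero h2) (Nat.dvd_of_mod_eq_zero h1.symm)
  have hrow' : ∀ (j : ℕ) (hj : j < D.len i) (hj' : j < D'.len i),
      e (D.upAt i j hi hj) = D'.upAt i j hi hj' := by
    intro j hj hj'
    have := hrow j
    simpa only [Nat.mod_eq_of_lt hj, Nat.mod_eq_of_lt hj'] using this
  refine ⟨hlen, ?_, hrow'⟩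
  ext j
  have hiff : ∀ hj : j < D.len i, j ∈ D.word i ↔ j ∈ D'.word i := fun hj => by
    have h1 := D.isUp_next_up_iff ⟨i, j, hi, hj⟩
    have h2 := D'.isUp_next_up_iff ⟨i, j, hi, hlen ▸ hj⟩
    have h3 := RootedMap.isUp_of_iso e hn hr hroot hc (D.map.next (D.upAt i j hi hj))
    rw [hn, hrow' j hj (hlen ▸ hj)] at h3
    exact h1.symm.trans (h3.symm.trans h2)
  constructor
  · intro h
    exact (hiff (Finset.mem_range.1 (D.word_subset_len hi h))).1 h
  · intro h
    exact (hiff (hlen ▸ Finset.mem_range.1 (D'.word_subset_len hi h))).2 h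

theorem next_bwd_last {i : ℕ} (hi : i + 1 < N) (h0 : D.size i - 1 < D.size i) :
    D.map.next (D.map.rev (D.fwdAt i (D.size i - 1) (by omega) h0)) =
      D.upAt (i + 1) 0 hi (D.len_pos hi) := by
  have hl : D.len (i + 1) - 1 < D.len (i + 1) := Nat.sub_lt (D.len_pos hi) one_pos
  have ha : D.above ⟨i, D.size i - 1, by omega, h0⟩ =
      some ⟨i + 1, D.len (i + 1) - 1, hi, hl⟩ := by
    refine D.above_eq_some.2 ⟨D.last_notMem hi, rfl, ?_⟩
    have h2 := outCount_succ (D.word (i + 1)) (D.len (i + 1) - 1)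
    rw [if_neg (D.last_notMem hi), Nat.sub_add_cancel (D.len_pos hi), D.outCount_len hi] at h2
    dsimp only
    omega
  rw [D.skeleton.rev_fwd, D.skeleton.next_bwd_some ha]
  refine congrArg Skeleton.Dart.up (Cell.ext rfl ?_)
  rw [Cell.rot_j, if_neg (by dsimp only; omega)]

/-- Isomorphic maps have the same sizes and words. -/
theorem eq_of_iso (h : RootedMap.Iso D.map D'.map) {i : ℕ} (hi : i < N) :
    D.size i = D'.size i ∧ D.word i = D'.word i := by
  obtain ⟨e, hn, hr, hroot, -⟩ := h
  have hmark : ∀ i (hi : i < N), e (D.upAt i 0 hi (D.len_pos hi)) =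
      D'.upAt i 0 hi (D'.len_pos hi) := by
    intro i
    induction i with
    | zero => exact fun hi => hroot
    | succ i ih =>
      intro hi
      have hi' : i < N := by omega
      obtain ⟨-, hword, hrow⟩ := strip_eq_of_iso e hn hr hroot hi' (ih hi')
      have hsize : D.size i = D'.size i := by
        rw [← D.card_word_eq hi', ← D'.card_word_eq hi', hword]
      have hlast : D.size i - 1 < D.size i := Nat.sub_lt (D.size_pos i hi') one_pos
      have hlast' : D'.size i - 1 < D'.size i := Nat.sub_lt (D'.size_pos i hi') one_pos
      have hj := (D.below ⟨i, D.size i - 1, hi', hlast⟩).hj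
      have hj' := (D'.below ⟨i, D'.size i - 1, hi', hlast'⟩).hj
      have hrow' : ∀ (a b : ℕ) (_ : a = b) (ha : a < D.len i) (hb : b < D'.len i),
          e (D.upAt i a hi' ha) = D'.upAt i b hi' hb := by
        rintro a _ rfl ha hb
        exact hrow a ha hb
      have hfwd : e (D.fwdAt i (D.size i - 1) hi' hlast) =
          D'.fwdAt i (D'.size i - 1) hi' hlast' := by
        refine D'.map.next.injective ?_
        rw [← hn]
        have h1 := hrow' (inNth (D.word i) (D.size i - 1)) (inNth (D'.word i) (D'.size i - 1))
          (by rw [hword, hsize]) hj hj'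
        exact (hr (D.upAt i _ hi' hj)).trans (congrArg D'.map.rev h1)
      rw [← next_bwd_last hi hlast, ← next_bwd_last hi hlast', hn, hr, hfwd]
  obtain ⟨-, hword, -⟩ := strip_eq_of_iso e hn hr hroot hi (hmark i hi)
  exact ⟨by rw [← D.card_word_eq hi, ← D'.card_word_eq hi, hword], hword⟩

end SliceData


/-! ### Codes of causal triangulations -/

/-- The sizes and words of causal triangulations with `N + 1` slices and `m` vertices on the last
slice, built up slice by slice: a slice with `n + 1` vertices is followed by a slice with `m`
vertices, and the strip between them is given by the positions of its `m` triangles with a side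
in the upper slice among the first `n + m` of its `n + 1 + m` triangles. -/
def Code : ℕ → ℕ → Type
  | 0, _ => Unit
  | N + 1, m => Σ n : ℕ, Code N (n + 1) × {S // S ∈ Finset.powersetCard m (Finset.range (n + m))}

namespace Code

/-- The number of vertices of the slice at height `i + 1`. -/
def size : (N m : ℕ) → Code N m → ℕ → ℕ
  | 0, m, _, _ => m
  | N + 1, m, x, i => if i ≤ N then size N (x.1 + 1) x.2.1 i else m

/-- The word of the strip below the slice at height `i + 1`. -/
def word : (N m : ℕ) → Code N m → ℕ → Finset ℕ
  | 0, m, _, _ => Finset.range m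
  | N + 1, _, x, i => if i ≤ N then word N (x.1 + 1) x.2.1 i else x.2.2.1

theorem size_last (N m : ℕ) (x : Code N m) : size N m x N = m := by
  rcases N with _ | N
  · rfl
  · exact if_neg (by omega)

theorem size_succ_of_le {N m i : ℕ} (x : Code (N + 1) m) (hi : i ≤ N) :
    size (N + 1) m x i = size N (x.1 + 1) x.2.1 i := if_pos hi

theorem word_succ_of_le {N m i : ℕ} (x : Code (N + 1) m) (hi : i ≤ N) :
    word (N + 1) m x i = word N (x.1 + 1) x.2.1 i := if_pos hi

theorem word_last {N m : ℕ} (x : Code (N + 1) m) : word (N + 1) m x (N + 1) = x.2.2.1 :=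
  if_neg (by omega)

theorem size_pos : ∀ (N m : ℕ) (_ : 0 < m) (x : Code N m) (i : ℕ), 0 < size N m x i
  | 0, _, hm, _, _ => hm
  | N + 1, m, hm, x, i => by
    unfold size
    split_ifs
    · exact size_pos N (x.1 + 1) (Nat.succ_pos _) x.2.1 i
    · exact hm

theorem word_zero : ∀ (N m : ℕ) (x : Code N m), word N m x 0 = Finset.range (size N m x 0)
  | 0, _, _ => rfl
  | N + 1, m, x => by
    rw [word_succ_of_le x (Nat.zero_le N), size_succ_of_le x (Nat.zero_le N)]
    exact word_zero N _ _

theorem word_mem : ∀ (N m : ℕ) (x : Code N m) (i : ℕ), i + 1 < N + 1 →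
    word N m x (i + 1) ∈ Finset.powersetCard (size N m x (i + 1))
      (Finset.range (size N m x i + size N m x (i + 1) - 1))
  | 0, _, _, _, hi => absurd hi (by omega)
  | N + 1, m, x, i, hi => by
    rw [size_succ_of_le x (by omega : i ≤ N)]
    rcases Nat.lt_or_ge i N with h | h
    · rw [size_succ_of_le x (by omega : i + 1 ≤ N), word_succ_of_le x (by omega : i + 1 ≤ N)]
      exact word_mem N _ _ i (by omega)
    · obtain rfl : i = N := by omega
      rw [size_last, size_last, word_last, show x.1 + 1 + m - 1 = x.1 + m by omega]
      exact x.2.2.2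

/-- The sizes and words of a code. -/
def data {N m : ℕ} (hm : 0 < m) (x : Code N m) : SliceData (N + 1) where
  size := size N m x
  word := word N m x
  pos := Nat.succ_pos N
  size_pos i _ := size_pos N m hm x i
  word_zero := word_zero N m x
  word_subset i hi := (Finset.mem_powersetCard.1 (word_mem N m x i hi)).1
  card_word i hi := (Finset.mem_powersetCard.1 (word_mem N m x i hi)).2

theorem ext : ∀ {N m : ℕ} {x y : Code N m},
    (∀ i ≤ N, size N m x i = size N m y i ∧ word N m x i = word N m y i) → x = y
  | 0, _, _, _, _ => rfl
  | N + 1, m, x, y, h => by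
    have h1 : x.1 = y.1 := by
      have := (h N (by omega)).1
      rw [size_succ_of_le _ le_rfl, size_succ_of_le _ le_rfl, size_last, size_last] at this
      exact Nat.succ.inj this
    have h2 : ∀ i ≤ N, size N _ x.2.1 i = size N _ y.2.1 i ∧
        word N _ x.2.1 i = word N _ y.2.1 i := fun i hi => by
      have := h i (by omega)
      rwa [size_succ_of_le _ hi, size_succ_of_le _ hi, word_succ_of_le _ hi,
        word_succ_of_le _ hi] at this
    have h3 : x.2.2.1 = y.2.2.1 := by
      have := (h (N + 1) le_rfl).2
      rwa [word_last, word_last] at this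
    obtain ⟨n, x, S⟩ := x
    obtain ⟨n', y, S'⟩ := y
    dsimp only at h1
    subst h1
    obtain rfl : x = y := ext h2
    obtain rfl : S = S' := Subtype.ext h3
    rfl

/-- Every sequence of sizes and words comes from a code. -/
theorem exists_code : ∀ {N : ℕ} (D : SliceData (N + 1)),
    ∃ x : Code N (D.size N), ∀ i ≤ N, size N _ x i = D.size i ∧ word N _ x i = D.word i
  | 0, D => ⟨(), fun i hi => by
    obtain rfl : i = 0 := by omega
    exact ⟨rfl, D.word_zero.symm⟩⟩
  | N + 1, D => by
    let D' : SliceData (N + 1) :=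
      { size := D.size
        word := D.word
        pos := Nat.succ_pos N
        size_pos := fun i hi => D.size_pos i (by omega)
        word_zero := D.word_zero
        word_subset := fun i hi => D.word_subset i (by omega)
        card_word := fun i hi => D.card_word i (by omega) }
    obtain ⟨x, hx⟩ := exists_code D'
    obtain ⟨n, hn⟩ : ∃ n, D.size N = n + 1 :=
      ⟨D.size N - 1, by have := D.size_pos N (by omega); omega⟩
    have hx' : ∃ y : Code N (n + 1), ∀ i ≤ N,
        size N _ y i = D.size i ∧ word N _ y i = D.word i := by
      rw [← hn]; exact ⟨x, hx⟩
    obtain ⟨y, hy⟩ := hx'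
    have hS : D.word (N + 1) ∈ Finset.powersetCard (D.size (N + 1))
        (Finset.range (n + D.size (N + 1))) := by
      have h1 := D.word_subset N (by omega)
      rw [hn, show n + 1 + D.size (N + 1) - 1 = n + D.size (N + 1) by omega] at h1
      exact Finset.mem_powersetCard.2 ⟨h1, D.card_word N (by omega)⟩
    let z : Code (N + 1) (D.size (N + 1)) := ⟨n, y, _, hS⟩
    refine ⟨z, fun i hi => ?_⟩
    rcases Nat.lt_or_ge N i with h | h
    · obtain rfl : i = N + 1 := by omega
      exact ⟨size_last _ _ z, word_last z⟩
    · rw [size_succ_of_le z h, word_succ_of_le z h]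
      exact hy i h

/-- The causal triangulation of a code. -/
def toTriangulation {N m : ℕ} (hm : 0 < m) (x : Code N m) : Triangulations (N + 1) m :=
  Quotient.mk _ ⟨(x.data hm).map, by
    have h := (x.data hm).isCausal
    rwa [show (x.data hm).size (N + 1 - 1) = m from size_last N m x] at h⟩

theorem toTriangulation_bijective {N m : ℕ} (hm : 0 < m) :
    Function.Bijective (toTriangulation hm : Code N m → Triangulations (N + 1) m) := by
  constructor
  · intro x y hxy
    have h : RootedMap.Iso (x.data hm).map (y.data hm).map := Quotient.exact hxy
    exact ext fun i hi => SliceData.eq_of_iso h (Nat.lt_succ_of_le hi)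
  · rintro ⟨M, hM⟩
    have hN : 0 < N + 1 := Nat.succ_pos N
    have hlast : (hM.data hN).size N = m := hM.sliceLen_last hN
    have hx : ∃ x : Code N m, ∀ i ≤ N, size N m x i = (hM.data hN).size i ∧
        word N m x i = (hM.data hN).word i := by
      obtain ⟨x, hx⟩ := exists_code (hM.data hN)
      revert x
      rw [hlast]
      exact fun x hx => ⟨x, hx⟩
    obtain ⟨x, hx⟩ := hx
    exact ⟨x, Quotient.sound (hM.iso_map (x.data hm) (fun i hi => (hx i (by omega)).1)
      fun i hi => (hx i (by omega)).2)⟩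

/-- Causal triangulations correspond to codes. -/
def equivTriangulations {N m : ℕ} (hm : 0 < m) : Code N m ≃ Triangulations (N + 1) m :=
  Equiv.ofBijective _ (toTriangulation_bijective hm)

theorem iso_toMap {N m : ℕ} (hm : 0 < m) (x : Code N m) :
    RootedMap.Iso (equivTriangulations hm x).toMap (x.data hm).map :=
  Quotient.exact (Quotient.out_eq (toTriangulation hm x))

end Code


/-! ### Partition functions of the Ising model on finite graphs -/

section Ising

variable {V E : Type} [Fintype V] (a b : E → V)

/-- The number of spin configurations for which an even number of the edges in `S` join opposite
spins minus the number of the other ones. -/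
def characterSum (S : Finset E) : ℝ := by
  classical
  exact ∑ σ : V → ℤˣ, ∏ e ∈ S, (((σ (a e) * σ (b e) : ℤˣ) : ℤ) : ℝ)

theorem characterSum_nonneg (S : Finset E) : 0 ≤ characterSum a b S := by
  classical
  let χ : (V → ℤˣ) →* ℝ :=
    { toFun := fun σ => ∏ e ∈ S, (((σ (a e) * σ (b e) : ℤˣ) : ℤ) : ℝ)
      map_one' := by simp
      map_mul' := fun σ τ => by
        rw [← Finset.prod_mul_distrib]
        refine Finset.prod_congr rfl fun e _ => ?_
        simp only [Pi.mul_apply, Units.val_mul, Int.cast_mul]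
        ring }
  have h := sum_hom_units χ
  change 0 ≤ ∑ σ, χ σ
  rw [h]
  split_ifs
  · positivity
  · simp

variable [Fintype E]

open Classical in
/-- The partition function of the Ising model, without external field, on a graph with the
vertices `V` and the edges `E`, the edge `e` joining `a e` and `b e`. -/
def ising (β : ℝ) : ℝ :=
  ∑ σ : V → ℤˣ, Real.exp (β * ∑ e, (((σ (a e) * σ (b e) : ℤˣ) : ℤ) : ℝ))

theorem ising_pos (β : ℝ) : 0 < ising a b β := by
  classical
  exact Finset.sum_pos (fun σ _ => Real.exp_pos _) ⟨1, Finset.mem_univ _⟩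

/-- The contribution of the two constant spin configurations. -/
theorem exp_card_le_ising (β : ℝ) : Real.exp (β * Fintype.card E) ≤ ising a b β := by
  classical
  refine le_trans (le_of_eq ?_) (Finset.single_le_sum
    (f := fun σ : V → ℤˣ => Real.exp (β * ∑ e, (((σ (a e) * σ (b e) : ℤˣ) : ℤ) : ℝ)))
    (fun σ _ => (Real.exp_pos _).le) (Finset.mem_univ (1 : V → ℤˣ)))
  simp

theorem exp_mul_unit (β : ℝ) (s : ℤˣ) :
    Real.exp (β * ((s : ℤ) : ℝ)) = ((s : ℤ) : ℝ) * Real.sinh β + Real.cosh β := by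
  rcases Int.units_eq_one_or s with rfl | rfl
  · simp [Real.sinh_add_cosh]
  · simp only [Units.val_neg, Units.val_one, Int.cast_neg, Int.cast_one]
    rw [mul_neg_one, ← Real.cosh_sub_sinh]
    ring

/-- The high temperature expansion. -/
theorem ising_eq_sum (β : ℝ) : ising a b β =
    ∑ S : Finset E, Real.sinh β ^ S.card * Real.cosh β ^ (Fintype.card E - S.card) *
      characterSum a b S := by
  classical
  have h : ∀ σ : V → ℤˣ, Real.exp (β * ∑ e, (((σ (a e) * σ (b e) : ℤˣ) : ℤ) : ℝ)) =
      ∑ S : Finset E, Real.sinh β ^ S.card * Real.cosh β ^ (Fintype.card E - S.card) *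
        ∏ e ∈ S, (((σ (a e) * σ (b e) : ℤˣ) : ℤ) : ℝ) := fun σ => by
    rw [Finset.mul_sum, Real.exp_sum]
    simp only [exp_mul_unit]
    rw [Finset.prod_add, Finset.powerset_univ]
    refine Finset.sum_congr rfl fun S _ => ?_
    rw [Finset.prod_mul_distrib, Finset.prod_const, Finset.prod_const,
      Finset.card_sdiff_of_subset (Finset.subset_univ S), Finset.card_univ]
    ring
  rw [ising, Finset.sum_congr rfl fun σ _ => h σ, Finset.sum_comm]
  refine Finset.sum_congr rfl fun S _ => ?_
  rw [characterSum, Finset.mul_sum]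

theorem ising_mono {β β' : ℝ} (h0 : 0 ≤ β) (h : β ≤ β') : ising a b β ≤ ising a b β' := by
  rw [ising_eq_sum, ising_eq_sum]
  have h1 : 0 ≤ Real.sinh β := Real.sinh_nonneg_iff.2 h0
  have h2 : 0 ≤ Real.cosh β := (Real.cosh_pos β).le
  have h3 : Real.sinh β ≤ Real.sinh β' := Real.sinh_le_sinh.2 h
  have h4 : Real.cosh β ≤ Real.cosh β' := Real.cosh_le_cosh.2 (by
    rwa [abs_of_nonneg h0, abs_of_nonneg (h0.trans h)])
  have h5 : 0 ≤ Real.sinh β' := h1.trans h3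
  refine Finset.sum_le_sum fun S _ => mul_le_mul_of_nonneg_right ?_ (characterSum_nonneg a b S)
  gcongr

/-- The contribution of the empty set to the high temperature expansion. -/
theorem two_pow_mul_cosh_pow_le_ising {β : ℝ} (h0 : 0 ≤ β) :
    2 ^ Fintype.card V * Real.cosh β ^ Fintype.card E ≤ ising a b β := by
  classical
  rw [ising_eq_sum]
  have h1 : 0 ≤ Real.sinh β := Real.sinh_nonneg_iff.2 h0
  have h2 : 0 ≤ Real.cosh β := (Real.cosh_pos β).le
  refine le_trans (le_of_eq ?_) (Finset.single_le_sum
    (f := fun S : Finset E => Real.sinh β ^ S.card * Real.cosh β ^ (Fintype.card E - S.card) *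
      characterSum a b S)
    (fun S _ => mul_nonneg (by positivity) (characterSum_nonneg a b S)) (Finset.mem_univ ∅))
  simp [characterSum, mul_comm]

/-- Adding vertices and edges to a graph costs at most a factor `exp (-β)` for each new edge: give
the spin `1` to the new vertices. -/
theorem exp_mul_ising_le {V' E' : Type} [Fintype V'] [Fintype E'] (a' b' : E' → V') {f : V → V'}
    {g : E → E'} (hf : f.Injective) (hg : g.Injective) (ha : ∀ e, a' (g e) = f (a e))
    (hb : ∀ e, b' (g e) = f (b e)) {β : ℝ} (h0 : 0 ≤ β) {n : ℕ}
    (hn : Fintype.card E' = Fintype.card E + n) :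
    Real.exp (-(β * n)) * ising a b β ≤ ising a' b' β := by
  classical
  let ext : (V → ℤˣ) → (V' → ℤˣ) := fun σ => Function.extend f σ 1
  have hext : ∀ σ v, ext σ (f v) = σ v := fun σ v => hf.extend_apply _ _ _
  have hinj : ext.Injective := fun σ τ h => funext fun v => by rw [← hext σ, h, hext]
  rw [ising, ising, Finset.mul_sum]
  refine le_trans ?_ ((Finset.sum_map Finset.univ ⟨ext, hinj⟩ _).symm.trans_le
    (Finset.sum_le_sum_of_subset_of_nonneg (Finset.subset_univ _)
      fun σ _ _ => (Real.exp_pos _).le))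
  refine Finset.sum_le_sum fun σ _ => ?_
  rw [← Real.exp_add, Real.exp_le_exp]
  have hsplit : ∀ F : E' → ℝ, ∑ e, F e =
      ∑ e, F (g e) + ∑ e ∈ (Finset.univ.map ⟨g, hg⟩)ᶜ, F e := fun F => by
    rw [← Finset.sum_add_sum_compl (Finset.univ.map ⟨g, hg⟩), Finset.sum_map]
    rfl
  have hrest : -(n : ℝ) ≤ ∑ e ∈ (Finset.univ.map ⟨g, hg⟩)ᶜ,
      (((ext σ (a' e) * ext σ (b' e) : ℤˣ) : ℤ) : ℝ) := by
    have hcard : ((Finset.univ.map ⟨g, hg⟩)ᶜ : Finset E').card = n := by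
      rw [Finset.card_compl, Finset.card_map, Finset.card_univ, hn]
      omega
    have := Finset.card_nsmul_le_sum ((Finset.univ.map ⟨g, hg⟩)ᶜ : Finset E')
      (fun e => (((ext σ (a' e) * ext σ (b' e) : ℤˣ) : ℤ) : ℝ)) (-1) fun e _ => by
        rcases Int.units_eq_one_or (ext σ (a' e) * ext σ (b' e)) with h | h <;> simp [h]
    rw [hcard] at this
    simpa using this
  have hmain : ∑ e, (((ext σ (a' (g e)) * ext σ (b' (g e)) : ℤˣ) : ℤ) : ℝ) =
      ∑ e, (((σ (a e) * σ (b e) : ℤˣ) : ℤ) : ℝ) := by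
    simp only [ha, hb, hext]
  have := mul_le_mul_of_nonneg_left hrest h0
  change _ ≤ β * ∑ e, (((ext σ (a' e) * ext σ (b' e) : ℤˣ) : ℤ) : ℝ)
  rw [hsplit, hmain, mul_add]
  linarith

end Ising

namespace RootedMap

/-- Isomorphic maps have the same weight. -/
theorem Iso.weight_eq {M M' : RootedMap} (h : Iso M M') (β μ : ℝ) :
    M.weight β μ = M'.weight β μ := by
  classical
  obtain ⟨e, hn, hr, -, ho⟩ := h
  have hF : M.numTriangles = M'.numTriangles := by
    refine Nat.card_congr ((faceIso e hn hr).subtypeEquiv fun f => not_congr ?_)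
    obtain ⟨d₀, h₀⟩ := M.exists_face M.outerFace
    have h₀' := (ho d₀).1 h₀
    rw [← h₀', ← faceIso_face e hn hr, h₀, (faceIso e hn hr).apply_eq_iff_eq]
  have hH : ∀ σ : M'.Vertex → ℤˣ,
      M.hamiltonian (fun v => σ (vertexIso e hn v)) = M'.hamiltonian σ := fun σ => by
    simp only [hamiltonian, vertexIso_tail, vertexIso_head e hn hr]
    rw [← e.sum_comp]
  rw [weight, weight, hF]
  refine Fintype.sum_equiv ((vertexIso e hn).arrowCongr (Equiv.refl _)) _ _ fun σ => ?_
  rw [← hH]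
  congr 4
  funext v
  simp [Equiv.arrowCongr]

end RootedMap

namespace Skeleton

variable {N : ℕ} (K : Skeleton N)

instance : Fintype K.U := Fintype.ofFinite _
instance : Fintype K.H := Fintype.ofFinite _
instance : Fintype K.Dart := Fintype.ofFinite _

/-- The starting point of an edge. -/
def edgeStart : K.U ⊕ K.H → Option K.H := Sum.elim K.bot some

/-- The end point of an edge. -/
def edgeEnd : K.U ⊕ K.H → Option K.H := Sum.elim (fun u => some (K.top u)) fun h => some (K.succ h)

theorem hamiltonian_eq (σ : Option K.H → ℤˣ) :
    K.map.hamiltonian (fun v => σ (K.vertexEquiv v)) =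
      -∑ e, (((σ (K.edgeStart e) * σ (K.edgeEnd e) : ℤˣ) : ℤ) : ℝ) := by
  rw [RootedMap.hamiltonian]
  simp only [vertexEquiv_tail, vertexEquiv_head]
  rw [← K.dartEquiv.symm.sum_comp (fun d : K.Dart => (((σ (K.start d) : ℤˣ) : ℤ) : ℝ) *
    (((σ (K.start (K.map.rev d)) : ℤˣ) : ℤ) : ℝ)), Fintype.sum_sum_type, Fintype.sum_sum_type,
    Fintype.sum_sum_type, Fintype.sum_sum_type]
  simp only [Units.val_mul, Int.cast_mul]
  have h1 : ∀ u, K.start (K.map.rev (K.dartEquiv.symm (.inl (.inl u)))) = some (K.top u) :=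
    fun _ => rfl
  have h2 : ∀ u, K.start (K.map.rev (K.dartEquiv.symm (.inl (.inr u)))) = K.bot u :=
    fun _ => rfl
  have h3 : ∀ h, K.start (K.map.rev (K.dartEquiv.symm (.inr (.inl h)))) = some (K.succ h) :=
    fun _ => rfl
  have h4 : ∀ h, K.start (K.map.rev (K.dartEquiv.symm (.inr (.inr h)))) = some h :=
    fun _ => rfl
  have h5 : ∀ u, K.start (K.dartEquiv.symm (.inl (.inl u))) = K.bot u := fun _ => rfl
  have h6 : ∀ u, K.start (K.dartEquiv.symm (.inl (.inr u))) = some (K.top u) := fun _ => rfl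
  have h7 : ∀ h, K.start (K.dartEquiv.symm (.inr (.inl h))) = some h := fun _ => rfl
  have h8 : ∀ h, K.start (K.dartEquiv.symm (.inr (.inr h))) = some (K.succ h) := fun _ => rfl
  simp only [h1, h2, h3, h4, h5, h6, h7, h8, edgeStart, edgeEnd, Sum.elim_inl, Sum.elim_inr]
  simp only [mul_comm (((σ (some (K.top _)) : ℤˣ) : ℤ) : ℝ),
    mul_comm (((σ (some (K.succ _)) : ℤˣ) : ℤ) : ℝ)]
  ring

theorem weight_eq (β μ : ℝ) : K.map.weight β μ =
    Real.exp (-μ * Nat.card K.U) * ising K.edgeStart K.edgeEnd β := by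
  classical
  rw [RootedMap.weight, ising, Finset.mul_sum]
  refine Finset.sum_equiv (K.vertexEquiv.arrowCongr (Equiv.refl _)) (by simp) fun σ _ => ?_
  rw [← Real.exp_add]
  have h : σ = fun v => (K.vertexEquiv.arrowCongr (Equiv.refl ℤˣ) σ) (K.vertexEquiv v) := by
    funext v
    simp [Equiv.arrowCongr]
  have h' := K.hamiltonian_eq (K.vertexEquiv.arrowCongr (Equiv.refl ℤˣ) σ)
  rw [← h] at h'
  rw [h', K.numTriangles_eq]
  congr 1
  ring

end Skeleton


/-! ### Bounds for the weight of a causal triangulation -/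

instance {N : ℕ} {L : ℕ → ℕ} : Fintype (Cell N L) := Fintype.ofFinite _

namespace SliceData

variable {N : ℕ} (D : SliceData N)

theorem sum_len_add (n : ℕ) : ∑ i ∈ Finset.range (n + 1), D.len i + D.size n =
    2 * ∑ i ∈ Finset.range (n + 1), D.size i := by
  induction n with
  | zero => simp [len, two_mul]
  | succ n ih =>
    rw [Finset.sum_range_succ, Finset.sum_range_succ D.size, mul_add, ← ih,
      show D.len (n + 1) = D.size n + D.size (n + 1) from rfl]
    ring

/-- The partition function of the Ising model on the edges of the map. -/
abbrev isingSum (β : ℝ) : ℝ := ising D.skeleton.edgeStart D.skeleton.edgeEnd β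

theorem sum_exp_mul_units {H : Type} [Fintype H] [DecidableEq H] (β : ℝ) :
    ∑ τ : H → ℤˣ, Real.exp (β * ∑ h, ((τ h : ℤ) : ℝ)) = (2 * Real.cosh β) ^ Fintype.card H := by
  have h1 : ∑ s : ℤˣ, Real.exp (β * ((s : ℤ) : ℝ)) = 2 * Real.cosh β := by
    simp only [exp_mul_unit, UnitsInt.univ]
    rw [Finset.sum_pair (by decide)]
    simp only [Units.val_neg, Units.val_one, Int.cast_neg, Int.cast_one]
    ring
  simp only [Finset.mul_sum, Real.exp_sum]
  rw [← Finset.card_univ, ← Finset.prod_const, ← h1, Finset.prod_univ_sum,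
    Fintype.piFinset_univ]

/-- The edges between the slices contribute at most `exp β` each. Without them the model splits
into cycles, on which the spin at one vertex and the products along the edges determine the
configuration. -/
theorem isingSum_le {β : ℝ} (h0 : 0 ≤ β) : D.isingSum β ≤
    Real.exp (β * Nat.card D.U) * (2 ^ (N + 1) * (2 * Real.cosh β) ^ Nat.card D.H) := by
  classical
  let Φ : (Option D.H → ℤˣ) → ℤˣ × (Fin N → ℤˣ) × (D.H → ℤˣ) := fun σ =>
    (σ none, fun i => σ (some ⟨i, 0, i.2, D.size_pos i i.2⟩),
      fun h => σ (some h) * σ (some (Cell.rot h)))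
  have hΦ : Φ.Injective := by
    intro σ σ' h
    have h1 : σ none = σ' none := congrArg Prod.fst h
    have h2 : ∀ i : Fin N, σ (some ⟨i, 0, i.2, D.size_pos i i.2⟩) =
        σ' (some ⟨i, 0, i.2, D.size_pos i i.2⟩) := fun i =>
      congrFun (congrArg (fun x => x.2.1) h) i
    have h3 : ∀ h : D.H, σ (some h) * σ (some (Cell.rot h)) =
        σ' (some h) * σ' (some (Cell.rot h)) := congrFun (congrArg (fun x => x.2.2) h)
    have h4 : ∀ (i j : ℕ) (hi : i < N) (hj : j < D.size i),
        σ (some ⟨i, j, hi, hj⟩) = σ' (some ⟨i, j, hi, hj⟩) := by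
      intro i j hi
      induction j with
      | zero => exact fun _ => h2 ⟨i, hi⟩
      | succ j ih =>
        intro hj
        have hr : (Cell.rot (⟨i, j, hi, by omega⟩ : D.H)) = ⟨i, j + 1, hi, hj⟩ :=
          Cell.rot_pow (⟨i, j, hi, by omega⟩ : D.H) 1 hj
        have := h3 ⟨i, j, hi, by omega⟩
        rw [ih (by omega), hr] at this
        exact mul_left_cancel this
    funext o
    rcases o with _ | ⟨i, j, hi, hj⟩
    · exact h1
    · exact h4 i j hi hj
  let F : ℤˣ × (Fin N → ℤˣ) × (D.H → ℤˣ) → ℝ := fun p =>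
    Real.exp (β * ∑ h : D.skeleton.H, (((p.2.2 h : ℤˣ) : ℤ) : ℝ))
  have hsum : ∑ σ : Option D.H → ℤˣ, F (Φ σ) ≤
      2 ^ (N + 1) * (2 * Real.cosh β) ^ Nat.card D.H := by
    refine ((Finset.sum_map Finset.univ ⟨Φ, hΦ⟩ F).symm.trans_le
      (Finset.sum_le_sum_of_subset_of_nonneg (Finset.subset_univ _)
        fun σ _ _ => (Real.exp_pos _).le)).trans (le_of_eq ?_)
    rw [Fintype.sum_prod_type]
    simp only [Fintype.sum_prod_type, F]
    rw [sum_exp_mul_units (H := D.skeleton.H), Nat.card_eq_fintype_card]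
    simp [pow_succ]
    ring
  refine le_trans ?_ (mul_le_mul_of_nonneg_left hsum (Real.exp_pos _).le)
  rw [Finset.mul_sum]
  refine (le_of_eq (Finset.sum_congr (by congr!) fun _ _ => rfl)).trans
    (Finset.sum_le_sum fun σ _ => ?_)
  rw [← Real.exp_add, Real.exp_le_exp, Fintype.sum_sum_type, mul_add]
  refine add_le_add (mul_le_mul_of_nonneg_left ?_ h0) le_rfl
  have := Finset.sum_le_card_nsmul (Finset.univ : Finset D.skeleton.U)
    (fun u => (((σ (D.skeleton.edgeStart (.inl u)) * σ (D.skeleton.edgeEnd (.inl u)) : ℤˣ) : ℤ) : ℝ))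
    1 fun u _ => by
      rcases Int.units_eq_one_or (σ (D.skeleton.edgeStart (.inl u)) *
        σ (D.skeleton.edgeEnd (.inl u))) with h | h <;> simp [h]
  rwa [Finset.card_univ, nsmul_one, Fintype.card_eq_nat_card] at this

theorem le_isingSum (β : ℝ) :
    Real.exp (β * (Nat.card D.U + Nat.card D.H)) ≤ D.isingSum β := by
  have h := exp_card_le_ising D.skeleton.edgeStart D.skeleton.edgeEnd β
  rw [Fintype.card_sum, Fintype.card_eq_nat_card, Fintype.card_eq_nat_card] at h
  exact_mod_cast h

theorem two_pow_mul_cosh_pow_le_isingSum {β : ℝ} (h0 : 0 ≤ β) :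
    2 ^ (Nat.card D.H + 1) * Real.cosh β ^ (Nat.card D.U + Nat.card D.H) ≤ D.isingSum β := by
  have h := two_pow_mul_cosh_pow_le_ising D.skeleton.edgeStart D.skeleton.edgeEnd h0
  rwa [Fintype.card_sum, Fintype.card_option, Fintype.card_eq_nat_card,
    Fintype.card_eq_nat_card] at h

section Extension

variable {D} {D' : SliceData (N + 1)} (hs : ∀ i < N, D'.size i = D.size i)
  (hw : ∀ i < N, D'.word i = D.word i)

include hs in
theorem len_eq_of_size_eq {i : ℕ} (hi : i < N) : D'.len i = D.len i := by
  rcases i with _ | i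
  · exact hs 0 hi
  · rw [len, len, hs _ hi, hs _ (by omega)]

include hs hw in
/-- The model on all slices but the last one. -/
theorem isingSum_extend {β : ℝ} (h0 : 0 ≤ β) :
    Real.exp (-(β * (D'.len N + D'.size N : ℕ))) * D.isingSum β ≤ D'.isingSum β := by
  let fH : D.H → D'.H := fun h => ⟨h.i, h.j, by have := h.hi; omega, by
    rw [hs _ h.hi]; exact h.hj⟩
  let fU : D.U → D'.U := fun u => ⟨u.i, u.j, by have := u.hi; omega, by
    rw [len_eq_of_size_eq hs u.hi]; exact u.hj⟩
  have hfH : fH.Injective := fun h h' e => by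
    rw [Cell.ext_iff] at e ⊢; exact e
  have hfU : fU.Injective := fun h h' e => by
    rw [Cell.ext_iff] at e ⊢; exact e
  have hbot : ∀ u, D'.bot (fU u) = (D.bot u).map fH := fun u => by
    rcases h : D.bot u with _ | g
    · exact D'.bot_eq_none.2 (D.bot_eq_none.1 h)
    · obtain ⟨h1, h2⟩ := D.bot_eq_some.1 h
      exact D'.bot_eq_some.2 ⟨h1, by rw [hw _ u.hi]; exact h2⟩
  have htop : ∀ u, D'.top (fU u) = fH (D.top u) := fun u => by
    ext
    · rfl
    · change (if inCount (D'.word u.i) u.j < D'.size u.i then _ else _) = _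
      rw [hw _ u.hi, hs _ u.hi]
      rfl
  have hrot : ∀ h : D.H, Cell.rot (fH h) = fH (Cell.rot h) := fun h => by
    ext
    · rfl
    · rw [Cell.rot_j]
      change (if h.j + 1 < D'.size h.i then _ else _) = _
      rw [hs _ h.hi]
      rfl
  refine exp_mul_ising_le _ _ _ _ (Option.map_injective hfH) (Sum.map_injective.2 ⟨hfU, hfH⟩)
    ?_ ?_ h0 ?_
  · rintro (u | h)
    · exact hbot u
    · rfl
  · rintro (u | h)
    · exact congrArg some (htop u)
    · exact congrArg some (hrot h)
  · simp only [Fintype.card_eq_nat_card, Nat.card_sum, Cell.card]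
    rw [Finset.sum_range_succ, Finset.sum_range_succ,
      Finset.sum_congr rfl fun i hi => len_eq_of_size_eq hs (Finset.mem_range.1 hi),
      Finset.sum_congr rfl fun i hi => hs i (Finset.mem_range.1 hi)]
    ring

end Extension

end SliceData

namespace Code

/-- The number of vertices besides the root. -/
def total (N m : ℕ) (x : Code N m) : ℕ := ∑ i ∈ Finset.range (N + 1), size N m x i

theorem total_zero {m : ℕ} (x : Code 0 m) : total 0 m x = m := by
  rw [total, zero_add, Finset.sum_range_one]
  rfl

theorem total_succ {N m : ℕ} (x : Code (N + 1) m) :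
    total (N + 1) m x = total N (x.1 + 1) x.2.1 + m := by
  rw [total, Finset.sum_range_succ, size_last, total]
  congr 1
  exact Finset.sum_congr rfl fun i hi => size_succ_of_le x (Finset.mem_range_succ_iff.1 hi)

variable {N m : ℕ} (hm : 0 < m) (x : Code N m)

theorem card_H : Nat.card (x.data hm).H = total N m x := Cell.card

theorem card_U_add : Nat.card (x.data hm).U + m = 2 * total N m x := by
  rw [Cell.card]
  have h := (x.data hm).sum_len_add N
  rwa [show (x.data hm).size N = m from size_last N m x] at h

/-- The weight of the causal triangulation of a code. -/
def weight (β μ : ℝ) : ℝ := (x.data hm).map.weight β μ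

theorem weight_eq (β μ : ℝ) : weight hm x β μ =
    Real.exp (μ * m) * Real.exp (-2 * μ) ^ total N m x * (x.data hm).isingSum β := by
  rw [weight, Skeleton.weight_eq, ← Real.exp_nat_mul, ← Real.exp_add]
  congr 2
  have h : ((Nat.card (x.data hm).U : ℝ) + m) = 2 * total N m x := by
    exact_mod_cast card_U_add hm x
  change -μ * (Nat.card (x.data hm).U : ℝ) = _
  linear_combination (-μ) * h

theorem exp_pow_total_le_weight (β μ : ℝ) :
    Real.exp ((μ - β) * m) * Real.exp (3 * β - 2 * μ) ^ total N m x ≤ weight hm x β μ := by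
  rw [weight_eq]
  refine le_trans (le_of_eq ?_) (mul_le_mul_of_nonneg_left ((x.data hm).le_isingSum β)
    (by positivity))
  rw [← Real.exp_nat_mul, ← Real.exp_nat_mul, ← Real.exp_add, ← Real.exp_add, ← Real.exp_add,
    card_H]
  congr 1
  have h : ((Nat.card (x.data hm).U : ℝ) + m) = 2 * total N m x := by
    exact_mod_cast card_U_add hm x
  linear_combination (-β) * h

theorem cosh_pow_total_le_weight {β : ℝ} (h0 : 0 ≤ β) (μ : ℝ) :
    2 * Real.exp (μ * m) / Real.cosh β ^ m *
      (2 * Real.cosh β ^ 3 * Real.exp (-2 * μ)) ^ total N m x ≤ weight hm x β μ := by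
  rw [weight_eq]
  refine le_trans (le_of_eq ?_) (mul_le_mul_of_nonneg_left
    ((x.data hm).two_pow_mul_cosh_pow_le_isingSum h0) (by positivity))
  have hc := (Real.cosh_pos β).ne'
  have h : Nat.card (x.data hm).U + Nat.card (x.data hm).H + m = 3 * total N m x := by
    have := card_U_add hm x
    rw [card_H]
    omega
  have h' : Real.cosh β ^ (Nat.card (x.data hm).U + Nat.card (x.data hm).H) * Real.cosh β ^ m =
      (Real.cosh β ^ 3) ^ total N m x := by rw [← pow_add, h, pow_mul]
  rw [card_H, mul_pow, mul_pow, ← h', card_H]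
  field_simp
  ring

theorem weight_le {β : ℝ} (h0 : 0 ≤ β) (μ : ℝ) : weight hm x β μ ≤
    2 ^ (N + 2) * Real.exp ((μ - β) * m) *
      (2 * Real.cosh β * Real.exp (2 * β - 2 * μ)) ^ total N m x := by
  rw [weight_eq]
  refine (mul_le_mul_of_nonneg_left ((x.data hm).isingSum_le h0)
    (by positivity)).trans (le_of_eq ?_)
  have h : ((Nat.card (x.data hm).U : ℝ) + m) = 2 * total N m x := by
    exact_mod_cast card_U_add hm x
  have h' : Real.exp (μ * m) * Real.exp (-2 * μ) ^ total N m x *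
      Real.exp (β * Nat.card (x.data hm).U) =
      Real.exp ((μ - β) * m) * Real.exp (2 * β - 2 * μ) ^ total N m x := by
    rw [← Real.exp_nat_mul, ← Real.exp_nat_mul, ← Real.exp_add, ← Real.exp_add, ← Real.exp_add]
    congr 1
    linear_combination β * h
  rw [card_H, mul_pow, mul_pow, ← mul_assoc, h', mul_pow]
  ring

theorem weight_mono {β β' : ℝ} (h0 : 0 ≤ β) (h : β ≤ β') (μ : ℝ) :
    weight hm x β μ ≤ weight hm x β' μ := by
  rw [weight_eq, weight_eq]
  exact mul_le_mul_of_nonneg_left (ising_mono _ _ h0 h) (by positivity)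

theorem weight_antitone (β : ℝ) {μ μ' : ℝ} (h : μ ≤ μ') :
    weight hm x β μ' ≤ weight hm x β μ := by
  rw [weight, weight, Skeleton.weight_eq, Skeleton.weight_eq]
  refine mul_le_mul_of_nonneg_right (Real.exp_le_exp.2 ?_) (ising_pos _ _ _).le
  exact mul_le_mul_of_nonneg_right (neg_le_neg h) (Nat.cast_nonneg _)

/-- Adding a slice decreases the weight at most by a factor that depends only on the sizes of the
last two slices. -/
theorem weight_extend (x : Code (N + 1) m) {β : ℝ} (h0 : 0 ≤ β) (μ : ℝ) :
    Real.exp (-(β * (x.1 + 1 + m + m : ℕ))) * Real.exp (-μ * (x.1 + 1 + m : ℕ)) *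
      weight (Nat.succ_pos x.1) x.2.1 β μ ≤ weight hm x β μ := by
  have hs : ∀ i < N + 1, (x.data hm).size i = (x.2.1.data (Nat.succ_pos x.1)).size i :=
    fun i hi => size_succ_of_le x (Nat.le_of_lt_succ hi)
  have hw : ∀ i < N + 1, (x.data hm).word i = (x.2.1.data (Nat.succ_pos x.1)).word i :=
    fun i hi => word_succ_of_le x (Nat.le_of_lt_succ hi)
  have h1 : (x.data hm).size (N + 1) = m := size_last _ _ _
  have h2 : (x.data hm).size N = x.1 + 1 := (hs N (Nat.lt_succ_self N)).trans (size_last _ _ _)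
  have h := SliceData.isingSum_extend hs hw h0
  rw [show (x.data hm).len (N + 1) = (x.data hm).size N + (x.data hm).size (N + 1) from rfl,
    h1, h2] at h
  rw [weight_eq hm, weight_eq]
  refine le_trans (le_of_eq ?_) (mul_le_mul_of_nonneg_left h (by positivity))
  have he : Real.exp (-μ * (x.1 + 1 + m : ℕ)) *
      (Real.exp (μ * (x.1 + 1 : ℕ)) * Real.exp (-2 * μ) ^ total N (x.1 + 1) x.2.1) =
      Real.exp (μ * m) * Real.exp (-2 * μ) ^ total (N + 1) m x := by
    rw [← Real.exp_nat_mul, ← Real.exp_nat_mul, ← Real.exp_add, ← Real.exp_add, ← Real.exp_add,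
      total_succ]
    congr 1
    push_cast
    ring
  rw [← he]
  ring

end Code


/-! ### Sums over causal triangulations weighted by their number of vertices -/

open scoped ENNReal

namespace Code

/-- The generating function of the causal triangulations with `N + 1` slices and `m` vertices on
the last slice by their number of vertices besides the root. -/
def codeSum (N m : ℕ) (g : ℝ≥0∞) : ℝ≥0∞ := ∑' x : Code N m, g ^ total N m x

theorem codeSum_zero (m : ℕ) (g : ℝ≥0∞) : codeSum 0 m g = g ^ m := by
  have h : ∀ x : Code 0 m, g ^ total 0 m x = g ^ m := fun x => by rw [total_zero]
  rw [codeSum, tsum_congr h]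
  change ∑' _ : Unit, g ^ m = g ^ m
  simp

theorem codeSum_succ (N m : ℕ) (g : ℝ≥0∞) :
    codeSum (N + 1) m g = g ^ m * ∑' n, ((n + m).choose m : ℝ≥0∞) * codeSum N (n + 1) g := by
  rw [codeSum]
  have h : ∀ x : Code (N + 1) m, g ^ total (N + 1) m x =
      g ^ m * g ^ total N (x.1 + 1) x.2.1 := fun x => by rw [total_succ, pow_add, mul_comm]
  rw [tsum_congr h, ENNReal.tsum_mul_left]
  congr 1
  refine (ENNReal.tsum_sigma' (fun x : Σ n : ℕ, Code N (n + 1) ×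
    {S // S ∈ Finset.powersetCard m (Finset.range (n + m))} =>
      g ^ total N (x.1 + 1) x.2.1)).trans (tsum_congr fun n => ?_)
  refine (ENNReal.tsum_prod (f := fun (y : Code N (n + 1))
    (_ : {S // S ∈ Finset.powersetCard m (Finset.range (n + m))}) =>
      g ^ total N (n + 1) y)).trans ?_
  rw [codeSum, ← ENNReal.tsum_mul_left]
  refine tsum_congr fun y => ?_
  rw [tsum_fintype, Finset.sum_const, Finset.card_univ, Fintype.card_coe,
    Finset.card_powersetCard, Finset.card_range, nsmul_eq_mul]

theorem tsum_choose_mul_pow (m : ℕ) {y : ℝ} (h0 : 0 ≤ y) (h1 : y < 1) :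
    ∑' n : ℕ, ((n + m).choose m : ℝ≥0∞) * ENNReal.ofReal y ^ n =
      ENNReal.ofReal (1 / (1 - y) ^ (m + 1)) := by
  have h := hasSum_choose_mul_geometric_of_norm_lt_one (𝕜 := ℝ) m (r := y)
    (by rwa [Real.norm_of_nonneg h0])
  rw [← h.tsum_eq, ENNReal.ofReal_tsum_of_nonneg (fun n => by positivity) h.summable]
  refine tsum_congr fun n => ?_
  rw [ENNReal.ofReal_mul (by positivity), ENNReal.ofReal_natCast, ENNReal.ofReal_pow h0]

/-- For `g ≤ 1 / 4` the recursion preserves the bound `(2 * g) ^ m`, because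
`1 / (1 - 2 * g) ≤ 2`. -/
theorem codeSum_le {g : ℝ} (h0 : 0 ≤ g) (h1 : g ≤ 1 / 4) (N m : ℕ) :
    codeSum N m (ENNReal.ofReal g) ≤ ENNReal.ofReal ((2 * g) ^ m) := by
  induction N generalizing m with
  | zero =>
    rw [codeSum_zero, ← ENNReal.ofReal_pow h0]
    exact ENNReal.ofReal_le_ofReal (pow_le_pow_left₀ h0 (by linarith) m)
  | succ N ih =>
    rw [codeSum_succ]
    have h2 : ∀ n : ℕ, ((n + m).choose m : ℝ≥0∞) * codeSum N (n + 1) (ENNReal.ofReal g) ≤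
        ENNReal.ofReal (2 * g) * (((n + m).choose m : ℝ≥0∞) * ENNReal.ofReal (2 * g) ^ n) :=
      fun n => by
        refine (mul_le_mul_right (ih (n + 1)) _).trans (le_of_eq ?_)
        rw [pow_succ, ENNReal.ofReal_mul (by positivity), ENNReal.ofReal_pow (by positivity)]
        ring
    refine (mul_le_mul_right (ENNReal.tsum_le_tsum h2) _).trans ?_
    rw [ENNReal.tsum_mul_left, tsum_choose_mul_pow m (by positivity) (by linarith),
      ← ENNReal.ofReal_mul (by positivity), ← ENNReal.ofReal_pow h0,
      ← ENNReal.ofReal_mul (by positivity)]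
    refine ENNReal.ofReal_le_ofReal ?_
    have h3 : (1 / 2 : ℝ) ≤ 1 - 2 * g := by linarith
    have h4 : 1 / (1 - 2 * g) ^ (m + 1) ≤ 2 ^ (m + 1) := by
      rw [div_le_iff₀ (by positivity), ← mul_pow]
      exact one_le_pow₀ (by linarith)
    calc g ^ m * (2 * g * (1 / (1 - 2 * g) ^ (m + 1)))
        ≤ g ^ m * (2 * g * 2 ^ (m + 1)) := by gcongr
      _ = (2 * g) ^ m * (4 * g) := by rw [pow_succ, mul_pow]; ring
      _ ≤ (2 * g) ^ m * 1 := by gcongr; linarith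
      _ = (2 * g) ^ m := mul_one _

/-- The recursion applied to a lower bound of the form `K * y ^ m`. -/
theorem le_codeSum_succ {N m : ℕ} {g K y : ℝ} (hg : 0 ≤ g) (hK : 0 ≤ K) (hy : 0 ≤ y)
    (h : ∀ m, ENNReal.ofReal (K * y ^ m) ≤ codeSum N m (ENNReal.ofReal g)) :
    ENNReal.ofReal (g ^ m * (K * y)) * ∑' n : ℕ, ((n + m).choose m : ℝ≥0∞) * ENNReal.ofReal y ^ n
      ≤ codeSum (N + 1) m (ENNReal.ofReal g) := by
  rw [codeSum_succ, ENNReal.ofReal_mul (by positivity), ENNReal.ofReal_pow hg, mul_assoc,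
    ← ENNReal.tsum_mul_left]
  refine mul_le_mul_right (ENNReal.tsum_le_tsum fun n => ?_) _
  refine le_trans (le_of_eq ?_) (mul_le_mul_right (h (n + 1)) _)
  rw [ENNReal.ofReal_mul hK, ENNReal.ofReal_mul hK, ENNReal.ofReal_pow hy, pow_succ]
  ring

/-- For `g > 1 / 4` a lower bound `K * y ^ m` improves with every slice to one with
`g / (1 - y) ≥ y + (g - 1 / 4)` in place of `y`, until `y ≥ 1` and the sum over the size of the last
slice but one diverges. -/
theorem exists_codeSum_eq_top {g : ℝ} (hg : 1 / 4 < g) :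
    ∃ N, codeSum N 1 (ENNReal.ofReal g) = ⊤ := by
  by_contra! hfin
  have hg0 : 0 < g := by linarith
  have hlt : ∀ {N : ℕ} {K y : ℝ}, 0 < K → 0 < y →
      (∀ m, ENNReal.ofReal (K * y ^ m) ≤ codeSum N m (ENNReal.ofReal g)) → y < 1 := by
    intro N K y hK hy h
    by_contra! hy1
    refine hfin (N + 1) (top_le_iff.1 (le_trans (le_of_eq ?_)
      (le_codeSum_succ (m := 1) hg0.le hK.le hy.le h)))
    have h1 : ∀ n : ℕ, (1 : ℝ≥0∞) ≤ ((n + 1).choose 1 : ℝ≥0∞) * ENNReal.ofReal y ^ n := fun n => by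
      refine one_le_mul ?_ (one_le_pow₀ (ENNReal.one_le_ofReal.2 hy1))
      rw [Nat.choose_one_right]
      exact_mod_cast Nat.succ_pos n
    have h2 : ∑' n : ℕ, ((n + 1).choose 1 : ℝ≥0∞) * ENNReal.ofReal y ^ n = ⊤ :=
      top_le_iff.1 ((ENNReal.tsum_const_eq_top_of_ne_zero one_ne_zero).symm.trans_le
        (ENNReal.tsum_le_tsum h1))
    rw [h2, ENNReal.mul_top]
    exact (ENNReal.ofReal_pos.2 (by positivity)).ne'
  have key : ∀ N : ℕ, ∃ K y : ℝ, 0 < K ∧ g + N * (g - 1 / 4) ≤ y ∧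
      ∀ m, ENNReal.ofReal (K * y ^ m) ≤ codeSum N m (ENNReal.ofReal g) := by
    intro N
    induction N with
    | zero =>
      exact ⟨1, g, one_pos, by simp, fun m => by
        rw [codeSum_zero, one_mul, ENNReal.ofReal_pow hg0.le]⟩
    | succ N ih =>
      obtain ⟨K, y, hK, hy, h⟩ := ih
      have hN : 0 ≤ (N : ℝ) * (g - 1 / 4) := mul_nonneg (Nat.cast_nonneg _) (by linarith)
      have hy0 : 0 < y := by linarith
      have hy1 := hlt hK hy0 h
      have hy2 : 0 < 1 - y := by linarith
      refine ⟨K * y / (1 - y), g / (1 - y), by positivity, ?_, fun m => ?_⟩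
      · have : y + (g - 1 / 4) ≤ g / (1 - y) := by
          rw [le_div_iff₀ hy2]
          nlinarith [sq_nonneg (y - 1 / 2), mul_pos hy0 (show 0 < g - 1 / 4 by linarith)]
        push_cast
        linarith
      · refine le_trans (le_of_eq ?_) (le_codeSum_succ hg0.le hK.le hy0.le h)
        rw [tsum_choose_mul_pow m hy0.le hy1, ← ENNReal.ofReal_mul (by positivity)]
        congr 1
        rw [div_pow, pow_succ]
        field_simp
  obtain ⟨N, hN⟩ := exists_nat_gt (1 / (g - 1 / 4))
  obtain ⟨K, y, hK, hy, h⟩ := key N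
  have h1 : 1 < N * (g - 1 / 4) := (div_lt_iff₀ (by linarith)).1 hN
  have := hlt hK (by linarith) h
  linarith

end Code


/-! ### The critical line -/

theorem partitionFunction_eq {N m : ℕ} (hm : 0 < m) (β μ : ℝ) :
    partitionFunction (N + 1) m β μ = ∑' x : Code N m, ENNReal.ofReal (x.weight hm β μ) := by
  rw [partitionFunction, ← (Code.equivTriangulations hm).tsum_eq]
  exact tsum_congr fun x => by rw [(Code.iso_toMap hm x).weight_eq]; rfl

theorem partitionFunction_mono {N m : ℕ} (hm : 0 < m) {β β' : ℝ} (h0 : 0 ≤ β) (h : β ≤ β')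
    (μ : ℝ) : partitionFunction (N + 1) m β μ ≤ partitionFunction (N + 1) m β' μ := by
  rw [partitionFunction_eq hm, partitionFunction_eq hm]
  exact ENNReal.tsum_le_tsum fun x => ENNReal.ofReal_le_ofReal (x.weight_mono hm h0 h μ)

theorem partitionFunction_antitone {N m : ℕ} (hm : 0 < m) (β : ℝ) {μ μ' : ℝ} (h : μ ≤ μ') :
    partitionFunction (N + 1) m β μ' ≤ partitionFunction (N + 1) m β μ := by
  rw [partitionFunction_eq hm, partitionFunction_eq hm]
  exact ENNReal.tsum_le_tsum fun x => ENNReal.ofReal_le_ofReal (x.weight_antitone hm β h)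

theorem partitionFunction_lt_top {N m : ℕ} (hm : 0 < m) {β μ : ℝ} (h0 : 0 ≤ β)
    (h : 2 * Real.cosh β * Real.exp (2 * β - 2 * μ) ≤ 1 / 4) :
    partitionFunction (N + 1) m β μ < ⊤ := by
  have hc := Real.cosh_pos β
  rw [partitionFunction_eq hm]
  refine lt_of_le_of_lt (ENNReal.tsum_le_tsum fun x =>
    ENNReal.ofReal_le_ofReal (x.weight_le hm h0 μ)) ?_
  have h1 : ∀ x : Code N m, ENNReal.ofReal (2 ^ (N + 2) * Real.exp ((μ - β) * m) *
      (2 * Real.cosh β * Real.exp (2 * β - 2 * μ)) ^ Code.total N m x) =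
      ENNReal.ofReal (2 ^ (N + 2) * Real.exp ((μ - β) * m)) *
        ENNReal.ofReal (2 * Real.cosh β * Real.exp (2 * β - 2 * μ)) ^ Code.total N m x :=
    fun x => by rw [ENNReal.ofReal_mul (by positivity), ENNReal.ofReal_pow (by positivity)]
  rw [tsum_congr h1, ENNReal.tsum_mul_left]
  exact ENNReal.mul_lt_top ENNReal.ofReal_lt_top
    ((Code.codeSum_le (by positivity) h N m).trans_lt ENNReal.ofReal_lt_top)

theorem exists_partitionFunction_eq_top_of_le {β μ K g : ℝ} (hK : 0 < K) (hg : 1 / 4 < g)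
    (h : ∀ N (x : Code N 1), K * g ^ Code.total N 1 x ≤ x.weight one_pos β μ) :
    ∃ N, partitionFunction (N + 1) 1 β μ = ⊤ := by
  obtain ⟨N, hN⟩ := Code.exists_codeSum_eq_top hg
  have hg0 : 0 ≤ g := by linarith
  refine ⟨N, top_le_iff.1 ?_⟩
  rw [partitionFunction_eq one_pos]
  refine le_trans (le_of_eq ?_) (ENNReal.tsum_le_tsum fun x => ENNReal.ofReal_le_ofReal (h N x))
  have h1 : ∀ x : Code N 1, ENNReal.ofReal (K * g ^ Code.total N 1 x) =
      ENNReal.ofReal K * ENNReal.ofReal g ^ Code.total N 1 x :=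
    fun x => by rw [ENNReal.ofReal_mul hK.le, ENNReal.ofReal_pow hg0]
  rw [tsum_congr h1, ENNReal.tsum_mul_left]
  change ⊤ = ENNReal.ofReal K * Code.codeSum N 1 (ENNReal.ofReal g)
  rw [hN, ENNReal.mul_top (ENNReal.ofReal_pos.2 hK).ne']

/-- The lower bound of the critical line. -/
def lowerLine (β : ℝ) : ℝ :=
  max (3 / 2 * Real.log 2 + 3 / 2 * Real.log (Real.cosh β)) (Real.log 2 + 3 / 2 * β)

/-- The upper bound of the critical line. -/
def upperLine (β : ℝ) : ℝ := 3 / 2 * Real.log 2 + β + 1 / 2 * Real.log (Real.cosh β)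

/-- Below the lower bound, the constant configurations or the empty term of the high
temperature expansion already make the partition function of some number of slices infinite. -/
theorem exists_partitionFunction_eq_top {β μ : ℝ} (h0 : 0 ≤ β) (h : μ < lowerLine β) :
    ∃ N, partitionFunction (N + 1) 1 β μ = ⊤ := by
  have hc := Real.cosh_pos β
  have h4 : (1 / 4 : ℝ) = Real.exp (-(2 * Real.log 2)) := by
    rw [Real.exp_neg, two_mul, Real.exp_add, Real.exp_log two_pos]
    norm_num
  rcases lt_max_iff.1 h with h | h
  · refine exists_partitionFunction_eq_top_of_le
      (K := 2 * Real.exp (μ * (1 : ℕ)) / Real.cosh β ^ 1) (by positivity) ?_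
      fun N x => x.cosh_pow_total_le_weight one_pos h0 μ
    have h3 : Real.exp (Real.log 2 + 3 * Real.log (Real.cosh β) - 2 * μ) =
        2 * Real.cosh β ^ 3 * Real.exp (-2 * μ) := by
      rw [sub_eq_add_neg, Real.exp_add, Real.exp_add, Real.exp_log two_pos,
        show (3 : ℝ) = (3 : ℕ) by norm_num, Real.exp_nat_mul, Real.exp_log hc, neg_mul]
    rw [← h3, h4, Real.exp_lt_exp]
    linarith
  · refine exists_partitionFunction_eq_top_of_le (by positivity) ?_
      fun N x => x.exp_pow_total_le_weight one_pos β μ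
    rw [h4, Real.exp_lt_exp]
    linarith

theorem partitionFunction_upperLine_lt_top {N m : ℕ} (hm : 0 < m) {β : ℝ} (h0 : 0 ≤ β) :
    partitionFunction (N + 1) m β (upperLine β) < ⊤ := by
  refine partitionFunction_lt_top hm h0 (le_of_eq ?_)
  have hc := Real.cosh_pos β
  have h : 2 * β - 2 * upperLine β = -(3 * Real.log 2 + Real.log (Real.cosh β)) := by
    rw [upperLine]; ring
  rw [h, Real.exp_neg, Real.exp_add, Real.exp_log hc, show (3 : ℝ) = (3 : ℕ) by norm_num,
    Real.exp_nat_mul, Real.exp_log two_pos]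
  field_simp
  norm_num

/-- A triangulation is extended by one slice of any given size. -/
theorem partitionFunction_lt_top_of_succ {N l m : ℕ} (hl : 0 < l) (hm : 0 < m) {β μ : ℝ}
    (h0 : 0 ≤ β) (h : partitionFunction (N + 2) m β μ < ⊤) :
    partitionFunction (N + 1) l β μ < ⊤ := by
  obtain ⟨n, rfl⟩ : ∃ n, l = n + 1 := ⟨l - 1, by omega⟩
  obtain ⟨S, hS⟩ : (Finset.powersetCard m (Finset.range (n + m))).Nonempty :=
    Finset.powersetCard_nonempty.2 (by rw [Finset.card_range]; omega)
  let f : Code N (n + 1) → Code (N + 1) m := fun y => ⟨n, y, S, hS⟩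
  have hf : f.Injective := fun y y' hy =>
    congrArg Prod.fst (eq_of_heq (Sigma.mk.inj hy).2)
  set c := Real.exp (-(β * (n + 1 + m + m : ℕ))) * Real.exp (-μ * (n + 1 + m : ℕ)) with hc
  have hc0 : 0 < c := by positivity
  have h1 : ENNReal.ofReal c * partitionFunction (N + 1) (n + 1) β μ ≤
      partitionFunction (N + 2) m β μ := by
    rw [partitionFunction_eq hl, partitionFunction_eq hm, ← ENNReal.tsum_mul_left]
    refine le_trans (ENNReal.tsum_le_tsum fun y => ?_) (ENNReal.tsum_comp_le_tsum_of_injective hf _)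
    rw [← ENNReal.ofReal_mul hc0.le]
    exact ENNReal.ofReal_le_ofReal ((f y).weight_extend hm h0 μ)
  exact lt_top_iff_ne_top.2 fun htop => by
    rw [htop, ENNReal.mul_top (ENNReal.ofReal_pos.2 hc0).ne'] at h1
    exact (h1.trans_lt h).ne rfl

theorem criticalValue_le_succ {N l m : ℕ} (hl : 0 < l) (hm : 0 < m) {β : ℝ} (h0 : 0 ≤ β) :
    criticalValue (N + 1) l β ≤ criticalValue (N + 2) m β := by
  refine sInf_le_sInf ?_
  rintro x ⟨μ, rfl, h⟩
  exact ⟨μ, rfl, partitionFunction_lt_top_of_succ hl hm h0 h⟩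

theorem criticalValue_mono {N : ℕ} {β β' : ℝ} (h0 : 0 ≤ β) (h : β ≤ β') :
    criticalValue (N + 1) 1 β ≤ criticalValue (N + 1) 1 β' := by
  refine sInf_le_sInf ?_
  rintro x ⟨μ, rfl, hμ⟩
  exact ⟨μ, rfl, (partitionFunction_mono one_pos h0 h μ).trans_lt hμ⟩

theorem criticalValue_le_upperLine {N m : ℕ} (hm : 0 < m) {β : ℝ} (h0 : 0 ≤ β) :
    criticalValue (N + 1) m β ≤ upperLine β :=
  sInf_le ⟨_, rfl, partitionFunction_upperLine_lt_top hm h0⟩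

theorem exists_le_criticalValue {β μ : ℝ} (h0 : 0 ≤ β) (h : μ < lowerLine β) :
    ∃ N, (μ : EReal) ≤ criticalValue (N + 1) 1 β := by
  obtain ⟨N, hN⟩ := exists_partitionFunction_eq_top h0 h
  refine ⟨N, le_sInf ?_⟩
  rintro x ⟨μ', rfl, hμ'⟩
  by_contra! hlt
  have := partitionFunction_antitone (N := N) one_pos β (EReal.coe_lt_coe_iff.1 hlt).le
  rw [hN] at this
  exact (this.trans_lt hμ').ne rfl

theorem monotone_criticalValue {β : ℝ} (h0 : 0 ≤ β) :
    Monotone fun N : ℕ => criticalValue (N + 1) 1 β :=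
  monotone_nat_of_le_succ fun _ => criticalValue_le_succ one_pos one_pos h0

theorem lowerLine_le_iSup {β : ℝ} (h0 : 0 ≤ β) :
    (lowerLine β : EReal) ≤ ⨆ N : ℕ, criticalValue (N + 1) 1 β := by
  refine EReal.ge_of_forall_gt_iff_ge.1 fun μ hμ => ?_
  obtain ⟨N, hN⟩ := exists_le_criticalValue h0 (EReal.coe_lt_coe_iff.1 hμ)
  exact hN.trans (le_iSup (fun N : ℕ => criticalValue (N + 1) 1 β) N)

theorem coe_criticalLine {β : ℝ} (h0 : 0 ≤ β) :
    (criticalLine β : EReal) = ⨆ N : ℕ, criticalValue (N + 1) 1 β := by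
  have h1 : Tendsto (fun N : ℕ => criticalValue N 1 β) atTop
      (𝓝 (⨆ N : ℕ, criticalValue (N + 1) 1 β)) :=
    (tendsto_add_atTop_iff_nat 1).1 (tendsto_atTop_iSup (monotone_criticalValue h0))
  rw [criticalLine, h1.limUnder_eq]
  refine EReal.coe_toReal (fun h => ?_) (fun h => ?_)
  · have h2 : (⨆ N : ℕ, criticalValue (N + 1) 1 β) ≤ upperLine β :=
      iSup_le fun N => criticalValue_le_upperLine one_pos h0
    rw [h] at h2
    exact EReal.coe_ne_top _ (top_le_iff.1 h2)
  · have h2 := lowerLine_le_iSup h0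
    rw [h] at h2
    exact EReal.coe_ne_bot _ (le_bot_iff.1 h2)

theorem tendsto_criticalValue {β : ℝ} (h0 : 0 ≤ β) {l : ℕ} (hl : 0 < l) :
    Tendsto (fun N : ℕ => criticalValue N l β) atTop (𝓝 (criticalLine β : EReal)) := by
  have h1 : Tendsto (fun N : ℕ => criticalValue (N + 1) 1 β) atTop (𝓝 (criticalLine β : EReal)) := by
    rw [coe_criticalLine h0]
    exact tendsto_atTop_iSup (monotone_criticalValue h0)
  refine (tendsto_add_atTop_iff_nat 2).1 ?_
  exact tendsto_of_tendsto_of_tendsto_of_le_of_le h1 ((tendsto_add_atTop_iff_nat 2).2 h1)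
    (fun N => criticalValue_le_succ one_pos hl h0) (fun N => criticalValue_le_succ hl one_pos h0)

theorem lowerLine_le_criticalLine {β : ℝ} (h0 : 0 ≤ β) : lowerLine β ≤ criticalLine β := by
  rw [← EReal.coe_le_coe_iff, coe_criticalLine h0]
  exact lowerLine_le_iSup h0

theorem criticalLine_le_upperLine {β : ℝ} (h0 : 0 ≤ β) : criticalLine β ≤ upperLine β := by
  rw [← EReal.coe_le_coe_iff, coe_criticalLine h0]
  exact iSup_le fun N => criticalValue_le_upperLine one_pos h0

theorem monotoneOn_criticalLine : MonotoneOn criticalLine (Set.Ici 0) := by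
  intro β h0 β' h0' h
  rw [← EReal.coe_le_coe_iff, coe_criticalLine h0, coe_criticalLine h0']
  exact iSup_mono fun N => criticalValue_mono h0 h

theorem log_cosh_le {β : ℝ} :
    Real.log (Real.cosh β) ≤ β - Real.log 2 + Real.exp (-2 * β) := by
  have h : Real.cosh β = Real.exp β * (1 + Real.exp (-2 * β)) / 2 := by
    rw [Real.cosh_eq, mul_add, mul_one, ← Real.exp_add]
    ring_nf
  have h1 : 0 < 1 + Real.exp (-2 * β) := by positivity
  rw [h, Real.log_div (by positivity) two_ne_zero, Real.log_mul (Real.exp_ne_zero _) h1.ne',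
    Real.log_exp]
  linarith [Real.log_le_sub_one_of_pos h1]

theorem criticalLine_isBigO_atTop :
    (fun β : ℝ => criticalLine β - (Real.log 2 + 3 / 2 * β))
      =O[atTop] (fun β : ℝ => Real.exp (-2 * β)) := by
  refine IsBigO.of_bound 1 ?_
  filter_upwards [eventually_ge_atTop 0] with β h0
  have h1 := (le_max_right _ _).trans (lowerLine_le_criticalLine h0)
  have h2 := criticalLine_le_upperLine h0
  have h3 := log_cosh_le (β := β)
  have h4 := Real.exp_pos (-2 * β)
  rw [upperLine] at h2
  rw [Real.norm_of_nonneg (by linarith), Real.norm_of_nonneg h4.le]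
  linarith

theorem criticalLine_isBigO_zero :
    (fun β : ℝ => criticalLine β - 3 / 2 * Real.log 2) =O[𝓝[≥] 0] (fun β : ℝ => β) := by
  refine IsBigO.of_bound (3 / 2) ?_
  filter_upwards [self_mem_nhdsWithin] with β h0
  have h0 : 0 ≤ β := h0
  have h1 := (le_max_left _ _).trans (lowerLine_le_criticalLine h0)
  have h2 := criticalLine_le_upperLine h0
  have h3 : 0 ≤ Real.log (Real.cosh β) := Real.log_nonneg (Real.one_le_cosh β)
  have h4 : Real.log (Real.cosh β) ≤ β := by
    rw [Real.log_le_iff_le_exp (Real.cosh_pos β), ← Real.cosh_add_sinh]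
    linarith [Real.sinh_nonneg_iff.2 h0]
  rw [upperLine] at h2
  rw [Real.norm_of_nonneg (by linarith), Real.norm_of_nonneg h0]
  linarith

end

end CDT

/-- The first clause says that the limit defining the critical line exists, is finite and does not
depend on `l`. -/
theorem theorem2 :
    (∀ β : ℝ, 0 ≤ β → ∀ l : ℕ, 1 ≤ l →
      Tendsto (fun N : ℕ => CDT.criticalValue N l β) atTop (𝓝 (CDT.criticalLine β : EReal))) ∧
    MonotoneOn CDT.criticalLine (Set.Ici 0) ∧
    {β : ℝ | 0 ≤ β ∧ ¬ ContinuousWithinAt CDT.criticalLine (Set.Ici 0) β}.Countable ∧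
    (∀ β : ℝ, 0 ≤ β →
      max (3 / 2 * Real.log 2 + 3 / 2 * Real.log (Real.cosh β)) (Real.log 2 + 3 / 2 * β)
          ≤ CDT.criticalLine β ∧
        CDT.criticalLine β ≤ 3 / 2 * Real.log 2 + β + 1 / 2 * Real.log (Real.cosh β)) ∧
    (fun β : ℝ => CDT.criticalLine β - (Real.log 2 + 3 / 2 * β))
      =O[atTop] (fun β : ℝ => Real.exp (-2 * β)) ∧
    (fun β : ℝ => CDT.criticalLine β - 3 / 2 * Real.log 2) =O[𝓝[≥] 0] (fun β : ℝ => β) := by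
  refine ⟨fun β h0 l hl => CDT.tendsto_criticalValue h0 hl, CDT.monotoneOn_criticalLine,
    CDT.monotoneOn_criticalLine.countable_not_continuousWithinAt,
    fun β h0 => ⟨CDT.lowerLine_le_criticalLine h0, CDT.criticalLine_le_upperLine h0⟩,
    CDT.criticalLine_isBigO_atTop, CDT.criticalLine_isBigO_zero⟩
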